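/- An analytic field is a field that is complete with respect to a nonarchimedean real-valued absolute value (possibly trivial); an extension of analytic fields is one whose absolute values are compatible. For an analytic field $L$ let $\widehat{L^a}$ be the completion of an algebraic closure of $L$ with respect to the unique extension of the absolute value. For an extension $L/k$ of analytic fields, a subset $S\subseteq L$ is called topologically-algebraically generating over $k$ if $\widehat{k(S)^a}=\widehat{L^a}$, where $\widehat{k(S)^a}$ denotes the closure in $\widehat{L^a}$ of the algebraic closure of $k(S)$ in $\widehat{L^a}$; $\mathrm{Topdeg}(L/k)$ is the minimum of the cardinalities of such subsets $S$. Theorem. Let $K/k$ be an extension of analytic fields, let $\{F_i\}_{i\in I}$ be a filtered family (with respect to inclusion) of analytic (that is, complete) intermediate fields $k\subseteq F_i\subseteq K$ of at most countable cofinality, and let $F$ be the completion of $\bigcup_{i\in I}F_i$, that is, its closure in $K$. If the maximum $d=\max_{i\in I}\mathrm{Topdeg}(F_i/k)$ exists and is finite, then $\mathrm{Topdeg}(F/k)=d$. -/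

import Mathlib

open Cardinal

noncomputable section

/-! An *analytic field* is a field complete with respect to a nonarchimedean absolute value with
values in `ℝ` (the trivial absolute value is allowed): `[NormedField L] [IsUltrametricDist L]
[CompleteSpace L]`. An *extension* `K/k` of analytic fields is a `[NormedAlgebra k K]`
(then `‖algebraMap k K x‖ = ‖x‖`). -/

namespace AnalyticField

section CompletedAlgClosure

variable (L : Type*) [NormedField L] [IsUltrametricDist L] [CompleteSpace L]

/-- The spectral norm on the algebraic closure of an analytic field is multiplicative, also when
the absolute value is trivial. -/
theorem spectralNorm_algClosure_mul (x y : AlgebraicClosure L) :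
    spectralNorm L (AlgebraicClosure L) (x * y) =
      spectralNorm L (AlgebraicClosure L) x * spectralNorm L (AlgebraicClosure L) y := by
  by_cases h : ∃ a : L, 1 < ‖a‖
  · let _ : NontriviallyNormedField L := { (inferInstance : NormedField L) with non_trivial := h }
    exact spectralAlgNorm_mul (K := L) (L := AlgebraicClosure L) x y
  · push Not at h
    have hle : ∀ z : AlgebraicClosure L, spectralNorm L (AlgebraicClosure L) z ≤ 1 := fun z =>
      (spectralValue_le_one_iff (minpoly.monic (Algebra.IsAlgebraic.isAlgebraic z).isIntegral)).2
        fun n => h _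
    have hone : ∀ z : AlgebraicClosure L, z ≠ 0 → spectralNorm L (AlgebraicClosure L) z = 1 := by
      intro z hz
      refine le_antisymm (hle z) ?_
      have h1 : spectralNorm L (AlgebraicClosure L) (z * z⁻¹) ≤
          spectralNorm L (AlgebraicClosure L) z * spectralNorm L (AlgebraicClosure L) z⁻¹ :=
        spectralNorm_mul (Algebra.IsAlgebraic.isAlgebraic z) (Algebra.IsAlgebraic.isAlgebraic z⁻¹)
      rw [mul_inv_cancel₀ hz, spectralNorm_one] at h1
      nlinarith [hle z, hle z⁻¹, spectralNorm_nonneg (K := L) z,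
        spectralNorm_nonneg (K := L) z⁻¹]
    by_cases hx : x = 0
    · simp [hx, spectralNorm_zero]
    by_cases hy : y = 0
    · simp [hy, spectralNorm_zero]
    rw [hone _ (mul_ne_zero hx hy), hone x hx, hone y hy, one_mul]

/-- The algebraic closure `Lᵃ` of an analytic field `L`, as a type that carries the norm below. -/
def AlgClosure : Type _ := AlgebraicClosure L

instance : Field (AlgClosure L) := inferInstanceAs (Field (AlgebraicClosure L))

instance : Algebra L (AlgClosure L) := inferInstanceAs (Algebra L (AlgebraicClosure L))

instance : IsAlgClosure L (AlgClosure L) :=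
  inferInstanceAs (IsAlgClosure L (AlgebraicClosure L))

instance : Algebra.IsAlgebraic L (AlgClosure L) :=
  inferInstanceAs (Algebra.IsAlgebraic L (AlgebraicClosure L))

/-- The unique extension to `Lᵃ` of the absolute value of `L`: the spectral norm. -/
instance : NormedField (AlgClosure L) :=
  { (inferInstance : Field (AlgClosure L)) with
    norm := fun x => spectralNorm L (AlgClosure L) x
    dist := fun x y => spectralNorm L (AlgClosure L) (x - y)
    dist_self := fun x => by simp [spectralNorm_zero]
    dist_comm := fun x y => by
      rw [← neg_sub, spectralNorm_neg (Algebra.IsAlgebraic.isAlgebraic _)]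
    dist_triangle := fun x y z =>
      sub_add_sub_cancel x y z ▸ isNonarchimedean_spectralNorm.add_le spectralNorm_nonneg
    eq_of_dist_eq_zero := fun {x y} hxy => by
      rw [← sub_eq_zero]
      exact eq_zero_of_map_spectralNorm_eq_zero hxy (Algebra.IsAlgebraic.isAlgebraic _)
    dist_eq := fun x y => by
      rw [← spectralNorm_neg (Algebra.IsAlgebraic.isAlgebraic _), sub_eq_add_neg, neg_add, neg_neg]
    norm_mul := fun x y => spectralNorm_algClosure_mul L x y }

instance : NormedAlgebra L (AlgClosure L) :=
  { (inferInstance : Algebra L (AlgClosure L)) with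
    norm_smul_le := fun r x =>
      (spectralNorm_smul r (Algebra.IsAlgebraic.isAlgebraic x)).le }

/-- The completed algebraic closure of `L`: the completion of `Lᵃ`, an analytic extension
of `L`. -/
abbrev CompletedAlgClosure : Type _ := UniformSpace.Completion (AlgClosure L)

end CompletedAlgClosure

/-- For a subfield `E` of a normed field `Ω`: the topological closure in `Ω` of the algebraic
closure of `E` in `Ω`. When `Ω` is complete and algebraically closed, this is the completed
algebraic closure of `E`. -/
def completedAlgClosureIn {Ω : Type*} [NormedField Ω] (E : Subfield Ω) : Subfield Ω :=
  (algebraicClosure E Ω).toSubfield.topologicalClosure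

section Topdeg

variable (k : Type*) {L : Type*} [Field k] [NormedField L] [IsUltrametricDist L]
  [CompleteSpace L] [Algebra k L]

/-- `S ⊆ L` is topologically-algebraically generating over `k`: inside the completed algebraic
closure of `L`, the completed algebraic closure of `k(S)` is everything. -/
def IsTAGenerating (S : Set L) : Prop :=
  completedAlgClosureIn
    ((IntermediateField.adjoin k S).toSubfield.map (algebraMap L (CompletedAlgClosure L))) = ⊤

variable (L) in
/-- The topological generating degree `Topdeg(L/k)`: the minimum of the cardinals of the
topologically-algebraically generating subsets of `L` over `k`. -/
def Topdeg : Cardinal :=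
  sInf {c : Cardinal | ∃ S : Set L, IsTAGenerating k S ∧ #S = c}

end Topdeg

section CompletedUnion

variable {k K : Type*} [NormedField k] [NormedField K] [NormedAlgebra k K]

/-- The closure in `K` of an intermediate field of `K/k`; it is the completion of that field when
`K` is complete. -/
def closureIn (E : IntermediateField k K) : IntermediateField k K :=
  { E.toSubfield.topologicalClosure with
    algebraMap_mem' := fun x => subset_closure (E.algebraMap_mem x) }

theorem coe_closureIn (E : IntermediateField k K) : (closureIn E : Set K) = closure (E : Set K) :=
  rfl

/-- The completion of the union of a nonempty directed family of intermediate fields of `K/k`,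
realized in the complete field `K`. -/
def completedUnion {ι : Type*} (F : ι → IntermediateField k K) : IntermediateField k K :=
  closureIn (⨆ i, F i)

theorem coe_completedUnion {ι : Type*} [Nonempty ι] (F : ι → IntermediateField k K)
    (hF : Directed (· ≤ ·) F) :
    (completedUnion F : Set K) = closure (⋃ i, (F i : Set K)) := by
  rw [completedUnion, coe_closureIn, IntermediateField.coe_iSup_of_directed hF]

instance [CompleteSpace K] {ι : Type*} (F : ι → IntermediateField k K) :
    CompleteSpace (completedUnion F) :=
  (isClosed_closure (s := ((⨆ i, F i : IntermediateField k K) : Set K))).completeSpace_coe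

end CompletedUnion

end AnalyticField

end

/-! ### Locating roots from the sizes of coefficients. -/

noncomputable section

namespace AnalyticField

open Polynomial

section RootNorms

variable {W : Type*} [NormedField W] [IsUltrametricDist W]

/-! Everything is placed in one complete algebraically closed ultrametric field `W`, the completed
algebraic closure of `K`. There `taClosure S` is the topological closure of the algebraic closure of
the field generated by `S`. It is a closure operator, and by `isTAGenerating_iff_of_isometry`
generation does not depend on the ambient field, so the theorem becomes a statement about generating
`d`-tuples in `W`.

The engine is a weak form of exchange, `mem_taClosure_or_mem_taClosure`: if `y₁` and `y₂` lie in the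
closure of `A ∪ {x}`, then one of them lies in the closure of `A` and the other. By induction, a
finite set inside the closure of `n` elements is generated by at most `n` of its own members
(`exists_generating_subset`). Hence finite degrees are monotone, which gives `≥`. For `≤`, a
generating tuple of a nontrivially valued field can be moved into any prescribed ball
(`exists_generating_near`), and being within `ε` of the algebraic closure of the field generated by
a tuple is an open condition on the tuple (`isOpen_near`). Baire's theorem for `d`-tuples in the
completed union, along a countable cofinal subfamily, then yields one tuple that generates every
member. If all members are trivially valued, topological generation inside them is algebraic
generation, and the classical dimension argument applies.

For weak exchange, let `k` be the closure of `A`, and approximate `y₁`, `y₂` by elements `z₁`, `z₂`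
algebraic over `k(x)`. It suffices to show, for each `ε`, that one of the `yᵢ` is within `ε` of an
element algebraic over `k` and the other one. If `k` is nontrivially valued, an ultrapower makes it
spherically complete with every positive real as a value, and approximations descend again. Then
`k(z₁, z₂)` contains a `t` over which its residue field extension is separable. The stability
theorem (`finrank_le_finrank_red`) excludes defect, and Hensel's lemma expands `z₁`, `z₂` as bounded
power series `F₁`, `F₂` on the open disc of radius `‖t‖`, algebraic over `k(t + X)`, with constant
terms `z₁`, `z₂`.

If `zᵢ` is farther than `ε` from `k`, then `Fᵢ` moves by more than `ε` on this disc
(`exists_coeff_gt`). Let `sᵢ` be the radius at which `Fᵢ` moves by exactly `ε`. If `s₁ ≤ s₂`, solve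
`F₁(u) = y₁` with `‖u‖ ≤ s₁`: then `F₂(u)` is algebraic over `k(y₁)` and within `ε` of `z₂`. If `s₂
≤ s₁`, exchange the roles. When `k` is trivially valued but the one-dimensional extension is not,
Laurent polynomials in a uniformizer take the place of the stability theorem; when both are
trivially valued, exchange is the classical one. -/

theorem coeff_mul_pow_lt_of_forall_lt_norm_aux (s : ℝ) (hs : 0 ≤ s) (l : W) (hl : l ≠ 0)
    (m : Multiset W) (h : ∀ u ∈ m, s < ‖u‖) :
    (C l * (m.map fun a => X - C a).prod).coeff 0 ≠ 0 ∧ ∀ j, 1 ≤ j →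
      ‖(C l * (m.map fun a => X - C a).prod).coeff j‖ * s ^ j <
        ‖(C l * (m.map fun a => X - C a).prod).coeff 0‖ := by
  induction m using Multiset.induction_on with
  | empty =>
    refine ⟨by simpa using hl, fun j hj => ?_⟩
    simp [coeff_C, Nat.one_le_iff_ne_zero.mp hj, hl]
  | cons a m ih =>
    obtain ⟨h0, ih⟩ := ih fun u hu => h u (Multiset.mem_cons_of_mem hu)
    have ha := h a (Multiset.mem_cons_self a m)
    set q := C l * (m.map fun a => X - C a).prod with hq
    have hqa : C l * ((a ::ₘ m).map fun a => X - C a).prod = (X - C a) * q := by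
      simp only [Multiset.map_cons, Multiset.prod_cons, hq]; ring
    rw [hqa]
    have hc0 : ((X - C a) * q).coeff 0 = -(a * q.coeff 0) := by
      simp [sub_mul]
    have ha0 : a ≠ 0 := by
      intro h'; rw [h', norm_zero] at ha; linarith
    refine ⟨by rw [hc0]; simp [ha0, h0], fun j hj => ?_⟩
    obtain ⟨i, rfl⟩ : ∃ i, j = i + 1 := ⟨j - 1, by omega⟩
    have hcj : ((X - C a) * q).coeff (i + 1) = q.coeff i - a * q.coeff (i + 1) := by
      simp [sub_mul, coeff_X_mul]
    rw [hc0, hcj, norm_neg, norm_mul]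
    have h0' : 0 < ‖q.coeff 0‖ := norm_pos_iff.mpr h0
    have hmax : ‖q.coeff i - a * q.coeff (i + 1)‖ ≤ max ‖q.coeff i‖ ‖a * q.coeff (i + 1)‖ := by
      rw [sub_eq_add_neg, ← norm_neg (a * q.coeff (i + 1))]
      exact IsUltrametricDist.norm_add_le_max _ _
    have hi : ‖q.coeff i‖ * s ^ i ≤ ‖q.coeff 0‖ := by
      rcases Nat.eq_zero_or_pos i with rfl | hi
      · simp
      · exact (ih i hi).le
    have h1 : ‖q.coeff i‖ * s ^ (i + 1) < ‖a‖ * ‖q.coeff 0‖ := by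
      calc ‖q.coeff i‖ * s ^ (i + 1) = (‖q.coeff i‖ * s ^ i) * s := by ring
        _ ≤ ‖q.coeff 0‖ * s := by gcongr
        _ < ‖q.coeff 0‖ * ‖a‖ := by gcongr
        _ = _ := mul_comm _ _
    have h2 : ‖a * q.coeff (i + 1)‖ * s ^ (i + 1) < ‖a‖ * ‖q.coeff 0‖ := by
      rw [norm_mul, mul_assoc]
      have := ih (i + 1) hj
      have ha' : 0 < ‖a‖ := norm_pos_iff.mpr ha0
      gcongr
    rcases max_cases ‖q.coeff i‖ ‖a * q.coeff (i + 1)‖ with ⟨h, -⟩ | ⟨h, -⟩ <;> rw [h] at hmax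
    · exact (mul_le_mul_of_nonneg_right hmax (by positivity)).trans_lt h1
    · exact (mul_le_mul_of_nonneg_right hmax (by positivity)).trans_lt h2

/-- A split polynomial whose constant term is dominated by another term on the circle of radius
`s` has a root in the disc of radius `s`. -/
theorem exists_root_norm_le {q : W[X]} (hq : q.Splits) {s : ℝ} (hs : 0 ≤ s)
    (h : ∃ j, 1 ≤ j ∧ ‖q.coeff 0‖ ≤ ‖q.coeff j‖ * s ^ j) : ∃ u, q.IsRoot u ∧ ‖u‖ ≤ s := by
  by_cases hq0 : q = 0
  · exact ⟨0, by simp [hq0], by simpa using hs⟩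
  by_contra! hr
  have := coeff_mul_pow_lt_of_forall_lt_norm_aux s hs q.leadingCoeff (by simpa using hq0) q.roots
    fun u hu => hr u (isRoot_of_mem_roots hu)
  rw [← hq.eq_prod_roots] at this
  obtain ⟨j, hj, hle⟩ := h
  exact absurd (this.2 j hj) (not_lt.mpr hle)

/-- If a nonzero polynomial has a root in the open disc of radius `ε` then the constant term is
dominated by another term on the circle of radius `ε`. -/
theorem exists_coeff_lt_of_isRoot {q : W[X]} (hq0 : q ≠ 0) {v : W} (hv : q.IsRoot v) {ε : ℝ}
    (hε : ‖v‖ < ε) : ∃ j, 1 ≤ j ∧ ‖q.coeff 0‖ < ‖q.coeff j‖ * ε ^ j := by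
  have hε0 : 0 < ε := (norm_nonneg v).trans_lt hε
  by_contra! h
  by_cases h0 : q.coeff 0 = 0
  · refine hq0 (Polynomial.ext fun j => ?_)
    rcases Nat.eq_zero_or_pos j with rfl | hj
    · simpa using h0
    · have := h j hj
      rw [h0, norm_zero] at this
      have h1 : 0 < ε ^ j := by positivity
      have : ‖q.coeff j‖ = 0 := by nlinarith [norm_nonneg (q.coeff j)]
      simpa using this
  have hsum : q.coeff 0 = -∑ j ∈ Finset.range q.natDegree, q.coeff (j + 1) * v ^ (j + 1) := by
    have := hv
    rw [IsRoot.def, eval_eq_sum_range, Finset.sum_range_succ'] at this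
    simp only [pow_zero, mul_one] at this
    exact (neg_eq_of_add_eq_zero_right this).symm
  have h0' : 0 < ‖q.coeff 0‖ := norm_pos_iff.mpr h0
  -- If no term dominates at radius `ε`, each nonconstant term at `v` is at most `‖v‖ / ε` times the
  -- constant term. These terms sum to minus the constant term, which would then be smaller than
  -- itself.
  have hlt : ‖q.coeff 0‖ * (‖v‖ / ε) < ‖q.coeff 0‖ := by
    have : ‖v‖ / ε < 1 := (div_lt_one hε0).mpr hε
    nlinarith
  refine absurd ?_ (not_le.mpr hlt)
  conv_lhs => rw [hsum, norm_neg]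
  refine IsUltrametricDist.norm_sum_le_of_forall_le_of_nonneg (by positivity) fun j _ => ?_
  have hj := h (j + 1) (by omega)
  rw [norm_mul, norm_pow]
  have hd : 0 ≤ ‖v‖ / ε := by positivity
  calc ‖q.coeff (j + 1)‖ * ‖v‖ ^ (j + 1)
      = (‖q.coeff (j + 1)‖ * ε ^ (j + 1)) * (‖v‖ / ε) ^ (j + 1) := by
        rw [div_pow, mul_assoc, mul_div_cancel₀ _ (by positivity)]
    _ ≤ ‖q.coeff 0‖ * (‖v‖ / ε) ^ (j + 1) := by gcongr
    _ ≤ ‖q.coeff 0‖ * (‖v‖ / ε) := by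
        gcongr
        exact pow_le_of_le_one hd ((div_le_one hε0).mpr hε.le) (by omega)

/-- The value at `b` is the leading coefficient times the product of the differences between `b` and
the roots, so the nearest root is no farther than the geometric mean. Here the top Taylor
coefficient at `b` is the dominating term. -/
theorem exists_root_norm_sub_le {q : W[X]} (hq : q.Splits) (hd : 1 ≤ q.natDegree) {b : W} {η : ℝ}
    (hη : 0 ≤ η) (h : ‖q.eval b‖ ≤ ‖q.leadingCoeff‖ * η ^ q.natDegree) :
    ∃ u, q.IsRoot u ∧ ‖u - b‖ ≤ η := by
  obtain ⟨u, hu, hun⟩ := exists_root_norm_le (q := taylor b q) (hq.taylor b) hη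
    ⟨q.natDegree, hd, by rwa [taylor_coeff_zero, coeff_taylor_natDegree]⟩
  exact ⟨u + b, by rw [IsRoot.def] at hu ⊢; rwa [taylor_eval] at hu, by simpa using hun⟩

/-- A complete ultrametric field with a dense algebraically closed subfield is algebraically
closed. -/
theorem isAlgClosed_of_denseRange {D : Type*} [Field D] [IsAlgClosed D] [CompleteSpace W]
    (f : D →+* W) (hf : DenseRange f) : IsAlgClosed W := by
  refine IsAlgClosed.of_exists_root _ fun p hp hirr => ?_
  set d := p.natDegree with hd
  have hd1 : 1 ≤ d := hirr.natDegree_pos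
  have happ : ∀ δ > (0 : ℝ), ∃ g : D[X], g.Monic ∧ g.natDegree = d ∧
      ∀ i, ‖(g.map f).coeff i - p.coeff i‖ ≤ δ := by
    intro δ hδ
    have := fun i => hf.exists_dist_lt (p.coeff i) hδ
    choose a ha using this
    set g : D[X] := X ^ d + ∑ i ∈ Finset.range d, C (a i) * X ^ i with hg
    have hlt : (∑ i ∈ Finset.range d, C (a i) * X ^ i).degree < (d : WithBot ℕ) := by
      rw [degree_lt_iff_coeff_zero]
      intro m hm
      simp only [finsetSum_coeff, coeff_C_mul, coeff_X_pow]
      refine Finset.sum_eq_zero fun i hi => ?_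
      rw [if_neg (by have := Finset.mem_range.mp hi; omega), mul_zero]
    refine ⟨g, monic_X_pow_add hlt, natDegree_eq_of_degree_eq_some ?_, fun i => ?_⟩
    · rw [hg, degree_add_eq_left_of_degree_lt (by rwa [degree_X_pow]), degree_X_pow]
    · rw [coeff_map]
      rcases lt_trichotomy i d with h | h | h
      · have : g.coeff i = a i := by
          simp only [hg, coeff_add, coeff_X_pow, finsetSum_coeff, coeff_C_mul]
          rw [if_neg h.ne, Finset.sum_eq_single i]
          · simp
          · intro j _ hj; simp [hj.symm]
          · intro hi; simp [h] at hi
        rw [this, ← dist_eq_norm, dist_comm]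
        exact (ha i).le
      · have h1 : g.coeff i = 1 := by
          simp only [hg, coeff_add, coeff_X_pow, finsetSum_coeff, coeff_C_mul]
          rw [if_pos h, Finset.sum_eq_zero, add_zero]
          intro j hj
          rw [if_neg (by have := Finset.mem_range.mp hj; omega), mul_zero]
        rw [h1, h, hd, hp.coeff_natDegree, map_one, sub_self, norm_zero]
        exact hδ.le
      · have h1 : g.coeff i = 0 := by
          simp only [hg, coeff_add, coeff_X_pow, finsetSum_coeff, coeff_C_mul]
          rw [if_neg h.ne', Finset.sum_eq_zero, add_zero]
          intro j hj
          rw [if_neg (by have := Finset.mem_range.mp hj; omega), mul_zero]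
        rw [h1, coeff_eq_zero_of_natDegree_lt h, map_zero, sub_self, norm_zero]
        exact hδ.le
  -- a bound for all roots of the approximations
  obtain ⟨B, hB1, hB⟩ : ∃ B : ℝ, 1 ≤ B ∧ ∀ i, ‖p.coeff i‖ ≤ B := by
    refine ⟨1 + ∑ i ∈ p.support, ‖p.coeff i‖, ?_, fun i => ?_⟩
    · have := Finset.sum_nonneg fun i (_ : i ∈ p.support) => norm_nonneg (p.coeff i)
      linarith
    by_cases hi : i ∈ p.support
    · have := Finset.single_le_sum (f := fun i => ‖p.coeff i‖) (fun _ _ => norm_nonneg _) hi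
      linarith
    · rw [notMem_support_iff.mp hi, norm_zero]
      positivity
  have hroot : ∀ g : D[X], g.Monic → g.natDegree = d → (∀ i, ‖(g.map f).coeff i - p.coeff i‖ ≤ 1) →
      ∀ u : W, (g.map f).IsRoot u → ‖u‖ ≤ B := by
    intro g hg hgd hgc u hu
    by_contra! hlt
    have hu0 : 0 < ‖u‖ := by linarith
    have hsum : u ^ d = -∑ i ∈ Finset.range d, (g.map f).coeff i * u ^ i := by
      have h1 := hu
      rw [IsRoot.def, eval_eq_sum_range, hg.natDegree_map, hgd, Finset.sum_range_succ] at h1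
      have : (g.map f).coeff d = 1 := by
        rw [← hgd, ← hg.natDegree_map f, (hg.map f).coeff_natDegree]
      rw [this, one_mul] at h1
      exact eq_neg_of_add_eq_zero_right h1
    have hle : ‖u ^ d‖ ≤ B * ‖u‖ ^ (d - 1) := by
      rw [hsum, norm_neg]
      refine IsUltrametricDist.norm_sum_le_of_forall_le_of_nonneg (by positivity) fun i hi => ?_
      rw [norm_mul, norm_pow]
      have h1 : ‖(g.map f).coeff i‖ ≤ B := by
        have := IsUltrametricDist.norm_add_le_max ((g.map f).coeff i - p.coeff i) (p.coeff i)
        rw [sub_add_cancel] at this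
        exact this.trans (max_le ((hgc i).trans hB1) (hB i))
      have h2 : ‖u‖ ^ i ≤ ‖u‖ ^ (d - 1) :=
        pow_le_pow_right₀ (by linarith) (by have := Finset.mem_range.mp hi; omega)
      gcongr
    rw [norm_pow] at hle
    have : ‖u‖ ^ d = ‖u‖ * ‖u‖ ^ (d - 1) := by
      rw [← pow_succ', Nat.sub_add_cancel hd1]
    rw [this] at hle
    have := le_of_mul_le_mul_right hle (by positivity)
    linarith
  have heval : ∀ h : W[X], h.natDegree ≤ d → ∀ δ : ℝ, 0 ≤ δ → (∀ i, ‖h.coeff i‖ ≤ δ) →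
      ∀ u : W, ‖u‖ ≤ B → ‖h.eval u‖ ≤ δ * B ^ d := by
    intro h hhd δ hδ hc u hu
    rw [eval_eq_sum_range]
    refine IsUltrametricDist.norm_sum_le_of_forall_le_of_nonneg (by positivity) fun i hi => ?_
    rw [norm_mul, norm_pow]
    have h2 : ‖u‖ ^ i ≤ B ^ d := (pow_le_pow_left₀ (norm_nonneg _) hu i).trans
      (pow_le_pow_right₀ hB1 (by have := Finset.mem_range.mp hi; omega))
    have := hc i
    gcongr
  -- With this precision the `n + 1`st approximation has value at most `((1 / 2) ^ n) ^ d` at a root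
  -- of the `n`th one, so by `exists_root_norm_sub_le` it has a root within `(1 / 2) ^ n`. Roots
  -- followed in this way form a Cauchy sequence.
  have hδpos : ∀ n : ℕ, (0 : ℝ) < (1 / 2) ^ (n * d) / B ^ d := fun n => by positivity
  have hδle : ∀ n : ℕ, (1 / 2 : ℝ) ^ (n * d) / B ^ d ≤ 1 := fun n => by
    rw [div_le_one (by positivity)]
    exact (pow_le_one₀ (by norm_num) (by norm_num)).trans (one_le_pow₀ hB1)
  choose g hgm hgd hgc using fun n : ℕ => happ _ (hδpos n)
  have hsplit : ∀ n, ((g n).map f).Splits := fun n => (IsAlgClosed.splits (g n)).map f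
  have hgc1 : ∀ n i, ‖((g n).map f).coeff i - p.coeff i‖ ≤ 1 := fun n i =>
    (hgc n i).trans (hδle n)
  have hdm : ∀ n, ((g n).map f).natDegree = d := fun n => by rw [(hgm n).natDegree_map, hgd]
  have hstep : ∀ n (u : W), ((g n).map f).IsRoot u →
      ∃ v, ((g (n + 1)).map f).IsRoot v ∧ ‖v - u‖ ≤ (1 / 2) ^ n := by
    intro n u hu
    refine exists_root_norm_sub_le (hsplit (n + 1)) (by rw [hdm]; exact hd1) (by positivity) ?_
    rw [((hgm (n + 1)).map f).leadingCoeff, norm_one, one_mul, hdm]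
    have h1 : ((g (n + 1)).map f).eval u = ((g (n + 1)).map f - (g n).map f).eval u := by
      rw [eval_sub, hu.eq_zero, sub_zero]
    rw [h1]
    refine (heval _ ?_ ((1 / 2) ^ (n * d) / B ^ d) (hδpos n).le ?_ u
      (hroot _ (hgm n) (hgd n) (hgc1 n) u hu)).trans ?_
    · exact (natDegree_sub_le _ _).trans (by rw [hdm, hdm, max_self])
    · intro i
      rw [coeff_sub]
      have h2 := IsUltrametricDist.norm_add_le_max (((g (n + 1)).map f).coeff i - p.coeff i)
        (-(((g n).map f).coeff i - p.coeff i))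
      rw [norm_neg, ← sub_eq_add_neg, sub_sub_sub_cancel_right] at h2
      refine h2.trans (max_le ((hgc (n + 1) i).trans ?_) (hgc n i))
      gcongr ?_ / _
      exact pow_le_pow_of_le_one (by norm_num) (by norm_num) (by nlinarith)
    · rw [div_mul_cancel₀ _ (by positivity), pow_mul]
  obtain ⟨u0, hu0⟩ : ∃ u, ((g 0).map f).IsRoot u := by
    refine (hsplit 0).exists_eval_eq_zero ?_
    rw [degree_eq_natDegree ((hgm 0).map f).ne_zero, hdm]
    exact_mod_cast (by omega : d ≠ 0)
  choose next hnext hnextd using hstep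
  let seq : ∀ n : ℕ, {u : W // ((g n).map f).IsRoot u} := fun n =>
    Nat.rec ⟨u0, hu0⟩ (fun n u => ⟨next n u.1 u.2, hnext n u.1 u.2⟩) n
  have hseq : ∀ n, ‖(seq (n + 1)).1 - (seq n).1‖ ≤ (1 / 2) ^ n := fun n => hnextd n _ _
  have hcau : CauchySeq fun n => (seq n).1 := by
    refine cauchySeq_of_le_geometric (1 / 2) 1 (by norm_num) fun n => ?_
    rw [dist_comm, dist_eq_norm, one_mul]
    exact hseq n
  obtain ⟨u, hu⟩ := cauchySeq_tendsto_of_complete hcau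
  refine ⟨u, ?_⟩
  have h1 : Filter.Tendsto (fun n => p.eval (seq n).1) Filter.atTop (nhds (p.eval u)) :=
    (p.continuous.tendsto u).comp hu
  have h2 : Filter.Tendsto (fun n => p.eval (seq n).1) Filter.atTop (nhds 0) := by
    refine squeeze_zero_norm (a := fun n => (1 / 2 : ℝ) ^ n) (fun n => ?_)
      (tendsto_pow_atTop_nhds_zero_of_lt_one (by norm_num) (by norm_num))
    have h3 : p.eval (seq n).1 = -((g n).map f - p).eval (seq n).1 := by
      rw [eval_sub, (seq n).2.eq_zero, zero_sub, neg_neg]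
    rw [h3, norm_neg]
    refine (heval _ ((natDegree_sub_le _ _).trans (by rw [hdm, ← hd, max_self]))
      ((1 / 2) ^ (n * d) / B ^ d) (hδpos n).le (fun i => by rw [coeff_sub]; exact hgc n i) _
      (hroot _ (hgm n) (hgd n) (hgc1 n) _ (seq n).2)).trans ?_
    rw [div_mul_cancel₀ _ (by positivity)]
    exact pow_le_pow_of_le_one (by norm_num) (by norm_num) (Nat.le_mul_of_pos_right n hd1)
  exact tendsto_nhds_unique h1 h2

end RootNorms

end AnalyticField
end

/-! ### The closure operator of topological-algebraic generation. -/

noncomputable section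

namespace AnalyticField

open Polynomial

section TAClosure

variable {W : Type*} [NormedField W]

theorem isAlgebraic_subfield_iff {E : Subfield W} {a : W} :
    IsAlgebraic E a ↔ ∃ q : W[X], q ≠ 0 ∧ (∀ n, q.coeff n ∈ E) ∧ q.IsRoot a := by
  constructor
  · rintro ⟨p, hp, hpa⟩
    refine ⟨p.map (algebraMap E W), ?_, fun n => ?_, ?_⟩
    · rwa [Ne, Polynomial.map_eq_zero]
    · rw [coeff_map]; exact (p.coeff n).2
    · rwa [IsRoot.def, eval_map_algebraMap]
  · rintro ⟨q, hq, hc, hr⟩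
    have hl : q ∈ lifts (algebraMap E W) := by
      rw [lifts_iff_coeff_lifts]
      exact fun n => ⟨⟨_, hc n⟩, rfl⟩
    obtain ⟨p, rfl⟩ := (mem_lifts _).mp hl
    exact ⟨p, by rintro rfl; simp at hq, by rwa [IsRoot.def, eval_map_algebraMap] at hr⟩

theorem exists_common_denominator (s : Set W) (t : Finset W)
    (ht : ∀ x ∈ t, x ∈ Subfield.closure s) :
    ∃ z ∈ Subring.closure s, z ≠ 0 ∧ ∀ x ∈ t, z * x ∈ Subring.closure s := by
  classical
  induction t using Finset.induction_on with
  | empty => exact ⟨1, one_mem _, one_ne_zero, by simp⟩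
  | insert x t _ ih =>
    obtain ⟨z, hz, hz0, h⟩ := ih fun y hy => ht y (Finset.mem_insert_of_mem hy)
    obtain ⟨y, hy, w, hw, hyw⟩ := Subfield.mem_closure_iff.mp (ht x (Finset.mem_insert_self _ _))
    by_cases hw0 : w = 0
    · have hx : x = 0 := by rw [← hyw, hw0, div_zero]
      refine ⟨z, hz, hz0, fun u hu => ?_⟩
      rcases Finset.mem_insert.mp hu with rfl | hu
      · rw [hx, mul_zero]; exact zero_mem _
      · exact h u hu
    · refine ⟨z * w, mul_mem hz hw, mul_ne_zero hz0 hw0, fun u hu => ?_⟩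
      rcases Finset.mem_insert.mp hu with rfl | hu
      · rw [← hyw, mul_assoc, mul_div_cancel₀ _ hw0]
        exact mul_mem hz hy
      · rw [mul_right_comm]
        exact mul_mem (h u hu) hw

/-- Clearing denominators. Elements of the generated ring are polynomial expressions in the
generators, so they vary continuously with them and follow ring homomorphisms; `isOpen_near` and
`mem_taClosure_image_iff` rest on this. -/
theorem isAlgebraic_closure_iff {s : Set W} {a : W} :
    IsAlgebraic (Subfield.closure s) a ↔
      ∃ q : W[X], q ≠ 0 ∧ (∀ n, q.coeff n ∈ Subring.closure s) ∧ q.IsRoot a := by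
  classical
  rw [isAlgebraic_subfield_iff]
  constructor
  · rintro ⟨q, hq, hc, hr⟩
    obtain ⟨z, hz, hz0, h⟩ := exists_common_denominator s (q.support.image q.coeff) (by
      intro x hx
      obtain ⟨n, -, rfl⟩ := Finset.mem_image.mp hx
      exact hc n)
    refine ⟨C z * q, mul_ne_zero (by simpa using hz0) hq, fun n => ?_, ?_⟩
    · rw [coeff_C_mul]
      by_cases hn : n ∈ q.support
      · exact h _ (Finset.mem_image_of_mem _ hn)
      · rw [notMem_support_iff.mp hn, mul_zero]; exact zero_mem _
    · rw [IsRoot.def] at hr ⊢; rw [eval_mul, hr, mul_zero]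
  · rintro ⟨q, hq, hc, hr⟩
    refine ⟨q, hq, fun n => ?_, hr⟩
    have : Subring.closure s ≤ (Subfield.closure s).toSubring :=
      Subring.closure_le.mpr Subfield.subset_closure
    exact this (hc n)

theorem mem_completedAlgClosureIn_iff {E : Subfield W} {b : W} :
    b ∈ completedAlgClosureIn E ↔ ∀ ε > 0, ∃ a, IsAlgebraic E a ∧ ‖a - b‖ < ε := by
  have : b ∈ completedAlgClosureIn E ↔ b ∈ closure (algebraicClosure E W : Set W) := Iff.rfl
  rw [this, Metric.mem_closure_iff]
  refine forall₂_congr fun ε _ => exists_congr fun a => ?_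
  rw [dist_comm, dist_eq_norm]
  exact and_congr_left fun _ => mem_algebraicClosure_iff

/-- The smallest closed subfield that contains `S` and is algebraically closed in `W`. -/
def taClosure (S : Set W) : Set W := completedAlgClosureIn (Subfield.closure S)

theorem mem_taClosure_iff {S : Set W} {b : W} : b ∈ taClosure S ↔
    ∀ ε > 0, ∃ a, IsAlgebraic (Subfield.closure S) a ∧ ‖a - b‖ < ε :=
  mem_completedAlgClosureIn_iff

theorem mem_taClosure_of_isAlgebraic {S : Set W} {b : W}
    (hb : IsAlgebraic (Subfield.closure S) b) : b ∈ taClosure S :=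
  mem_taClosure_iff.mpr fun ε hε => ⟨b, hb, by simpa using hε⟩

theorem subset_taClosure (S : Set W) : S ⊆ taClosure S := fun x hx =>
  mem_taClosure_of_isAlgebraic <|
    isAlgebraic_algebraMap (⟨x, Subfield.subset_closure hx⟩ : Subfield.closure S) (A := W)

theorem isAlgebraic_mono {E E' : Subfield W} (h : E ≤ E') {a : W} (ha : IsAlgebraic E a) :
    IsAlgebraic E' a := by
  obtain ⟨q, hq, hc, hr⟩ := isAlgebraic_subfield_iff.mp ha
  exact isAlgebraic_subfield_iff.mpr ⟨q, hq, fun n => h (hc n), hr⟩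

theorem taClosure_mono {S T : Set W} (h : S ⊆ T) : taClosure S ⊆ taClosure T := fun b hb => by
  rw [mem_taClosure_iff] at hb ⊢
  intro ε hε
  obtain ⟨a, ha, hab⟩ := hb ε hε
  exact ⟨a, isAlgebraic_mono (Subfield.closure_mono h) ha, hab⟩

theorem isAlgebraic_of_algebraicClosure {E : Subfield W} {a : W}
    (ha : IsAlgebraic (algebraicClosure E W).toSubfield a) : IsAlgebraic E a := by
  have : IsAlgebraic (algebraicClosure E W) a := ha
  exact this.restrictScalars E

variable [IsUltrametricDist W]

/-- A Taylor expansion at `b` whose constant term is dominated on the circle of radius `ε` has a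
root in the disc. Together with `exists_coeff_of_isAlgebraic_near` this turns approximability into a
strict inequality between two Taylor coefficients, which survives small perturbations, isometries
and ultralimits. -/
theorem exists_isAlgebraic_near_of_coeff {E : Subfield W} {b : W} {ε : ℝ}
    (hε : 0 < ε) {q : W[X]} (hs : q.Splits) (hc : ∀ n, q.coeff n ∈ E)
    (h : ∃ j, 1 ≤ j ∧ ‖(taylor b q).coeff 0‖ < ‖(taylor b q).coeff j‖ * ε ^ j) :
    ∃ a, IsAlgebraic E a ∧ ‖a - b‖ < ε := by
  obtain ⟨j, hj, hlt⟩ := h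
  -- The inequality is strict, so it persists at some `e < ε`; this makes the distance to the root
  -- strictly less than `ε`.
  have hcont : Filter.Tendsto (fun e : ℝ => ‖(taylor b q).coeff j‖ * e ^ j) (nhdsWithin ε (Set.Iio ε))
      (nhds (‖(taylor b q).coeff j‖ * ε ^ j)) :=
    ((by fun_prop : Continuous fun e : ℝ => ‖(taylor b q).coeff j‖ * e ^ j).tendsto ε).mono_left
      nhdsWithin_le_nhds
  obtain ⟨e, he, he0, he1⟩ := ((hcont.eventually (lt_mem_nhds hlt)).and
    (Ioo_mem_nhdsLT hε)).exists
  obtain ⟨u, hu, hun⟩ := exists_root_norm_le (hs.taylor b) he0.le ⟨j, hj, he.le⟩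
  refine ⟨u + b, isAlgebraic_subfield_iff.mpr ⟨q, ?_, hc, ?_⟩, by simpa using hun.trans_lt he1⟩
  · rintro rfl
    simp at hlt
  · rw [IsRoot.def] at hu ⊢; rwa [taylor_eval] at hu

theorem exists_coeff_of_isAlgebraic_near {s : Set W} {a b : W} {ε : ℝ}
    (ha : IsAlgebraic (Subfield.closure s) a) (hab : ‖a - b‖ < ε) :
    ∃ q : W[X], (∀ n, q.coeff n ∈ Subring.closure s) ∧
      ∃ j, 1 ≤ j ∧ ‖(taylor b q).coeff 0‖ < ‖(taylor b q).coeff j‖ * ε ^ j := by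
  obtain ⟨q, hq, hc, hr⟩ := isAlgebraic_closure_iff.mp ha
  refine ⟨q, hc, exists_coeff_lt_of_isRoot (q := taylor b q) (v := a - b) ?_ ?_ hab⟩
  · simpa using hq
  · rw [IsRoot.def, taylor_eval]; simpa using hr

/-- Continuity of roots: the criterion for a root near `a` is open in the coefficient vector, so the
coefficients can be moved from the closure into the algebraic closure of `E` itself. -/
theorem mem_completedAlgClosureIn_of_isAlgebraic [IsAlgClosed W] {E : Subfield W} {a : W}
    (ha : IsAlgebraic (completedAlgClosureIn E) a) : a ∈ completedAlgClosureIn E := by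
  rw [mem_completedAlgClosureIn_iff]
  intro ε hε
  obtain ⟨q, hq, hc, hr⟩ := isAlgebraic_subfield_iff.mp ha
  obtain ⟨j, hj, hlt⟩ := exists_coeff_lt_of_isRoot (q := taylor a q) (v := 0) (by simpa using hq)
    (by rw [IsRoot.def, taylor_eval]; simpa using hr) (by simpa using hε)
  set N := q.natDegree + 1 with hN
  let P : (Fin N → W) → W[X] := fun v => ∑ i : Fin N, C (v i) * X ^ (i : ℕ)
  have hP : P (fun i => q.coeff i) = q := by
    conv_rhs => rw [q.as_sum_range_C_mul_X_pow, Finset.sum_range]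
  have hcont : ∀ m, Continuous fun v => (taylor a (P v)).coeff m := by
    intro m
    have : (fun v => (taylor a (P v)).coeff m) =
        fun v : Fin N → W => ∑ i : Fin N, v i * (taylor a (X ^ (i : ℕ))).coeff m := by
      funext v
      simp only [P, map_sum, finsetSum_coeff, taylor_mul, taylor_C, coeff_C_mul]
    rw [this]
    fun_prop
  have hopen : IsOpen {v : Fin N → W | ‖(taylor a (P v)).coeff 0‖ <
      ‖(taylor a (P v)).coeff j‖ * ε ^ j} :=
    isOpen_lt (hcont 0).norm ((hcont j).norm.mul continuous_const)
  have hmem : (fun i : Fin N => q.coeff i) ∈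
      closure (Set.univ.pi fun _ : Fin N => (algebraicClosure E W : Set W)) := by
    rw [closure_pi_set]
    exact fun i _ => hc i
  obtain ⟨v, hv, hvA⟩ := mem_closure_iff.mp hmem _ hopen (by rw [Set.mem_ofPred_eq, hP]; exact hlt)
  obtain ⟨b, hb, hba⟩ := exists_isAlgebraic_near_of_coeff
    (E := (algebraicClosure E W).toSubfield) hε (IsAlgClosed.splits (P v)) (fun n => by
      simp only [P, finsetSum_coeff, coeff_C_mul, coeff_X_pow]
      refine sum_mem fun i _ => mul_mem (hvA i trivial) ?_
      split_ifs
      exacts [one_mem _, zero_mem _]) ⟨j, hj, hv⟩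
  exact ⟨b, isAlgebraic_of_algebraicClosure hb, hba⟩

/-- The right side is topologically closed and algebraically closed in `W`, hence absorbs the
closure of any of its subsets. This is the idempotence of the operator. -/
theorem taClosure_subset [IsAlgClosed W] {S T : Set W} (h : S ⊆ taClosure T) :
    taClosure S ⊆ taClosure T := by
  intro b hb
  have hle : Subfield.closure S ≤ completedAlgClosureIn (Subfield.closure T) :=
    Subfield.closure_le.mpr h
  have hclosed : IsClosed (taClosure T) := isClosed_closure
  rw [← hclosed.closure_eq, Metric.mem_closure_iff]
  intro ε hε
  obtain ⟨a, ha, hab⟩ := mem_taClosure_iff.mp hb ε hε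
  refine ⟨a, mem_completedAlgClosureIn_of_isAlgebraic (isAlgebraic_mono hle ha), ?_⟩
  rwa [dist_comm, dist_eq_norm]

end TAClosure

end AnalyticField
end

/-! ### Power series with bounded weighted coefficients. -/

noncomputable section

namespace AnalyticField

open Polynomial

section WeightedBound

variable {W : Type*} [NormedField W]

/-- The coefficients of `F`, weighted by the powers of `r`, are bounded by `C`. -/
def WeightedBound (r C : ℝ) (F : PowerSeries W) : Prop :=
  ∀ n, ‖PowerSeries.coeff n F‖ * r ^ n ≤ C

variable {r C C' : ℝ} {F G : PowerSeries W}

theorem WeightedBound.mono (h : WeightedBound r C F) (hC : C ≤ C') : WeightedBound r C' F :=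
  fun n => (h n).trans hC

theorem WeightedBound.nonneg (h : WeightedBound r C F) : 0 ≤ C := by
  simpa using (by positivity : (0 : ℝ) ≤ ‖PowerSeries.coeff 0 F‖ * r ^ 0).trans (h 0)

theorem WeightedBound.neg (h : WeightedBound r C F) : WeightedBound r C (-F) := fun n => by
  simpa using h n

theorem weightedBound_C (a : W) : WeightedBound r ‖a‖ (PowerSeries.C a) := fun n => by
  rw [PowerSeries.coeff_C]
  split_ifs with h <;> simp [h]

theorem weightedBound_X (hr : 0 ≤ r) : WeightedBound r r (PowerSeries.X : PowerSeries W) :=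
  fun n => by
    rw [PowerSeries.coeff_X]
    split_ifs with h <;> simp [h, hr]

variable [IsUltrametricDist W]

theorem WeightedBound.add (hr : 0 ≤ r) (hF : WeightedBound r C F) (hG : WeightedBound r C G) :
    WeightedBound r C (F + G) := fun n => by
  rw [map_add]
  have := IsUltrametricDist.norm_add_le_max (PowerSeries.coeff n F) (PowerSeries.coeff n G)
  rcases le_max_iff.mp this with h | h
  · exact (mul_le_mul_of_nonneg_right h (by positivity)).trans (hF n)
  · exact (mul_le_mul_of_nonneg_right h (by positivity)).trans (hG n)

theorem WeightedBound.mul (hr : 0 ≤ r) (hF : WeightedBound r C F) (hG : WeightedBound r C' G) :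
    WeightedBound r (C * C') (F * G) := fun n => by
  have hC := hF.nonneg
  have hC' := hG.nonneg
  rw [PowerSeries.coeff_mul]
  have : ∃ p ∈ Finset.HasAntidiagonal.antidiagonal n,
      ‖∑ p ∈ Finset.HasAntidiagonal.antidiagonal n, PowerSeries.coeff p.1 F * PowerSeries.coeff p.2 G‖ ≤
        ‖PowerSeries.coeff p.1 F * PowerSeries.coeff p.2 G‖ := by
    obtain ⟨p, hp, h⟩ := IsUltrametricDist.exists_norm_finsetSum_le (Finset.HasAntidiagonal.antidiagonal n)
      (fun p : ℕ × ℕ => PowerSeries.coeff p.1 F * PowerSeries.coeff p.2 G)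
    exact ⟨p, hp ⟨(0, n), by simp⟩, h⟩
  obtain ⟨p, hp, h⟩ := this
  refine (mul_le_mul_of_nonneg_right h (by positivity)).trans ?_
  rw [norm_mul, ← Finset.HasAntidiagonal.mem_antidiagonal.mp hp, pow_add]
  calc _ = (‖PowerSeries.coeff p.1 F‖ * r ^ p.1) * (‖PowerSeries.coeff p.2 G‖ * r ^ p.2) := by ring
    _ ≤ C * C' := mul_le_mul (hF _) (hG _) (by positivity) hC

theorem WeightedBound.pow (hr : 0 ≤ r) (hF : WeightedBound r C F) (m : ℕ) :
    WeightedBound r (C ^ m) (F ^ m) := by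
  induction m with
  | zero => simpa using weightedBound_C (r := r) (1 : W)
  | succ m ih => rw [pow_succ, pow_succ]; exact ih.mul hr hF

theorem WeightedBound.sum (hr : 0 ≤ r) (hC : 0 ≤ C) {ι : Type*} (s : Finset ι)
    (f : ι → PowerSeries W) (h : ∀ i ∈ s, WeightedBound r C (f i)) :
    WeightedBound r C (∑ i ∈ s, f i) := by
  classical
  induction s using Finset.induction_on with
  | empty => simpa [WeightedBound] using hC
  | insert i s hi ih =>
    rw [Finset.sum_insert hi]
    exact (h i (Finset.mem_insert_self _ _)).add hr
      (ih fun j hj => h j (Finset.mem_insert_of_mem hj))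

/-- An ultrametric Schwarz lemma: vanishing to order `N` at the centre gains the factor `(s / r) ^
N` on the smaller disc. This makes truncation errors negligible. -/
theorem norm_eval_le_of_weightedBound {q : W[X]} {s : ℝ} (hr : 0 < r) (hs : 0 ≤ s) (hsr : s ≤ r)
    (hq : WeightedBound r C (q : PowerSeries W)) (N : ℕ) (hN : ∀ n < N, q.coeff n = 0) {u : W}
    (hu : ‖u‖ ≤ s) : ‖q.eval u‖ ≤ C * (s / r) ^ N := by
  rw [eval_eq_sum_range]
  have hC := hq.nonneg
  refine IsUltrametricDist.norm_sum_le_of_forall_le_of_nonneg (by positivity) fun n _ => ?_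
  by_cases hn : n < N
  · rw [hN n hn, zero_mul, norm_zero]; positivity
  · have h1 := hq n
    rw [Polynomial.coeff_coe] at h1
    rw [norm_mul, norm_pow]
    have hd : s / r ≤ 1 := (div_le_one hr).mpr hsr
    calc ‖q.coeff n‖ * ‖u‖ ^ n ≤ ‖q.coeff n‖ * s ^ n := by gcongr
      _ = ‖q.coeff n‖ * r ^ n * (s / r) ^ n := by
        rw [div_pow, mul_assoc, mul_div_cancel₀ _ (by positivity)]
      _ ≤ C * (s / r) ^ N := by
        refine mul_le_mul h1 (pow_le_pow_of_le_one (by positivity) hd (by omega))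
          (by positivity) hC

end WeightedBound

/-! ### Algebraic power series in a perturbation of a parameter. -/

section GoodSeries

variable {W : Type*} [NormedField W] (k : Subfield W)

variable {k} in
theorem aeval_ne_zero_of_notMem [IsAlgClosed k] {y : W} (hy : y ∉ k) {p : k[X]}
    (hp : p ≠ 0) : aeval y p ≠ 0 := by
  intro h
  have hr : y ∈ (p.map (algebraMap k W)).roots := by
    rw [mem_roots (by simpa using hp), IsRoot.def, eval_map_algebraMap, h]
  rw [(IsAlgClosed.splits p).roots_map] at hr
  obtain ⟨c, -, rfl⟩ := Multiset.mem_map.mp hr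
  exact hy c.2

/-- The power series `t + X`. -/
def shift (t : W) : PowerSeries W := PowerSeries.C t + PowerSeries.X

theorem constantCoeff_shift (t : W) : PowerSeries.constantCoeff (shift t) = t := by
  simp [shift]

variable {k} in
theorem algebraMap_powerSeries (c : k) :
    algebraMap k (PowerSeries W) c = PowerSeries.C (c : W) :=
  PowerSeries.algebraMap_apply

theorem constantCoeff_aeval (F : PowerSeries W) (p : k[X]) :
    PowerSeries.constantCoeff (aeval F p) = aeval (PowerSeries.constantCoeff F) p := by
  rw [aeval_def, hom_eval₂, aeval_def]
  congr 1

variable {k} in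
theorem mem_adjoin_shift_iff {t : W} {F : PowerSeries W} :
    F ∈ Algebra.adjoin k {shift t} ↔ ∃ p : k[X], aeval (shift t) p = F := by
  rw [Algebra.adjoin_singleton_eq_range_aeval]; rfl

/-- A power series that is algebraic over `k(t + X)` is determined by its constant term if `t` is
transcendental over `k`. -/
theorem eq_zero_of_constantCoeff_eq_zero {t : W} (ht : ∀ p : k[X], p ≠ 0 → aeval t p ≠ 0)
    {F : PowerSeries W} (hF : IsAlgebraic (Algebra.adjoin k {shift t}) F)
    (h0 : PowerSeries.constantCoeff F = 0) : F = 0 := by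
  by_contra hne
  -- A relation with nonzero constant coefficient is available because `F` is not a zero divisor.
  -- Its value at `X = 0` is a polynomial over `k` that kills `t`, hence zero.
  obtain ⟨q, hq0, hq⟩ := hF.exists_nonzero_coeff_and_aeval_eq_zero
    (mem_nonZeroDivisors_of_ne_zero hne)
  obtain ⟨p, hp⟩ := mem_adjoin_shift_iff.mp (q.coeff 0).2
  have h1 := congrArg PowerSeries.constantCoeff hq
  rw [aeval_def, hom_eval₂, h0, eval₂_at_zero, map_zero] at h1
  have h2 : aeval t p = 0 := by
    have h4 := constantCoeff_aeval k (shift t) p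
    rw [constantCoeff_shift, hp] at h4
    exact h4.symm.trans h1
  have h3 : p = 0 := by
    by_contra h; exact ht p h h2
  rw [h3, map_zero] at hp
  exact hq0 (Subtype.ext hp.symm)

/-- The relation of `F` over `k[t + X]`, sorted by powers of `t + X` instead of powers of `F`. Its
coefficients become polynomials in `F` over `k`, which is the form that
`exists_aeval_eq_mul_one_add` controls. -/
theorem exists_sum_shift_pow_mul_aeval_eq_zero {t : W}
    {F : PowerSeries W} (hF : IsAlgebraic (Algebra.adjoin k {shift t}) F) :
    ∃ (N : ℕ) (q : ℕ → k[X]), (∃ i ∈ Finset.range N, q i ≠ 0) ∧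
      ∑ i ∈ Finset.range N, shift t ^ i * aeval F (q i) = 0 := by
  obtain ⟨p, hp0, hp⟩ := hF
  choose g hg using fun j => mem_adjoin_shift_iff.mp (p.coeff j).2
  set n := p.natDegree + 1
  set N := (Finset.range n).sup (fun j => (g j).natDegree) + 1 with hN
  have hlt : ∀ j ∈ Finset.range n, (g j).natDegree < N := fun j hj =>
    Nat.lt_succ_of_le (Finset.le_sup (f := fun j => (g j).natDegree) hj)
  refine ⟨N, fun i => ∑ j ∈ Finset.range n, C ((g j).coeff i) * X ^ j, ?_, ?_⟩
  · by_contra! h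
    refine hp0 (Polynomial.ext fun j => ?_)
    by_cases hj : j < n
    · have : g j = 0 := by
        ext i
        by_cases hi : i < N
        · have h1 := congrArg (fun q => q.coeff j) (h i (Finset.mem_range.mpr hi))
          simp only [finsetSum_coeff, coeff_C_mul, coeff_X_pow, coeff_zero] at h1
          rw [Finset.sum_eq_single j (fun b _ hb => by simp [hb.symm])
            (fun hb => absurd (Finset.mem_range.mpr hj) hb)] at h1
          simpa using h1
        · rw [coeff_zero, coeff_eq_zero_of_natDegree_lt]
          have := hlt j (Finset.mem_range.mpr hj)
          omega
      have h2 := hg j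
      rw [this, map_zero] at h2
      exact Subtype.ext h2.symm
    · rw [coeff_eq_zero_of_natDegree_lt (by omega), coeff_zero]
  · rw [aeval_eq_sum_range] at hp
    rw [← hp]
    simp only [map_sum, map_mul, aeval_C, map_pow, aeval_X, Finset.mul_sum]
    rw [Finset.sum_comm]
    refine Finset.sum_congr rfl fun j hj => ?_
    rw [Algebra.smul_def]
    change _ = ((p.coeff j : Algebra.adjoin k {shift t}) : PowerSeries W) * F ^ j
    rw [← hg j, aeval_eq_sum_range' (hlt j hj), Finset.sum_mul]
    refine Finset.sum_congr rfl fun i _ => ?_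
    rw [Algebra.smul_def]
    ring

variable [IsUltrametricDist W]

theorem weightedBound_shift (t : W) : WeightedBound ‖t‖ ‖t‖ (shift t) :=
  (weightedBound_C t).add (norm_nonneg t) (weightedBound_X (norm_nonneg t))

/-- The power series that converge boundedly on the open disc of radius `‖t‖` and are algebraic
over `k(t + X)`. -/
def goodSeries (t : W) : Subring (PowerSeries W) where
  carrier := {F | (∃ C, WeightedBound ‖t‖ C F) ∧ IsAlgebraic (Algebra.adjoin k {shift t}) F}
  zero_mem' := ⟨⟨0, fun n => by simp⟩, isAlgebraic_zero⟩
  one_mem' := ⟨⟨1, by simpa using weightedBound_C (r := ‖t‖) (1 : W)⟩, isAlgebraic_one⟩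
  add_mem' := by
    rintro F G ⟨⟨C, hF⟩, hFa⟩ ⟨⟨C', hG⟩, hGa⟩
    exact ⟨⟨max C C', (hF.mono (le_max_left _ _)).add (norm_nonneg t) (hG.mono (le_max_right _ _))⟩,
      hFa.add hGa⟩
  mul_mem' := by
    rintro F G ⟨⟨C, hF⟩, hFa⟩ ⟨⟨C', hG⟩, hGa⟩
    exact ⟨⟨C * C', hF.mul (norm_nonneg t) hG⟩, hFa.mul hGa⟩
  neg_mem' := by
    rintro F ⟨⟨C, hF⟩, hFa⟩
    exact ⟨⟨C, hF.neg⟩, hFa.neg⟩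

/-- The constant terms of the good power series. -/
def goodElements (t : W) : Subring W := (goodSeries k t).map PowerSeries.constantCoeff

theorem algebraMap_mem_goodSeries (t : W) (c : k) :
    algebraMap k (PowerSeries W) c ∈ goodSeries k t := by
  refine ⟨⟨‖(c : W)‖, ?_⟩, ?_⟩
  · rw [algebraMap_powerSeries]; exact weightedBound_C (c : W)
  · exact isAlgebraic_algebraMap (⟨_, Subalgebra.algebraMap_mem _ c⟩ : Algebra.adjoin k {shift t})

theorem shift_mem_goodSeries (t : W) : shift t ∈ goodSeries k t :=
  ⟨⟨_, weightedBound_shift t⟩, isAlgebraic_algebraMap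
    (⟨_, Algebra.self_mem_adjoin_singleton k (shift t)⟩ : Algebra.adjoin k {shift t})⟩

theorem coe_mem_goodElements (t : W) (c : k) : (c : W) ∈ goodElements k t :=
  ⟨_, algebraMap_mem_goodSeries k t c, rfl⟩

theorem self_mem_goodElements (t : W) : t ∈ goodElements k t :=
  ⟨_, shift_mem_goodSeries k t, constantCoeff_shift t⟩

theorem aeval_mem_goodSeries {t : W} {F : PowerSeries W} (hF : F ∈ goodSeries k t) (p : k[X]) :
    aeval F p ∈ goodSeries k t := by
  rw [aeval_eq_sum_range]
  refine sum_mem fun i _ => ?_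
  rw [Algebra.smul_def]
  exact mul_mem (algebraMap_mem_goodSeries k t _) (pow_mem hF i)

/-- The witness is the geometric series of `1 / (t - c + X)`; its weighted coefficients are bounded
because `‖t‖ ≤ ‖t - c‖`. -/
theorem inv_sub_mem_goodElements {t : W} (ht : t ≠ 0) {c : k} (hc : ‖t‖ ≤ ‖t - c‖) :
    (t - c)⁻¹ ∈ goodElements k t := by
  have hpos : 0 < ‖t‖ := norm_pos_iff.mpr ht
  have hne : t - c ≠ 0 := norm_pos_iff.mp (hpos.trans_le hc)
  set G : PowerSeries W := PowerSeries.mk fun n => (-1) ^ n * (t - c)⁻¹ ^ (n + 1) with hG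
  have hmul : (shift t - algebraMap k (PowerSeries W) c) * G = 1 := by
    have h1 : shift t - algebraMap k (PowerSeries W) c = PowerSeries.C (t - c) + PowerSeries.X := by
      rw [shift, map_sub, sub_add_eq_add_sub, algebraMap_powerSeries]
    rw [h1]
    ext n
    rw [add_mul, map_add, PowerSeries.coeff_C_mul]
    cases n with
    | zero => simp [hG, PowerSeries.coeff_zero_X_mul, hne]
    | succ n =>
      rw [PowerSeries.coeff_succ_X_mul, hG, PowerSeries.coeff_mk, PowerSeries.coeff_mk,
        PowerSeries.coeff_one, if_neg (Nat.succ_ne_zero n)]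
      rw [pow_succ (t - (c : W))⁻¹ (n + 1)]
      field_simp
      ring
  refine ⟨G, ⟨⟨‖t - c‖⁻¹, fun n => ?_⟩, ?_⟩, by simp [hG]⟩
  · rw [hG, PowerSeries.coeff_mk, norm_mul, norm_pow, norm_neg, norm_one, one_pow, one_mul,
      norm_pow, norm_inv, pow_succ', mul_assoc, ← mul_pow]
    refine mul_le_of_le_one_right (by positivity) (pow_le_one₀ (by positivity) ?_)
    rw [inv_mul_le_one₀ (hpos.trans_le hc)]
    exact hc
  · have hs : shift t - algebraMap k (PowerSeries W) c ∈ Algebra.adjoin k {shift t} :=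
      sub_mem (Algebra.self_mem_adjoin_singleton k _) (Subalgebra.algebraMap_mem _ c)
    refine ⟨Polynomial.C (⟨_, hs⟩ : Algebra.adjoin k {shift t}) * X - 1, fun h => ?_, ?_⟩
    · have := congrArg (fun p => p.coeff 0) h
      simp at this
    · rw [map_sub, map_mul, aeval_C, aeval_X, map_one, sub_eq_zero]
      exact hmul

/-- Over the algebraically closed `k` the polynomial is a product of linear factors, and `F - c = (f
- c)(1 + G)` with `G` of size at most `ε / ‖f - c‖ < 1`. So if `F` moves by at most `ε`, less than
its distance to each constant, every polynomial in `F` is constant up to a relative error less than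
one. -/
theorem exists_aeval_eq_mul_one_add [IsAlgClosed k] {r ε : ℝ} (hr : 0 ≤ r) (hε : 0 ≤ ε)
    {F : PowerSeries W} (hc : ∀ c ∈ k, ε < ‖PowerSeries.constantCoeff F - c‖)
    (hF : ∀ n, 1 ≤ n → ‖PowerSeries.coeff n F‖ * r ^ n ≤ ε) (q : k[X]) :
    ∃ ρ H, 0 ≤ ρ ∧ ρ < 1 ∧ WeightedBound r ρ H ∧
      aeval F q = PowerSeries.C (aeval (PowerSeries.constantCoeff F) q) * (1 + H) := by
  set f := PowerSeries.constantCoeff F with hf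
  have h := (IsAlgClosed.splits q).eq_prod_roots
  generalize q.roots = m at h
  generalize q.leadingCoeff = l at h
  subst h
  induction m using Multiset.induction_on with
  | empty =>
    refine ⟨0, 0, le_rfl, one_pos, fun n => by simp, ?_⟩
    simp [algebraMap_powerSeries]
    rfl
  | cons c m ih =>
    obtain ⟨ρ, H, h0, h1, hH, heq⟩ := ih
    have hfc := hc c c.2
    have hpos : 0 < ‖f - c‖ := hε.trans_lt hfc
    have hne : f - c ≠ 0 := norm_pos_iff.mp hpos
    set G : PowerSeries W := PowerSeries.C (f - c)⁻¹ * (F - PowerSeries.C f) with hG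
    have hGb : WeightedBound r (ε / ‖f - c‖) G := fun n => by
      rw [hG, PowerSeries.coeff_C_mul, map_sub, PowerSeries.coeff_C]
      rcases Nat.eq_zero_or_pos n with rfl | hn
      · simp [hf]; positivity
      · rw [if_neg hn.ne', sub_zero, norm_mul, norm_inv, mul_assoc, inv_mul_eq_div]
        gcongr
        exact hF n hn
    have hFc : F - algebraMap k (PowerSeries W) c = PowerSeries.C (f - c) * (1 + G) := by
      have hCC : PowerSeries.C (f - (c : W)) * PowerSeries.C (f - (c : W))⁻¹ = 1 := by
        rw [← map_mul, mul_inv_cancel₀ hne, map_one]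
      rw [mul_add, hG, ← mul_assoc, hCC, one_mul, mul_one, map_sub]
      rw [algebraMap_powerSeries]
      ring
    have hlt : ε / ‖f - c‖ < 1 := (div_lt_one hpos).mpr hfc
    refine ⟨max ρ (ε / ‖f - c‖), H + G + H * G, le_max_of_le_left h0, max_lt h1 hlt, ?_, ?_⟩
    · refine ((hH.mono (le_max_left _ _)).add hr (hGb.mono (le_max_right _ _))).add hr
        ((hH.mul hr hGb).mono (le_max_of_le_left ?_))
      exact mul_le_of_le_one_right h0 hlt.le
    · rw [Multiset.map_cons, Multiset.prod_cons, mul_left_comm, map_mul, heq, map_sub (aeval (R := k) F),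
        aeval_X, aeval_C, hFc, map_mul (aeval f) (X - C c), map_sub (aeval (R := k) f), aeval_X, aeval_C,
        map_mul PowerSeries.C]
      change _ * (PowerSeries.C _ * _) = PowerSeries.C (f - (c : W)) * _ * _
      ring

/-- A good power series whose constant term has distance more than `ε` from `k` takes values at
distance more than `ε` from its constant term. -/
theorem exists_coeff_gt [IsAlgClosed k] {t : W} (ht : t ≠ 0)
    {F : PowerSeries W} (hFa : IsAlgebraic (Algebra.adjoin k {shift t}) F) {ε : ℝ} (hε : 0 ≤ ε)
    (hc : ∀ c ∈ k, ε < ‖PowerSeries.constantCoeff F - c‖) :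
    ∃ n, 1 ≤ n ∧ ε < ‖PowerSeries.coeff n F‖ * ‖t‖ ^ n := by
  by_contra! hF
  set f := PowerSeries.constantCoeff F with hf
  set r := ‖t‖ with hr'
  have hr : 0 < r := norm_pos_iff.mpr ht
  have hfk : f ∉ k := fun h => by
    have := hc f h
    rw [sub_self, norm_zero] at this
    linarith
  obtain ⟨N, q, ⟨i1, hi1, hqi1⟩, hsum⟩ := exists_sum_shift_pow_mul_aeval_eq_zero k hFa
  choose ρ H h0 h1 hH heq using fun i => exists_aeval_eq_mul_one_add k hr.le hε hc hF (q i)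
  have hne : (Finset.range N).Nonempty := ⟨i1, hi1⟩
  obtain ⟨i0, hi0, hmax⟩ := Finset.exists_max_image (Finset.range N)
    (fun i => ‖aeval f (q i)‖ * r ^ i) hne
  obtain ⟨i2, hi2, hρmax⟩ := Finset.exists_max_image (Finset.range N) ρ hne
  set m := ‖aeval f (q i0)‖ * r ^ i0 with hm
  have hmpos : 0 < m := by
    refine lt_of_lt_of_le ?_ (hmax i1 hi1)
    have := norm_pos_iff.mpr (aeval_ne_zero_of_notMem hfk hqi1)
    positivity
  -- If `F` moved by at most `ε`, replacing `F` by its constant term `f` in the relation would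
  -- change each summand by a relative error below one. Hence `g(t + X)` has Gauss norm at most `ρ
  -- i2 * m` at radius `r`, whereas that of `g` is at least `m`.
  set g : W[X] := ∑ i ∈ Finset.range N, C (aeval f (q i)) * X ^ i with hg
  have hgc : g.coeff i0 = aeval f (q i0) := by
    simp only [hg, finsetSum_coeff, coeff_C_mul, coeff_X_pow]
    rw [Finset.sum_eq_single i0 (fun b _ hb => by simp [hb.symm]) (fun hb => absurd hi0 hb)]
    simp
  have htay : ((taylor t g : W[X]) : PowerSeries W) =
      ∑ i ∈ Finset.range N, PowerSeries.C (aeval f (q i)) * shift t ^ i := by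
    have : taylor t g = ∑ i ∈ Finset.range N, C (aeval f (q i)) * (X + C t) ^ i := by
      simp [hg, taylor_apply]
    rw [this, ← coeToPowerSeries.ringHom_apply, map_sum]
    refine Finset.sum_congr rfl fun i _ => ?_
    simp [shift, add_comm]
  have hbound : WeightedBound r (ρ i2 * m) ((taylor t g : W[X]) : PowerSeries W) := by
    have : ((taylor t g : W[X]) : PowerSeries W) =
        -∑ i ∈ Finset.range N, H i * (PowerSeries.C (aeval f (q i)) * shift t ^ i) := by
      rw [htay, eq_neg_iff_add_eq_zero, ← hsum, ← Finset.sum_add_distrib]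
      refine Finset.sum_congr rfl fun i _ => ?_
      rw [heq i]; ring
    rw [this]
    refine (WeightedBound.sum hr.le (mul_nonneg (h0 i2) hmpos.le) _ _ fun i hi => ?_).neg
    exact ((hH i).mul hr.le ((weightedBound_C _).mul hr.le
      ((weightedBound_shift t).pow hr.le i))).mono
        (mul_le_mul (hρmax i hi) (hmax i hi) (by positivity) (h0 i2))
  -- Translation by `-t` keeps the bound because `‖t‖ = r`: centre and radius describe the same
  -- disc. The coefficient of index `i0` then contradicts `ρ i2 < 1`.
  have hback : WeightedBound r (ρ i2 * m) (g : PowerSeries W) := by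
    have h2 : g = taylor (-t) (taylor t g) := by rw [taylor_taylor]; simp
    have h3 : (g : PowerSeries W) = ∑ i ∈ Finset.range ((taylor t g).natDegree + 1),
        PowerSeries.C ((taylor t g).coeff i) * shift (-t) ^ i := by
      conv_lhs => rw [h2, taylor_apply, comp, eval₂_eq_sum_range]
      rw [← coeToPowerSeries.ringHom_apply, map_sum]
      refine Finset.sum_congr rfl fun i _ => ?_
      simp [shift, add_comm]
    rw [h3]
    refine WeightedBound.sum hr.le (mul_nonneg (h0 i2) hmpos.le) _ _ fun i _ => ?_
    have h4 := hbound i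
    rw [Polynomial.coeff_coe] at h4
    have h5 : WeightedBound r r (shift (-t)) := by
      have := weightedBound_shift (-t)
      rwa [norm_neg] at this
    exact ((weightedBound_C _).mul hr.le (h5.pow hr.le i)).mono h4
  have h6 := hback i0
  rw [Polynomial.coeff_coe, hgc] at h6
  have := h1 i2
  nlinarith

end GoodSeries

end AnalyticField
end

/-! ### Two algebraically dependent good elements: comparison of discs. -/

noncomputable section

namespace AnalyticField

open Polynomial

section EvalXY

variable {W : Type*} [NormedField W] {k : Subfield W}

/-- The value at `(x, y)` of a polynomial in two variables; the outer variable is `y`. -/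
def evalXY {A : Type*} [CommRing A] [Algebra k A] (x y : A) : k[X][X] →+* A :=
  eval₂RingHom (aeval x : k[X] →ₐ[k] A).toRingHom y

theorem map_evalXY_congr {A B T : Type*} [CommRing A] [Algebra k A] [CommRing B] [Algebra k B]
    [CommRing T] (φ : A →+* T) (ψ : B →+* T)
    (h : φ.comp (algebraMap k A) = ψ.comp (algebraMap k B)) {x y : A} {x' y' : B}
    (hx : φ x = ψ x') (hy : φ y = ψ y') (R : k[X][X]) : φ (evalXY x y R) = ψ (evalXY x' y' R) := by
  have : φ.comp (evalXY (k := k) x y) = ψ.comp (evalXY (k := k) x' y') := by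
    refine Polynomial.ringHom_ext' (Polynomial.ringHom_ext' ?_ ?_) ?_
    · ext c
      simpa [evalXY] using congrArg (fun g => g c) h
    · simpa [evalXY] using hx
    · simpa [evalXY] using hy
  exact congrArg (fun g => g R) this

theorem evalXY_eq_sum {A : Type*} [CommRing A] [Algebra k A] (x y : A) (R : k[X][X]) :
    evalXY x y R = ∑ n ∈ Finset.range (R.natDegree + 1), aeval x (R.coeff n) * y ^ n :=
  eval₂_eq_sum_range _ _

theorem evalXY_eq_eval_map (x y : W) (R : k[X][X]) :
    evalXY x y R = (R.map (aeval x : k[X] →ₐ[k] W).toRingHom).eval y := by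
  rw [eval_map]; rfl

theorem map_aeval_ne_zero [IsAlgClosed k] {y : W} (hy : y ∉ k) {R : k[X][X]} (hR : R ≠ 0) :
    R.map (aeval y : k[X] →ₐ[k] W).toRingHom ≠ 0 := by
  intro h
  refine hR (Polynomial.ext fun n => ?_)
  by_contra hn
  refine aeval_ne_zero_of_notMem hy hn ?_
  have := congrArg (fun p => p.coeff n) h
  simpa using this

variable [IsUltrametricDist W]

theorem exists_weightedBound_aeval {r C : ℝ} (hr : 0 ≤ r) (p : k[X]) :
    ∃ C', ∀ F, WeightedBound r C F → WeightedBound r C' (aeval F p : PowerSeries W) := by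
  induction p using Polynomial.induction_on' with
  | add p q hp hq =>
    obtain ⟨C1, h1⟩ := hp
    obtain ⟨C2, h2⟩ := hq
    refine ⟨max C1 C2, fun F hF => ?_⟩
    rw [map_add]
    exact ((h1 F hF).mono (le_max_left _ _)).add hr ((h2 F hF).mono (le_max_right _ _))
  | monomial n c =>
    refine ⟨‖(c : W)‖ * C ^ n, fun F hF => ?_⟩
    rw [aeval_monomial, algebraMap_powerSeries]
    exact (weightedBound_C _).mul hr (hF.pow hr n)

/-- The bound depends only on `R`, `r` and `C`, so it serves all truncations of two series at once.
-/
theorem exists_weightedBound_evalXY {r C : ℝ} (hr : 0 ≤ r) (R : k[X][X]) :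
    ∃ C', ∀ F G, WeightedBound r C F → WeightedBound r C G →
      WeightedBound r C' (evalXY F G R : PowerSeries W) := by
  induction R using Polynomial.induction_on' with
  | add p q hp hq =>
    obtain ⟨C1, h1⟩ := hp
    obtain ⟨C2, h2⟩ := hq
    refine ⟨max C1 C2, fun F G hF hG => ?_⟩
    rw [map_add]
    exact ((h1 F G hF hG).mono (le_max_left _ _)).add hr
      ((h2 F G hF hG).mono (le_max_right _ _))
  | monomial n c =>
    obtain ⟨C1, h1⟩ := exists_weightedBound_aeval (C := C) hr c
    refine ⟨C1 * C ^ n, fun F G hF hG => ?_⟩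
    have : evalXY F G (monomial n c) = aeval F c * G ^ n := by simp [evalXY]
    rw [this]
    exact (h1 F hF).mul hr (hG.pow hr n)

omit [IsUltrametricDist W] in
theorem WeightedBound.trunc {r C : ℝ} {F : PowerSeries W} (hF : WeightedBound r C F) (N : ℕ) :
    WeightedBound r C (PowerSeries.trunc N F : PowerSeries W) := fun n => by
  rw [Polynomial.coeff_coe, PowerSeries.coeff_trunc]
  split_ifs
  · exact hF n
  · simpa using hF.nonneg

omit [IsUltrametricDist W] in
-- Truncation at order `N` changes nothing modulo `X ^ N`, so the relation between the series holds
-- for the truncations up to that order.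
theorem coeff_evalXY_trunc {F G : PowerSeries W} {R : k[X][X]} (hR : evalXY F G R = 0) (N n : ℕ)
    (hn : n < N) :
    (evalXY (PowerSeries.trunc N F) (PowerSeries.trunc N G) R : W[X]).coeff n = 0 := by
  have hdvd : ∀ H : PowerSeries W,
      Ideal.Quotient.mk (Ideal.span {(PowerSeries.X : PowerSeries W) ^ N})
        ((PowerSeries.trunc N H : W[X]) : PowerSeries W) = Ideal.Quotient.mk _ H := by
    intro H
    rw [Ideal.Quotient.eq, Ideal.mem_span_singleton, PowerSeries.X_pow_dvd_iff]
    intro m hm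
    rw [map_sub, Polynomial.coeff_coe, PowerSeries.coeff_trunc, if_pos hm, sub_self]
  have := map_evalXY_congr (k := k)
    ((Ideal.Quotient.mk (Ideal.span {(PowerSeries.X : PowerSeries W) ^ N})).comp
      coeToPowerSeries.ringHom) (Ideal.Quotient.mk _) (by
        refine RingHom.ext fun c => ?_
        rw [RingHom.comp_apply, RingHom.comp_apply, RingHom.comp_apply, algebraMap_powerSeries]
        exact congrArg _ (Polynomial.coe_C _))
    (x := PowerSeries.trunc N F) (y := PowerSeries.trunc N G) (x' := F) (y' := G)
    (hdvd F) (hdvd G) R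
  rw [hR, map_zero, RingHom.comp_apply, Ideal.Quotient.eq_zero_iff_mem, Ideal.mem_span_singleton,
    PowerSeries.X_pow_dvd_iff] at this
  simpa using this n hn

/-- The polynomial `R(F_N, G_N)` vanishes to order `N` with a bound independent of `N`, so it is at
most `C' * (s / r) ^ N` on the disc of radius `s`. When `F_N(u) = y`, this says that `R(y, ·)` is
tiny at `G_N(u)` and therefore has a root nearby. Truncations replace the series because `W` is not
assumed complete. -/
theorem exists_root_near_trunc [IsAlgClosed W] {r C : ℝ} (hr : 0 < r) {F G : PowerSeries W}
    (hF : WeightedBound r C F) (hG : WeightedBound r C G) {R : k[X][X]} (hR : evalXY F G R = 0)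
    {y : W} (hy : R.map (aeval y : k[X] →ₐ[k] W).toRingHom ≠ 0) {s η : ℝ} (hs : 0 ≤ s)
    (hsr : s < r) (hη : 0 < η) :
    ∃ N0, ∀ N, N0 ≤ N → ∀ u, ‖u‖ ≤ s → (PowerSeries.trunc N F).eval u = y →
      ∃ α, evalXY y α R = 0 ∧ ‖α - (PowerSeries.trunc N G).eval u‖ ≤ η := by
  obtain ⟨C', hC'⟩ := exists_weightedBound_evalXY (C := C) hr.le R
  set q := R.map (aeval y : k[X] →ₐ[k] W).toRingHom with hq
  -- The power of `η` bounds the distance to a root; the `1` excludes a constant `q`, whose value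
  -- would equal its leading coefficient.
  have hlead : 0 < ‖q.leadingCoeff‖ * min 1 (η ^ q.natDegree) := by
    have : 0 < ‖q.leadingCoeff‖ := by simpa using hy
    have : 0 < min 1 (η ^ q.natDegree) := lt_min one_pos (by positivity)
    positivity
  have hsr' : s / r < 1 := (div_lt_one hr).mpr hsr
  have htend : Filter.Tendsto (fun N : ℕ => C' * (s / r) ^ N) Filter.atTop (nhds 0) := by
    simpa using (tendsto_pow_atTop_nhds_zero_of_lt_one (by positivity) hsr').const_mul C'
  obtain ⟨N0, hN0⟩ := Filter.eventually_atTop.mp (htend.eventually (gt_mem_nhds hlead))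
  refine ⟨N0, fun N hN u hu huy => ?_⟩
  have hsmall : ‖q.eval ((PowerSeries.trunc N G).eval u)‖ <
      ‖q.leadingCoeff‖ * min 1 (η ^ q.natDegree) := by
    refine lt_of_le_of_lt ?_ (hN0 N hN)
    have h1 : q.eval ((PowerSeries.trunc N G).eval u) =
        (evalXY (PowerSeries.trunc N F) (PowerSeries.trunc N G) R : W[X]).eval u := by
      rw [hq, ← evalXY_eq_eval_map]
      refine (map_evalXY_congr (k := k) (evalRingHom u) (RingHom.id W) ?_ ?_ ?_ R).symm
      · ext c
        simp [Polynomial.algebraMap_apply]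
      · simpa using huy
      · simp
    rw [h1]
    refine norm_eval_le_of_weightedBound hr hs hsr.le ?_ N
      (fun n hn => coeff_evalXY_trunc hR N n hn) hu
    have h2 := map_evalXY_congr (k := k) (coeToPowerSeries.ringHom (R := W))
      (RingHom.id (PowerSeries W)) (by
        ext c
        simp [algebraMap_powerSeries, Polynomial.algebraMap_apply]
        rfl)
      (x := PowerSeries.trunc N F) (y := PowerSeries.trunc N G)
      (x' := (PowerSeries.trunc N F : W[X])) (y' := (PowerSeries.trunc N G : W[X])) rfl rfl R
    rw [coeToPowerSeries.ringHom_apply, RingHom.id_apply] at h2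
    rw [h2]
    exact hC' _ _ (hF.trunc N) (hG.trunc N)
  have hd : 1 ≤ q.natDegree := by
    by_contra! h
    have h0 : q.natDegree = 0 := by omega
    have h1 : min 1 (η ^ q.natDegree) ≤ 1 := min_le_left _ _
    have h2 : q.leadingCoeff = q.coeff 0 := by rw [leadingCoeff, h0]
    have h3 : q.eval ((PowerSeries.trunc N G).eval u) = q.coeff 0 := by
      rw [eq_C_of_natDegree_eq_zero h0]; simp
    rw [h2, h3] at hsmall
    nlinarith [norm_nonneg (q.coeff 0)]
  obtain ⟨α, hα, hαn⟩ := exists_root_norm_sub_le (IsAlgClosed.splits q) hd hη.le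
    (hsmall.le.trans (mul_le_mul_of_nonneg_left (min_le_right _ _) (norm_nonneg _)))
  exact ⟨α, by rw [evalXY_eq_eval_map]; exact hα, hαn⟩

/-- The largest of the numbers `‖F_n‖ s ^ n` for `1 ≤ n < N`. -/
def truncSup (F : PowerSeries W) {N : ℕ} (hN : (Finset.Ico 1 N).Nonempty) (s : ℝ) : ℝ :=
  (Finset.Ico 1 N).sup' hN fun n => ‖PowerSeries.coeff n F‖ * s ^ n

omit [IsUltrametricDist W] in
-- The radius is found by the intermediate value theorem and need not be the norm of an element.
-- Exact equality is what makes the radii of two series comparable.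
theorem exists_truncSup_eq (F : PowerSeries W) {N : ℕ} (hN : (Finset.Ico 1 N).Nonempty) {s ε : ℝ}
    (hs : 0 ≤ s) (hε : 0 < ε) {n : ℕ} (hn : n ∈ Finset.Ico 1 N)
    (h : ε < ‖PowerSeries.coeff n F‖ * s ^ n) : ∃ s', 0 ≤ s' ∧ s' ≤ s ∧ truncSup F hN s' = ε := by
  have hcont : Continuous (truncSup F hN) :=
    Continuous.finset_sup'_apply hN fun n _ => by fun_prop
  have h0 : truncSup F hN 0 ≤ ε := by
    refine Finset.sup'_le _ _ fun m hm => ?_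
    have : m ≠ 0 := by have := (Finset.mem_Ico.mp hm).1; omega
    simp [this, hε.le]
  have h1 : ε ≤ truncSup F hN s :=
    h.le.trans (Finset.le_sup' (fun n => ‖PowerSeries.coeff n F‖ * s ^ n) hn)
  obtain ⟨s', hs', heq⟩ := intermediate_value_Icc hs hcont.continuousOn ⟨h0, h1⟩
  exact ⟨s', hs'.1, hs'.2, heq⟩

omit [IsUltrametricDist W] in
theorem truncSup_mono (F : PowerSeries W) {N : ℕ} (hN : (Finset.Ico 1 N).Nonempty) {s s' : ℝ}
    (hs : 0 ≤ s) (h : s ≤ s') : truncSup F hN s ≤ truncSup F hN s' := by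
  refine Finset.sup'_le _ _ fun m hm => ?_
  refine le_trans ?_ (Finset.le_sup' (fun n => ‖PowerSeries.coeff n F‖ * s' ^ n) hm)
  gcongr

theorem exists_eval_trunc_eq [IsAlgClosed W] (F : PowerSeries W) {N : ℕ}
    (hN : (Finset.Ico 1 N).Nonempty) {s : ℝ} (hs : 0 ≤ s) {y : W}
    (hy : ‖y - PowerSeries.constantCoeff F‖ ≤ truncSup F hN s) :
    ∃ u, ‖u‖ ≤ s ∧ (PowerSeries.trunc N F).eval u = y := by
  obtain ⟨n, hn, hmax⟩ := Finset.exists_mem_eq_sup' hN fun n => ‖PowerSeries.coeff n F‖ * s ^ n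
  have hn' := Finset.mem_Ico.mp hn
  rw [truncSup, hmax] at hy
  have hc0 : (PowerSeries.trunc N F - C y).coeff 0 = -(y - PowerSeries.constantCoeff F) := by
    rw [coeff_sub, PowerSeries.coeff_trunc, if_pos (by omega)]
    simp
  have hcn : (PowerSeries.trunc N F - C y).coeff n = PowerSeries.coeff n F := by
    rw [coeff_sub, PowerSeries.coeff_trunc, if_pos (by omega), coeff_C, if_neg (by omega), sub_zero]
  obtain ⟨u, hu, hus⟩ := exists_root_norm_le (IsAlgClosed.splits (PowerSeries.trunc N F - C y)) hs
    ⟨n, hn'.1, by rwa [hc0, hcn, norm_neg]⟩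
  refine ⟨u, hus, ?_⟩
  rw [IsRoot.def, eval_sub, eval_C, sub_eq_zero] at hu
  exact hu

theorem norm_eval_trunc_sub_le (F : PowerSeries W) {N : ℕ} (hN : (Finset.Ico 1 N).Nonempty)
    {s : ℝ} (hs : 0 ≤ s) {u : W} (hu : ‖u‖ ≤ s) :
    ‖(PowerSeries.trunc N F).eval u - PowerSeries.constantCoeff F‖ ≤ truncSup F hN s := by
  obtain ⟨m, hm⟩ := id hN
  have hm' := Finset.mem_Ico.mp hm
  have hnn : 0 ≤ truncSup F hN s := le_trans (by positivity)
    (Finset.le_sup' (fun n => ‖PowerSeries.coeff n F‖ * s ^ n) hm)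
  have : (PowerSeries.trunc N F).eval u - PowerSeries.constantCoeff F =
      ∑ n ∈ Finset.Ico 1 N, PowerSeries.coeff n F * u ^ n := by
    have h0 : (PowerSeries.trunc N F).eval u =
        ∑ n ∈ Finset.range N, PowerSeries.coeff n F * u ^ n :=
      PowerSeries.eval₂_trunc_eq_sum_range u (RingHom.id W) N F
    rw [h0, Finset.range_eq_Ico, Finset.sum_eq_sum_Ico_succ_bot (by omega)]
    simp
  rw [this]
  refine IsUltrametricDist.norm_sum_le_of_forall_le_of_nonneg hnn fun n hn => ?_
  refine le_trans ?_ (Finset.le_sup' (fun n => ‖PowerSeries.coeff n F‖ * s ^ n) hn)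
  rw [norm_mul, norm_pow]
  gcongr

/-- Solve `F_N(u) = y` inside the disc of radius `s'` and pass to a root of `R(y, ·)` near `G_N(u)`.
The order `N0` works for all `s' ≤ s` at once; this is needed because the radius used later depends
on the truncation order. -/
theorem exists_near_of_truncSup_le [IsAlgClosed W] {r C : ℝ} (hr : 0 < r) {F G : PowerSeries W}
    (hF : WeightedBound r C F) (hG : WeightedBound r C G) {R : k[X][X]} (hR : evalXY F G R = 0)
    {y : W} (hy : R.map (aeval y : k[X] →ₐ[k] W).toRingHom ≠ 0) {s η : ℝ}
    (hsr : s < r) (hη : 0 < η) :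
    ∃ N0, ∀ N, N0 ≤ N → ∀ hN : (Finset.Ico 1 N).Nonempty, ∀ s', 0 ≤ s' → s' ≤ s →
      ‖y - PowerSeries.constantCoeff F‖ ≤ truncSup F hN s' →
      ∃ α, evalXY y α R = 0 ∧
        ‖α - PowerSeries.constantCoeff G‖ ≤ max (truncSup G hN s') η := by
  by_cases hs : 0 ≤ s
  · obtain ⟨N0, h⟩ := exists_root_near_trunc hr hF hG hR hy hs hsr hη
    refine ⟨N0, fun N hNN hN s' hs' hs's hys => ?_⟩
    obtain ⟨u, hu, huy⟩ := exists_eval_trunc_eq F hN hs' hys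
    obtain ⟨α, hα, hαn⟩ := h N hNN u (hu.trans hs's) huy
    refine ⟨α, hα, ?_⟩
    have h2 := norm_eval_trunc_sub_le G hN hs' hu
    have h3 := IsUltrametricDist.norm_add_le_max (α - (PowerSeries.trunc N G).eval u)
      ((PowerSeries.trunc N G).eval u - PowerSeries.constantCoeff G)
    rw [sub_add_sub_cancel] at h3
    exact h3.trans (max_le (hαn.trans (le_max_right _ _)) (h2.trans (le_max_left _ _)))
  · exact ⟨0, fun N _ hN s' h1 h2 => absurd (h1.trans h2) hs⟩

/-- Let `f₁`, `f₂` be good elements over `t`, at distance more than `ε₁`, `ε₂` from `k`, and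
algebraically dependent over `k`. If `y₁`, `y₂` are approximations of them up to `ε₁`, `ε₂`, then
`f₂` is approximated up to `ε₂` by an element algebraic over `k(y₁)` or `f₁` is approximated up to
`ε₁` by an element algebraic over `k(y₂)`. -/
theorem near_or_near_of_mem_goodElements [IsAlgClosed W] [IsAlgClosed k] {t : W} (ht : t ≠ 0)
    (htk : t ∉ k) {f₁ f₂ y₁ y₂ : W} (hf₁ : f₁ ∈ goodElements k t) (hf₂ : f₂ ∈ goodElements k t)
    {R₁ R₂ : k[X][X]} (hR₁ : R₁ ≠ 0) (hR₂ : R₂ ≠ 0) (h₁₂ : evalXY f₁ f₂ R₁ = 0)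
    (h₂₁ : evalXY f₂ f₁ R₂ = 0) {ε₁ ε₂ η : ℝ} (hε₁ : 0 < ε₁) (hε₂ : 0 < ε₂) (hη : 0 < η)
    (hc₁ : ∀ c ∈ k, ε₁ < ‖f₁ - c‖) (hc₂ : ∀ c ∈ k, ε₂ < ‖f₂ - c‖)
    (hy₁ : ‖y₁ - f₁‖ ≤ ε₁) (hy₂ : ‖y₂ - f₂‖ ≤ ε₂) :
    (∃ α, evalXY y₁ α R₁ = 0 ∧ ‖α - f₂‖ ≤ max ε₂ η) ∨
      (∃ α, evalXY y₂ α R₂ = 0 ∧ ‖α - f₁‖ ≤ max ε₁ η) := by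
  obtain ⟨F₁, hF₁, rfl⟩ := hf₁
  obtain ⟨F₂, hF₂, rfl⟩ := hf₂
  set r := ‖t‖ with hr
  have hr0 : 0 < r := norm_pos_iff.mpr ht
  have hyk : ∀ {f y : W} {ε : ℝ}, (∀ c ∈ k, ε < ‖f - c‖) → ‖y - f‖ ≤ ε → y ∉ k := by
    intro f y ε hc hy hyk
    have := hc y hyk
    rw [norm_sub_rev] at this
    linarith
  have hzero : ∀ {F G : PowerSeries W} {R : k[X][X]}, F ∈ goodSeries k t → G ∈ goodSeries k t →
      evalXY (PowerSeries.constantCoeff F) (PowerSeries.constantCoeff G) R = 0 →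
      evalXY F G R = 0 := by
    intro F G R hF hG h
    refine eq_zero_of_constantCoeff_eq_zero k
      (fun p hp => aeval_ne_zero_of_notMem htk hp) (F := evalXY F G R) ?_ ?_
    · refine (?_ : evalXY F G R ∈ goodSeries k t).2
      rw [evalXY_eq_sum]
      exact Subring.sum_mem _ fun n _ => mul_mem (aeval_mem_goodSeries k hF _) (pow_mem hG n)
    · rw [← h]
      refine map_evalXY_congr (k := k) PowerSeries.constantCoeff (RingHom.id W) ?_ rfl rfl R
      ext c
      simp [algebraMap_powerSeries]
      rfl
  obtain ⟨⟨C₁, hb₁⟩, ha₁⟩ := id hF₁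
  obtain ⟨⟨C₂, hb₂⟩, ha₂⟩ := id hF₂
  replace hb₁ := hb₁.mono (le_max_left C₁ C₂)
  replace hb₂ := hb₂.mono (le_max_right C₁ C₂)
  obtain ⟨n₁, hn₁, hlt₁⟩ := exists_coeff_gt k ht ha₁ hε₁.le hc₁
  obtain ⟨n₂, hn₂, hlt₂⟩ := exists_coeff_gt k ht ha₂ hε₂.le hc₂
  obtain ⟨s, hs0, hsr, hs₁, hs₂⟩ : ∃ s, 0 ≤ s ∧ s < r ∧
      ε₁ < ‖PowerSeries.coeff n₁ F₁‖ * s ^ n₁ ∧ ε₂ < ‖PowerSeries.coeff n₂ F₂‖ * s ^ n₂ := by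
    have hcont : ∀ (a : ℝ) (n : ℕ), Filter.Tendsto (fun s : ℝ => a * s ^ n)
        (nhdsWithin r (Set.Iio r)) (nhds (a * r ^ n)) := fun a n =>
      ((by fun_prop : Continuous fun s : ℝ => a * s ^ n).tendsto r).mono_left nhdsWithin_le_nhds
    obtain ⟨s, h1, h2, h3⟩ := (((hcont _ n₁).eventually (lt_mem_nhds hlt₁)).and
      (((hcont _ n₂).eventually (lt_mem_nhds hlt₂)).and (Ioo_mem_nhdsLT hr0))).exists
    exact ⟨s, h3.1.le, h3.2, h1, h2⟩
  obtain ⟨N₁, hN₁⟩ := exists_near_of_truncSup_le hr0 hb₁ hb₂ (hzero hF₁ hF₂ h₁₂)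
    (map_aeval_ne_zero (hyk hc₁ hy₁) hR₁) hsr hη
  obtain ⟨N₂, hN₂⟩ := exists_near_of_truncSup_le hr0 hb₂ hb₁ (hzero hF₂ hF₁ h₂₁)
    (map_aeval_ne_zero (hyk hc₂ hy₂) hR₂) hsr hη
  set N := max (max N₁ N₂) (max (n₁ + 1) (n₂ + 1)) with hN
  have hm₁ : n₁ ∈ Finset.Ico 1 N := Finset.mem_Ico.mpr ⟨hn₁, by omega⟩
  have hm₂ : n₂ ∈ Finset.Ico 1 N := Finset.mem_Ico.mpr ⟨hn₂, by omega⟩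
  have hne : (Finset.Ico 1 N).Nonempty := ⟨n₁, hm₁⟩
  obtain ⟨s₁, hs₁0, hs₁s, heq₁⟩ := exists_truncSup_eq F₁ hne hs0 hε₁ hm₁ hs₁
  obtain ⟨s₂, hs₂0, hs₂s, heq₂⟩ := exists_truncSup_eq F₂ hne hs0 hε₂ hm₂ hs₂
  -- On the smaller disc both truncations stay within their tolerances. The series that attains its
  -- tolerance there is solved for its `y`, and the other one supplies the approximation.
  rcases le_total s₁ s₂ with h | h
  · left
    obtain ⟨α, hα, hαn⟩ := hN₁ N (by omega) hne s₁ hs₁0 hs₁s (by rwa [heq₁])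
    exact ⟨α, hα, hαn.trans (max_le_max_right _ (heq₂ ▸ truncSup_mono F₂ hne hs₁0 h))⟩
  · right
    obtain ⟨α, hα, hαn⟩ := hN₂ N (by omega) hne s₂ hs₂0 hs₂s (by rwa [heq₂])
    exact ⟨α, hα, hαn.trans (max_le_max_right _ (heq₁ ▸ truncSup_mono F₁ hne hs₂0 h))⟩

end EvalXY

end AnalyticField
end

/-! ### Functions integral over the affine line and their poles at infinity. -/

noncomputable section

namespace AnalyticField

open Polynomial

section PolyIntegral

variable {κ : Type*} [Field κ]

/-- The elements of `A` that are integral over `κ[s]`. -/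
def polyIntegral (κ : Type*) [Field κ] {A : Type*} [CommRing A] [Algebra κ A] (s : A) :
    Subalgebra κ A where
  carrier := {a | (aeval s : κ[X] →ₐ[κ] A).toRingHom.IsIntegralElem a}
  mul_mem' ha hb := ha.mul _ hb
  add_mem' ha hb := ha.add _ hb
  algebraMap_mem' c := by
    have := RingHom.isIntegralElem_map (f := (aeval s : κ[X] →ₐ[κ] A).toRingHom) (x := C c)
    simpa using this

theorem aeval_mem_polyIntegral {A : Type*} [CommRing A] [Algebra κ A] (s : A) (p : κ[X]) :
    aeval s p ∈ polyIntegral κ s :=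
  RingHom.isIntegralElem_map (f := (aeval s : κ[X] →ₐ[κ] A).toRingHom) (x := p)

theorem map_mem_polyIntegral {A B : Type*} [CommRing A] [Algebra κ A] [CommRing B] [Algebra κ B]
    (φ : A →ₐ[κ] B) {s a : A} (ha : a ∈ polyIntegral κ s) : φ a ∈ polyIntegral κ (φ s) := by
  have h : φ.toRingHom.comp (aeval s : κ[X] →ₐ[κ] A).toRingHom =
      (aeval (φ s) : κ[X] →ₐ[κ] B).toRingHom := by
    rw [aeval_algHom]; rfl
  have := RingHom.IsIntegralElem.map ha φ.toRingHom
  rwa [h] at this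

theorem mem_valuationSubring_of_mem_polyIntegral {L : Type*} [Field L] [Algebra κ L]
    {V : ValuationSubring L} (hV : ∀ c : κ, algebraMap κ L c ∈ V) {s a : L} (hs : s ∈ V)
    (ha : a ∈ polyIntegral κ s) : a ∈ V := by
  have h1 : ∀ p : κ[X], aeval s p ∈ V := fun p => by
    rw [aeval_eq_sum_range]
    exact sum_mem fun i _ => by
      rw [Algebra.smul_def]; exact mul_mem (hV _) (pow_mem hs i)
  obtain ⟨p, hp, hpa⟩ := ha
  have h2 : IsIntegral V a := by
    let f : κ[X] →+* V := (aeval s : κ[X] →ₐ[κ] L).toRingHom.codRestrict V h1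
    refine ⟨p.map f, hp.map f, ?_⟩
    rw [eval₂_map]
    exact hpa
  obtain ⟨y, hy⟩ := (IsIntegrallyClosed.isIntegral_iff (R := V) (K := L)).mp h2
  rw [← hy]
  exact y.2

/-- The image of an algebraically closed field is integrally closed in `L`, and an integrally closed
subring is the intersection of the valuation rings that contain it. -/
theorem exists_valuationSubring_notMem [IsAlgClosed κ] {L : Type*} [Field L] [Algebra κ L] {x : L}
    (hx : x ∉ Set.range (algebraMap κ L)) :
    ∃ V : ValuationSubring L, (∀ c : κ, algebraMap κ L c ∈ V) ∧ x ∉ V := by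
  have hint : IsIntegrallyClosedIn (algebraMap κ L).range L := by
    rw [Subring.isIntegrallyClosedIn_iff]
    intro y hy
    have hy' : IsIntegral κ y := by
      obtain ⟨p, hp, hpy⟩ := hy
      have hlift : p ∈ lifts (algebraMap κ L).rangeRestrict := by
        rw [lifts_iff_coeff_lifts]
        exact fun n => (algebraMap κ L).rangeRestrict_surjective _
      obtain ⟨q, hq, -, hqm⟩ := lifts_and_natDegree_eq_and_monic hlift hp
      refine ⟨q, hqm, ?_⟩
      rw [← hq, eval₂_map] at hpy
      exact hpy
    exact minpoly.mem_range_of_degree_eq_one κ y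
      (IsAlgClosed.degree_eq_one_of_irreducible κ (minpoly.irreducible hy'))
  obtain ⟨V, hV, hxV⟩ := Subring.exists_le_valuationSubring_of_isIntegrallyClosedIn
    (R := (algebraMap κ L).range) (x := x) (by simpa using hx)
  exact ⟨V, fun c => hV ⟨c, rfl⟩, hxV⟩

/-- A function on the line integral away from `∞`, and with a zero at `∞`, vanishes. -/
theorem eq_zero_of_mem_polyIntegral_inv [IsAlgClosed κ] {L : Type*} [Field L] [Algebra κ L]
    {s h : L} (hs : s ∉ Set.range (algebraMap κ L)) (h1 : h ∈ polyIntegral κ s)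
    (h2 : s * h ∈ polyIntegral κ s⁻¹) : h = 0 := by
  have hs0 : s ≠ 0 := by
    rintro rfl
    exact hs ⟨0, map_zero _⟩
  -- Every valuation ring over `κ` contains `s` or `s⁻¹`, and integrality in the corresponding chart
  -- puts `h` into it; so `h` is constant. A nonzero constant is then excluded by a valuation at
  -- which `s` has a pole.
  have hc : h ∈ Set.range (algebraMap κ L) := by
    by_contra hc
    obtain ⟨V, hV, hhV⟩ := exists_valuationSubring_notMem hc
    rcases V.mem_or_inv_mem s with hsV | hsV
    · exact hhV (mem_valuationSubring_of_mem_polyIntegral hV hsV h1)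
    · refine hhV ?_
      have := mul_mem hsV (mem_valuationSubring_of_mem_polyIntegral hV hsV h2)
      rwa [inv_mul_cancel_left₀ hs0] at this
  by_contra hne
  obtain ⟨c, rfl⟩ := hc
  obtain ⟨V, hV, hsV⟩ := exists_valuationSubring_notMem hs
  have hsV' := (V.mem_or_inv_mem s).resolve_left hsV
  have := mul_mem (mem_valuationSubring_of_mem_polyIntegral hV hsV' h2) (hV c⁻¹)
  rw [mul_assoc, ← map_mul, mul_inv_cancel₀ (by rintro rfl; simp at hne), map_one, mul_one] at this
  exact hsV this

variable {E A : Type*} [Field E] [CommRing A] [Algebra κ E] [Algebra E A] [Algebra κ A]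
  [IsScalarTower κ E A]

/-- The field case, applied to the fraction field of the quotient by each prime, shows that `h` lies
in every prime; a reduced ring has no other nilpotent than zero. -/
theorem eq_zero_of_mem_polyIntegral_of_isReduced [IsAlgClosed κ] [IsReduced A] {t : E}
    (ht : t ∉ Set.range (algebraMap κ E)) {h : A} (h1 : h ∈ polyIntegral κ (algebraMap E A t))
    (h2 : algebraMap E A t * h ∈ polyIntegral κ (algebraMap E A t⁻¹)) : h = 0 := by
  refine IsNilpotent.eq_zero (nilpotent_iff_mem_prime.mpr fun P hP => ?_)
  let L := FractionRing (A ⧸ P)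
  let φ : A →ₐ[E] L := (IsScalarTower.toAlgHom E (A ⧸ P) L).comp (Ideal.Quotient.mkₐ E P)
  have hφ : ∀ e : E, φ (algebraMap E A e) = algebraMap E L e := fun e => φ.commutes e
  have hs : algebraMap E L t ∉ Set.range (algebraMap κ L) := by
    rintro ⟨c, hc⟩
    rw [IsScalarTower.algebraMap_apply κ E L] at hc
    exact ht ⟨c, (algebraMap E L).injective hc⟩
  have := eq_zero_of_mem_polyIntegral_inv (h := φ h) hs
    (by rw [← hφ]; exact map_mem_polyIntegral (φ.restrictScalars κ) h1)
    (by
      have := map_mem_polyIntegral (φ.restrictScalars κ) h2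
      simpa [hφ] using this)
  have h3 : (algebraMap (A ⧸ P) L) (Ideal.Quotient.mk P h) = 0 := this
  rw [map_eq_zero_iff _ (IsFractionRing.injective (A ⧸ P) L)] at h3
  exact Ideal.Quotient.eq_zero_iff_mem.mp h3

theorem exists_common_multiple {t : E}
    (hE : ∀ e : E, ∃ p q : κ[X], aeval t q ≠ 0 ∧ aeval t q * e = aeval t p)
    {ι : Type*} [Fintype ι] (e : ι → E) :
    ∃ (q : κ[X]) (p : ι → κ[X]), aeval t q ≠ 0 ∧ ∀ i, aeval t q * e i = aeval t (p i) := by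
  classical
  choose p q hq hpq using hE
  refine ⟨∏ i, q (e i), fun i => (∏ j ∈ Finset.univ.erase i, q (e j)) * p (e i), ?_, fun i => ?_⟩
  · rw [map_prod]
    exact Finset.prod_ne_zero_iff.mpr fun i _ => hq _
  · rw [← Finset.prod_erase_mul _ _ (Finset.mem_univ i), map_mul, map_mul, mul_assoc, hpq]

/-- `n` elements integral over `κ[t]` that are independent over `κ` modulo `t` are independent
over `κ(t)`. -/
theorem linearIndependent_of_mod {t : E} (ht : t ∉ Set.range (algebraMap κ E))
    (hE : ∀ e : E, ∃ p q : κ[X], aeval t q ≠ 0 ∧ aeval t q * e = aeval t p)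
    {ι : Type*} [Fintype ι] {w : ι → A} (hw : ∀ i, w i ∈ polyIntegral κ (algebraMap E A t))
    (hind : ∀ c : ι → κ, (∃ h ∈ polyIntegral κ (algebraMap E A t),
      ∑ i, c i • w i = algebraMap E A t * h) → c = 0) : LinearIndependent E w := by
  have ht0 : t ≠ 0 := by
    rintro rfl
    exact ht ⟨0, map_zero _⟩
  -- Given a relation with coefficients in `κ[t]`, its constant terms form a relation modulo `t` and
  -- vanish; division by `t` lowers the degree.
  have key : ∀ (N : ℕ) (P : ι → κ[X]), (∀ i, (P i).natDegree ≤ N) →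
      ∑ i, aeval t (P i) • w i = 0 → P = 0 := by
    intro N
    induction N with
    | zero =>
      intro P hP hsum
      have : (fun i => (P i).coeff 0) = 0 := hind _ ⟨0, zero_mem _, by
        rw [mul_zero, ← hsum]
        refine Finset.sum_congr rfl fun i _ => ?_
        conv_rhs => rw [eq_C_of_natDegree_le_zero (hP i)]
        simp⟩
      funext i
      rw [eq_C_of_natDegree_le_zero (hP i), congrFun this i]
      simp
    | succ N ih =>
      intro P hP hsum
      have hdec : ∀ i, aeval t (P i) • w i =
          (P i).coeff 0 • w i + algebraMap E A t * (aeval t (P i).divX • w i) := by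
        intro i
        conv_lhs => rw [← divX_mul_X_add (P i)]
        rw [map_add, map_mul, aeval_X, aeval_C, add_smul, algebraMap_smul, add_comm, mul_comm,
          mul_smul, Algebra.smul_def t]
      simp only [hdec] at hsum
      rw [Finset.sum_add_distrib, ← Finset.mul_sum] at hsum
      have h0 : (fun i => (P i).coeff 0) = 0 := hind _ ⟨-∑ i, aeval t (P i).divX • w i, by
        refine neg_mem (sum_mem fun i _ => ?_)
        rw [Algebra.smul_def, ← aeval_algebraMap_apply]
        exact mul_mem (aeval_mem_polyIntegral _ _) (hw i), by
        rw [mul_neg]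
        exact eq_neg_of_add_eq_zero_left hsum⟩
      have h1 : ∑ i, aeval t (P i).divX • w i = 0 := by
        have h2 : ∑ i, (P i).coeff 0 • w i = 0 := Finset.sum_eq_zero fun i _ => by
          rw [show (P i).coeff 0 = 0 from congrFun h0 i, zero_smul]
        rw [h2, zero_add] at hsum
        have hu : IsUnit (algebraMap E A t) := (Ne.isUnit ht0).map _
        exact hu.mul_right_eq_zero.mp hsum
      have h2 := ih (fun i => (P i).divX) (fun i => by
        rw [natDegree_divX_eq_natDegree_tsub_one]
        have := hP i
        omega) h1
      funext i
      rw [← divX_mul_X_add (P i), show (P i).divX = 0 from congrFun h2 i,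
        show (P i).coeff 0 = 0 from congrFun h0 i]
      simp
  rw [Fintype.linearIndependent_iff]
  intro e he i
  obtain ⟨q, p, hq, hp⟩ := exists_common_multiple hE e
  have := key (Finset.univ.sup fun i => (p i).natDegree) p
    (fun i => Finset.le_sup (f := fun i => (p i).natDegree) (Finset.mem_univ i)) (by
      rw [← smul_zero (aeval t q), ← he, Finset.smul_sum]
      exact Finset.sum_congr rfl fun j _ => by rw [smul_smul, hp])
  have h3 := hp i
  rw [show p i = 0 from congrFun this i, map_zero] at h3
  exact (mul_eq_zero.mp h3).resolve_left hq

/-- The elements integral over `κ[t]` with a pole of order at most `n` at infinity. -/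
def polarSubmodule (κ : Type*) [Field κ] {E A : Type*} [Field E] [CommRing A] [Algebra E A]
    [Algebra κ A] (t : E) (n : ℕ) : Submodule κ A :=
  (polyIntegral κ (algebraMap E A t)).toSubmodule ⊓
    (polyIntegral κ (algebraMap E A t⁻¹)).toSubmodule.comap
      (LinearMap.mulLeft κ (algebraMap E A t⁻¹ ^ n))

/-- A Riemann-Roch estimate by induction on the pole order. Modulo `t` the space has rank at most
`[A : E]`, by `linearIndependent_of_mod`. The elements divisible by `t` become, after division,
elements with one pole order less; for pole order zero they vanish by
`eq_zero_of_mem_polyIntegral_of_isReduced`. -/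
theorem rank_polarSubmodule_le [IsAlgClosed κ] [IsReduced A] [FiniteDimensional E A] {t : E}
    (ht : t ∉ Set.range (algebraMap κ E))
    (hE : ∀ e : E, ∃ p q : κ[X], aeval t q ≠ 0 ∧ aeval t q * e = aeval t p) (n : ℕ) :
    Module.rank κ (polarSubmodule κ (A := A) t n) ≤ (Module.finrank E A * (n + 1) : ℕ) := by
  have ht0 : t ≠ 0 := by
    rintro rfl
    exact ht ⟨0, map_zero _⟩
  have hinv : ∀ a : A, algebraMap E A t⁻¹ * (algebraMap E A t * a) = a := fun a => by
    rw [← mul_assoc, ← map_mul, inv_mul_cancel₀ ht0, map_one, one_mul]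
  set B := (polyIntegral κ (algebraMap E A t)).toSubmodule with hB
  set I := B.map (LinearMap.mulLeft κ (algebraMap E A t)) with hI
  have hquot : ∀ G : Submodule κ A, G ≤ B →
      Module.rank κ (LinearMap.range (I.mkQ.domRestrict G)) ≤ (Module.finrank E A : ℕ) := by
    intro G hG
    refine rank_le fun s hs => ?_
    choose w hw using fun i : s => (i : LinearMap.range (I.mkQ.domRestrict G)).2
    have := linearIndependent_of_mod (w := fun i => (w i : A)) ht hE (fun i => hG (w i).2) (by
      rintro c ⟨h, hh, hsum⟩
      have hz : ∑ i, c i • (i : LinearMap.range (I.mkQ.domRestrict G)) = 0 := by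
        refine Subtype.ext ?_
        rw [AddSubmonoidClass.coe_finsetSum]
        simp only [SetLike.val_smul, ← hw]
        have : I.mkQ (∑ i, c i • (w i : A)) = 0 := by
          rw [Submodule.mkQ_apply, Submodule.Quotient.mk_eq_zero, hsum]
          exact ⟨h, hh, rfl⟩
        rw [map_sum] at this
        simpa using this
      funext i
      exact Fintype.linearIndependent_iff.mp hs c hz i)
    simpa using this.fintype_card_le_finrank
  have hker : ∀ g ∈ polarSubmodule κ (A := A) t n, I.mkQ g = 0 →
      ∃ h ∈ B, g = algebraMap E A t * h ∧ algebraMap E A t⁻¹ ^ n * g ∈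
        polyIntegral κ (algebraMap E A t⁻¹) := by
    intro g hg hg0
    rw [Submodule.mkQ_apply, Submodule.Quotient.mk_eq_zero] at hg0
    obtain ⟨h, hh, rfl⟩ := hg0
    exact ⟨h, hh, rfl, hg.2⟩
  induction n with
  | zero =>
    rw [← LinearMap.rank_range_add_rank_ker (I.mkQ.domRestrict (polarSubmodule κ t 0))]
    have : LinearMap.ker (I.mkQ.domRestrict (polarSubmodule κ (A := A) t 0)) = ⊥ := by
      rw [LinearMap.ker_eq_bot']
      intro g hg
      obtain ⟨h, hh, hgh, hg2⟩ := hker g.1 g.2 hg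
      rw [pow_zero, one_mul, hgh] at hg2
      have := eq_zero_of_mem_polyIntegral_of_isReduced ht hh hg2
      exact Subtype.ext (by rw [hgh, this, mul_zero]; rfl)
    rw [this, rank_bot, add_zero]
    rw [zero_add, mul_one]
    exact hquot (polarSubmodule κ t 0) inf_le_left
  | succ n ih =>
    rw [← LinearMap.rank_range_add_rank_ker (I.mkQ.domRestrict (polarSubmodule κ t (n + 1)))]
    have hk : Module.rank κ (LinearMap.ker (I.mkQ.domRestrict (polarSubmodule κ (A := A) t (n + 1))))
        ≤ Module.rank κ (polarSubmodule κ (A := A) t n) := by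
      have hmem : ∀ x : LinearMap.ker (I.mkQ.domRestrict (polarSubmodule κ (A := A) t (n + 1))),
          algebraMap E A t⁻¹ * (x : A) ∈ polarSubmodule κ (A := A) t n := by
        intro x
        obtain ⟨h, hh, hgh, hg2⟩ := hker x.1.1 x.1.2 x.2
        rw [hgh, hinv]
        refine ⟨hh, ?_⟩
        rw [hgh, pow_succ, mul_assoc, hinv] at hg2
        exact hg2
      let f : LinearMap.ker (I.mkQ.domRestrict (polarSubmodule κ (A := A) t (n + 1))) →ₗ[κ]
          polarSubmodule κ (A := A) t n :=
        ((LinearMap.mulLeft κ (algebraMap E A t⁻¹)).comp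
          ((Submodule.subtype _).comp (Submodule.subtype _))).codRestrict _ hmem
      refine f.rank_le_of_injective fun x y hxy => ?_
      have h1 : algebraMap E A t⁻¹ * (x : A) = algebraMap E A t⁻¹ * (y : A) :=
        congrArg Subtype.val hxy
      have hu : IsUnit (algebraMap E A t⁻¹) := (Ne.isUnit (inv_ne_zero ht0)).map _
      exact Subtype.ext (Subtype.ext (hu.mul_left_cancel h1))
    have hih := ih fun g hg hg0 => by
      rw [Submodule.mkQ_apply, Submodule.Quotient.mk_eq_zero] at hg0
      obtain ⟨h, hh, rfl⟩ := hg0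
      exact ⟨h, hh, rfl, hg.2⟩
    refine (add_le_add (hquot _ inf_le_left) (hk.trans hih)).trans (le_of_eq ?_)
    push_cast
    ring

end PolyIntegral

end AnalyticField
end

/-! ### Simple roots of characteristic polynomials in finite reduced algebras. -/

noncomputable section

namespace AnalyticField

open Polynomial

section SimpleRoot

variable {E : Type*} [Field E]

theorem charpoly_mulLeft_eq_minpoly {L : Type*} [Field L] [Algebra E L] [FiniteDimensional E L]
    {α : L} (hα : IntermediateField.adjoin E {α} = ⊤) :
    (LinearMap.mulLeft E α).charpoly = minpoly E α := by
  have hint : IsIntegral E α := Algebra.IsIntegral.isIntegral α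
  have hdvd : minpoly E α ∣ (LinearMap.mulLeft E α).charpoly := by
    refine minpoly.dvd E α ?_
    have h1 := LinearMap.aeval_self_charpoly (LinearMap.mulLeft E α)
    have h2 : aeval (LinearMap.mulLeft E α) (LinearMap.mulLeft E α).charpoly =
        Algebra.lmul E L (aeval α (LinearMap.mulLeft E α).charpoly) := by
      rw [← aeval_algHom_apply]; rfl
    rw [h2] at h1
    simpa using congrArg (fun f => f 1) h1
  refine eq_of_monic_of_dvd_of_natDegree_le (minpoly.monic hint)
    (LinearMap.charpoly_monic _) hdvd ?_
  rw [LinearMap.charpoly_natDegree, ← IntermediateField.finrank_top' (F := E) (E := L), ← hα,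
    IntermediateField.adjoin.finrank hint]

/-- The generator must be nonzero because the characteristic polynomial below has a power of `X` as
a second factor, which must not vanish at it. -/
theorem exists_ne_zero_adjoin_eq_top {L : Type*} [Field L] [Algebra E L] [FiniteDimensional E L]
    [Algebra.IsSeparable E L] : ∃ α : L, α ≠ 0 ∧ IntermediateField.adjoin E {α} = ⊤ := by
  obtain ⟨α, hα⟩ := Field.exists_primitive_element E L
  by_cases h0 : α = 0
  · refine ⟨1, one_ne_zero, ?_⟩
    subst h0
    rw [← hα]
    simp
  · exact ⟨α, h0, hα⟩

/-- In a finite reduced algebra there is an element whose value in a given separable residue field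
is a simple root of its characteristic polynomial. -/
theorem exists_eval_derivative_charpoly_ne_zero {A L : Type*} [CommRing A] [IsReduced A]
    [Algebra E A] [FiniteDimensional E A] [Field L] [Algebra E L] (π : A →ₐ[E] L)
    [Algebra.IsSeparable E L] :
    ∃ a : A, aeval (π a) (derivative (LinearMap.mulLeft E a).charpoly) ≠ 0 := by
  have : IsArtinianRing A := IsArtinianRing.of_finite E A
  have : IsSemisimpleRing A := IsArtinianRing.isSemisimpleRing_of_isReduced A
  set m : Ideal A := RingHom.ker π with hm
  have hprime : m.IsPrime := RingHom.ker_isPrime _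
  have hmax : m.IsMaximal := IsArtinianRing.isMaximal_of_isPrime m
  obtain ⟨J, hJ⟩ := exists_isCompl (m : Submodule A A)
  let _ : Field (A ⧸ m) := Ideal.Quotient.field m
  let ρ : A ⧸ m →ₐ[E] L := Ideal.kerLiftAlg π
  have hsep : Algebra.IsSeparable E (A ⧸ m) := Algebra.IsSeparable.of_algHom E L ρ
  have hfin : FiniteDimensional E (A ⧸ m) :=
    Module.Finite.of_surjective (Ideal.Quotient.mkₐ E m).toLinearMap Ideal.Quotient.mk_surjective
  have hfin' : FiniteDimensional E (A ⧸ J) :=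
    Module.Finite.of_surjective (Ideal.Quotient.mkₐ E J).toLinearMap Ideal.Quotient.mk_surjective
  let φ : A →ₐ[E] (A ⧸ m) × (A ⧸ J) := (Ideal.Quotient.mkₐ E m).prod (Ideal.Quotient.mkₐ E J)
  have hinj : Function.Injective φ := by
    rw [injective_iff_map_eq_zero]
    intro a ha
    have h1 : a ∈ m := Ideal.Quotient.eq_zero_iff_mem.mp (congrArg Prod.fst ha)
    have h2 : a ∈ J := Ideal.Quotient.eq_zero_iff_mem.mp (congrArg Prod.snd ha)
    exact (Submodule.mem_bot A).mp (hJ.inf_eq_bot ▸ ⟨h1, h2⟩)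
  have hsurj : Function.Surjective φ := by
    rintro ⟨x, y⟩
    obtain ⟨x, rfl⟩ := Ideal.Quotient.mk_surjective x
    obtain ⟨y, rfl⟩ := Ideal.Quotient.mk_surjective y
    obtain ⟨i, hi, j, hj, hij⟩ := Submodule.mem_sup.mp
      (hJ.sup_eq_top ▸ Submodule.mem_top : (1 : A) ∈ (m : Submodule A A) ⊔ J)
    refine ⟨x * j + y * i, Prod.ext ?_ ?_⟩
    · refine Ideal.Quotient.eq.mpr ?_
      have : x * j + y * i - x = (y - x) * i := by linear_combination x * hij
      rw [this]
      exact Ideal.mul_mem_left _ _ hi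
    · refine Ideal.Quotient.eq.mpr ?_
      have : x * j + y * i - y = (x - y) * j := by linear_combination y * hij
      rw [this]
      exact Ideal.mul_mem_left _ _ hj
  -- By semisimplicity `A` splits as `A / m × A / J`. The element `(α, 0)`, with `α` primitive in
  -- the first factor, has characteristic polynomial `minpoly α * X ^ n`, of which `α` is a simple
  -- root.
  obtain ⟨α, hα0, hα⟩ := exists_ne_zero_adjoin_eq_top (E := E) (L := A ⧸ m)
  obtain ⟨a, ha⟩ := hsurj (α, 0)
  have ha1 : Ideal.Quotient.mk m a = α := congrArg Prod.fst ha
  refine ⟨a, ?_⟩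
  let e : A ≃ₗ[E] (A ⧸ m) × (A ⧸ J) := LinearEquiv.ofBijective φ.toLinearMap ⟨hinj, hsurj⟩
  have hchar : (LinearMap.mulLeft E a).charpoly =
      minpoly E α * X ^ Module.finrank E (A ⧸ J) := by
    rw [← LinearEquiv.charpoly_conj e]
    have : e.conj (LinearMap.mulLeft E a) =
        (LinearMap.mulLeft E α).prodMap (0 : (A ⧸ J) →ₗ[E] (A ⧸ J)) := by
      refine LinearMap.ext fun z => ?_
      obtain ⟨b, rfl⟩ := e.surjective z
      rw [LinearEquiv.conj_apply_apply, e.symm_apply_apply]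
      have h1 : e (LinearMap.mulLeft E a b) = φ a * φ b := map_mul φ a b
      rw [h1, ha]
      exact Prod.ext rfl (zero_mul _)
    rw [this, LinearMap.charpoly_prodMap, charpoly_mulLeft_eq_minpoly hα, LinearMap.charpoly_zero]
  have hπa : π a = ρ α := by rw [← ha1]; rfl
  have hsepα : (minpoly E α).Separable := Algebra.IsSeparable.isSeparable E α
  rw [hchar, hπa, aeval_algHom_apply, derivative_mul, map_add, map_mul, map_mul, minpoly.aeval,
    zero_mul, add_zero, map_pow, aeval_X, _root_.map_ne_zero]
  exact mul_ne_zero (hsepα.aeval_derivative_ne_zero (minpoly.aeval E α)) (pow_ne_zero _ hα0)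

end SimpleRoot

end AnalyticField
end

/-! ### Nonarchimedean norms and their reductions. -/

noncomputable section

namespace AnalyticField

open Polynomial

/-- A submultiplicative nonarchimedean norm on a commutative ring. -/
structure UltraNorm (R : Type*) [CommRing R] where
  toFun : R → ℝ
  nonneg' : ∀ x, 0 ≤ toFun x
  zero' : toFun 0 = 0
  one' : toFun 1 ≤ 1
  neg' : ∀ x, toFun (-x) = toFun x
  add' : ∀ x y, toFun (x + y) ≤ max (toFun x) (toFun y)
  mul' : ∀ x y, toFun (x * y) ≤ toFun x * toFun y

namespace UltraNorm

variable {R S : Type*} [CommRing R] [CommRing S]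

instance : CoeFun (UltraNorm R) fun _ => R → ℝ := ⟨toFun⟩

variable (N : UltraNorm R) {N' : UltraNorm S}

theorem sum_le {ι : Type*} (s : Finset ι) (f : ι → R) {C : ℝ} (hC : 0 ≤ C)
    (h : ∀ i ∈ s, N (f i) ≤ C) : N (∑ i ∈ s, f i) ≤ C := by
  classical
  induction s using Finset.induction_on with
  | empty => simpa [N.zero'] using hC
  | insert a s ha ih =>
    rw [Finset.sum_insert ha]
    exact (N.add' _ _).trans (max_le (h a (Finset.mem_insert_self _ _))
      (ih fun i hi => h i (Finset.mem_insert_of_mem hi)))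

theorem mul_le_one {x y : R} (hx : N x ≤ 1) (hy : N y ≤ 1) : N (x * y) ≤ 1 :=
  (N.mul' x y).trans (mul_le_one₀ hx (N.nonneg' _) hy)

theorem pow_le_one {x : R} (hx : N x ≤ 1) (n : ℕ) : N (x ^ n) ≤ 1 := by
  induction n with
  | zero => simpa using N.one'
  | succ n ih => rw [pow_succ]; exact N.mul_le_one ih hx

/-- The elements of norm at most one. -/
def ball : Subring R where
  carrier := {x | N x ≤ 1}
  mul_mem' hx hy := N.mul_le_one hx hy
  one_mem' := N.one'
  add_mem' {x y} hx hy := (N.add' x y).trans (max_le hx hy)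
  zero_mem' := by simp [N.zero']
  neg_mem' {x} hx := by simpa [N.neg'] using hx

/-- The elements of norm less than one. -/
def openBall : Ideal N.ball where
  carrier := {x | N x < 1}
  add_mem' {x y} hx hy := (N.add' x y).trans_lt (max_lt hx hy)
  zero_mem' := by simp [N.zero']
  smul_mem' c x hx := (N.mul' c x).trans_lt
    ((mul_le_of_le_one_left (N.nonneg' _) c.2).trans_lt hx)

/-- The reduction: elements of norm at most one modulo elements of norm less than one. -/
def Red : Type _ := N.ball ⧸ N.openBall

instance : CommRing N.Red := inferInstanceAs (CommRing (N.ball ⧸ N.openBall))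

open Classical in
/-- The reduction of an element of norm at most one, and `0` for other elements. -/
def red (x : R) : N.Red :=
  if h : N x ≤ 1 then (Ideal.Quotient.mk N.openBall ⟨x, h⟩ : N.ball ⧸ N.openBall) else 0

variable {N}

theorem red_of_le {x : R} (h : N x ≤ 1) :
    N.red x = (Ideal.Quotient.mk N.openBall ⟨x, h⟩ : N.ball ⧸ N.openBall) := dif_pos h

theorem red_eq_zero_iff {x : R} (h : N x ≤ 1) : N.red x = 0 ↔ N x < 1 := by
  rw [red_of_le h]
  exact Ideal.Quotient.eq_zero_iff_mem

theorem red_add {x y : R} (hx : N x ≤ 1) (hy : N y ≤ 1) : N.red (x + y) = N.red x + N.red y := by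
  rw [red_of_le hx, red_of_le hy, red_of_le (N.ball.add_mem hx hy)]
  rfl

theorem red_neg {x : R} (hx : N x ≤ 1) : N.red (-x) = -N.red x := by
  rw [red_of_le hx, red_of_le (N.ball.neg_mem hx)]
  rfl

theorem red_sub {x y : R} (hx : N x ≤ 1) (hy : N y ≤ 1) : N.red (x - y) = N.red x - N.red y := by
  rw [sub_eq_add_neg, sub_eq_add_neg, red_add hx (N.ball.neg_mem hy), red_neg hy]

theorem red_mul {x y : R} (hx : N x ≤ 1) (hy : N y ≤ 1) : N.red (x * y) = N.red x * N.red y := by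
  rw [red_of_le hx, red_of_le hy, red_of_le (N.mul_le_one hx hy)]
  rfl

theorem red_zero : N.red 0 = 0 := by
  rw [red_eq_zero_iff (by simp [N.zero']), N.zero']
  exact one_pos

theorem red_one : N.red 1 = 1 := by
  rw [red_of_le N.one']
  rfl

theorem red_pow {x : R} (hx : N x ≤ 1) (n : ℕ) : N.red (x ^ n) = N.red x ^ n := by
  induction n with
  | zero => simp [red_one]
  | succ n ih => rw [pow_succ, pow_succ, red_mul (N.pow_le_one hx n) hx, ih]

theorem red_sum {ι : Type*} (s : Finset ι) (f : ι → R) (h : ∀ i ∈ s, N (f i) ≤ 1) :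
    N.red (∑ i ∈ s, f i) = ∑ i ∈ s, N.red (f i) := by
  classical
  induction s using Finset.induction_on with
  | empty => simp [red_zero]
  | insert a s ha ih =>
    have h' : ∀ i ∈ s, N (f i) ≤ 1 := fun i hi => h i (Finset.mem_insert_of_mem hi)
    rw [Finset.sum_insert ha, Finset.sum_insert ha,
      red_add (h a (Finset.mem_insert_self _ _)) (N.sum_le s f zero_le_one h'), ih h']

theorem red_eq_iff {x y : R} (hx : N x ≤ 1) (hy : N y ≤ 1) :
    N.red x = N.red y ↔ N (x - y) < 1 := by
  rw [← sub_eq_zero, ← red_sub hx hy, red_eq_zero_iff]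
  exact N.ball.sub_mem hx hy

theorem exists_red_eq (a : N.Red) : ∃ x, N x ≤ 1 ∧ N.red x = a := by
  obtain ⟨⟨x, hx⟩, hxa⟩ := Ideal.Quotient.mk_surjective (I := N.openBall) a
  exact ⟨x, hx, (red_of_le hx).trans hxa⟩

/-- The ring homomorphism between reductions induced by a contracting homomorphism. -/
def Red.map (f : R →+* S) (hf : ∀ x, N' (f x) ≤ N x) : N.Red →+* N'.Red :=
  Ideal.quotientMap N'.openBall
    (f.restrict N.ball N'.ball fun x hx => (hf x).trans hx)
    fun x hx => (hf x).trans_lt hx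

theorem Red.map_red (f : R →+* S) (hf : ∀ x, N' (f x) ≤ N x) {x : R} (hx : N x ≤ 1) :
    Red.map f hf (N.red x) = N'.red (f x) := by
  rw [red_of_le hx, red_of_le ((hf x).trans hx)]
  rfl

theorem isReduced_red (hN : ∀ x n, 1 ≤ n → N (x ^ n) = N x ^ n) : IsReduced N.Red := by
  refine ⟨fun a ⟨n, hn⟩ => ?_⟩
  obtain ⟨x, hx, rfl⟩ := exists_red_eq a
  rw [← red_pow hx, red_eq_zero_iff (N.pow_le_one hx n)] at hn
  rw [red_eq_zero_iff hx]
  by_contra! h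
  have h1 : N x = 1 := le_antisymm hx h
  rcases n with _ | n
  · rw [pow_zero] at hn
    have := N.mul' 1 x
    rw [one_mul, h1] at this
    linarith
  · rw [hN x _ (by omega), h1, one_pow] at hn
    exact lt_irrefl _ hn

/-- The norm of an ultrametric normed field. -/
def ofField (L : Type*) [NormedField L] [IsUltrametricDist L] : UltraNorm L where
  toFun x := ‖x‖
  nonneg' := norm_nonneg
  zero' := norm_zero
  one' := norm_one.le
  neg' := norm_neg
  add' := IsUltrametricDist.norm_add_le_max
  mul' x y := (norm_mul x y).le

theorem ofField_apply {L : Type*} [NormedField L] [IsUltrametricDist L] (x : L) :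
    ofField L x = ‖x‖ := rfl

end UltraNorm

open UltraNorm

/-- The residue field of an ultrametric normed field. -/
abbrev Residue (L : Type*) [NormedField L] [IsUltrametricDist L] : Type _ := (ofField L).Red

/-- The reduction map of an ultrametric normed field. -/
abbrev residue {L : Type*} [NormedField L] [IsUltrametricDist L] (x : L) : Residue L :=
  (ofField L).red x

section Residue

variable {L : Type*} [NormedField L] [IsUltrametricDist L]

theorem residue_eq_zero_iff {x : L} (hx : ‖x‖ ≤ 1) : residue x = 0 ↔ ‖x‖ < 1 :=
  red_eq_zero_iff (N := ofField L) hx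

instance : Field (Residue L) := IsField.toField
  { exists_pair_ne := ⟨0, 1, fun h => by
      rw [← red_one, eq_comm, red_eq_zero_iff (ofField L).one'] at h
      simp [ofField_apply] at h⟩
    mul_comm := mul_comm
    mul_inv_cancel := fun {a} ha => by
      obtain ⟨x, hx, rfl⟩ := exists_red_eq a
      have h1 : ‖x‖ = 1 := by
        rw [Ne, red_eq_zero_iff hx, not_lt] at ha
        exact le_antisymm hx ha
      have h2 : ‖x⁻¹‖ ≤ 1 := by rw [norm_inv, h1, inv_one]
      refine ⟨(ofField L).red x⁻¹, ?_⟩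
      rw [← red_mul hx h2, mul_inv_cancel₀ (by rintro rfl; simp at h1), red_one] }

instance [IsAlgClosed L] : IsAlgClosed (Residue L) := by
  refine IsAlgClosed.of_exists_root _ fun p hp hirr => ?_
  choose f hf1 hf using fun a : Residue L => exists_red_eq a
  set n := p.natDegree with hn
  set P : L[X] := X ^ n + ∑ i ∈ Finset.range n, C (f (p.coeff i)) * X ^ i with hP
  have hdeg : (∑ i ∈ Finset.range n, C (f (p.coeff i)) * X ^ i : L[X]).degree < n := by
    refine (degree_sum_le _ _).trans_lt ((Finset.sup_lt_iff (WithBot.bot_lt_coe _)).mpr ?_)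
    intro i hi
    exact (degree_C_mul_X_pow_le _ _).trans_lt (by exact_mod_cast Finset.mem_range.mp hi)
  have hPd : P.degree = n := by
    rw [hP, degree_add_eq_left_of_degree_lt (by rwa [degree_X_pow]), degree_X_pow]
  obtain ⟨x, hx⟩ := IsAlgClosed.exists_root P (by
    rw [hPd]
    have := hirr.natDegree_pos
    exact_mod_cast this.ne')
  have heval : x ^ n + ∑ i ∈ Finset.range n, f (p.coeff i) * x ^ i = 0 := by
    have := hx
    rw [IsRoot.def, hP, eval_add, eval_finsetSum] at this
    simpa using this
  have hx1 : ‖x‖ ≤ 1 := by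
    by_contra! h
    have hxn : x ^ n = -∑ i ∈ Finset.range n, f (p.coeff i) * x ^ i :=
      eq_neg_of_add_eq_zero_left heval
    have hle : ‖x ^ n‖ ≤ ‖x‖ ^ (n - 1) := by
      rw [hxn, norm_neg]
      refine (ofField L).sum_le _ _ (by positivity) fun i hi => ?_
      rw [ofField_apply, norm_mul, norm_pow]
      have h1 : ‖x‖ ^ i ≤ ‖x‖ ^ (n - 1) := by
        refine pow_le_pow_right₀ h.le ?_
        have := Finset.mem_range.mp hi
        omega
      exact (mul_le_of_le_one_left (by positivity) (hf1 _)).trans h1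
    rw [norm_pow] at hle
    have := hirr.natDegree_pos
    have := (pow_lt_pow_iff_right₀ h).mpr (by omega : n - 1 < n)
    linarith
  refine ⟨residue x, ?_⟩
  have hterm : ∀ i ∈ Finset.range n, ofField L (f (p.coeff i) * x ^ i) ≤ 1 := fun i _ =>
    (ofField L).mul_le_one (hf1 _) ((ofField L).pow_le_one hx1 i)
  rw [eval_eq_sum_range, Finset.sum_range_succ, ← hn]
  have h0 := congrArg (ofField L).red heval
  rw [red_zero, red_add ((ofField L).pow_le_one hx1 n) ((ofField L).sum_le _ _ zero_le_one hterm),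
    red_sum _ _ hterm, red_pow hx1] at h0
  have hlead : p.coeff n = 1 := hp
  rw [hlead, one_mul, add_comm, ← h0]
  refine congrArg _ (Finset.sum_congr rfl fun i _ => ?_)
  rw [red_mul (hf1 _) ((ofField L).pow_le_one hx1 i), red_pow hx1, hf]

end Residue

section Algebras

variable {k F M : Type*} [NormedField k] [IsUltrametricDist k] [NormedField F]
  [IsUltrametricDist F] [NormedAlgebra k F] [CommRing M] [Algebra F M]

instance : Algebra (Residue k) (Residue F) :=
  (Red.map (N := ofField k) (N' := ofField F) (algebraMap k F)
    fun x => (norm_algebraMap' F x).le).toAlgebra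

theorem algebraMap_residue {x : k} (hx : ‖x‖ ≤ 1) :
    algebraMap (Residue k) (Residue F) (residue x) = residue (algebraMap k F x) :=
  Red.map_red (N := ofField k) (N' := ofField F) (algebraMap k F) _ hx

end Algebras

end AnalyticField
end

/-! ### Spherical completeness and orthonormal families. -/

noncomputable section

namespace AnalyticField

open Polynomial

/-- Every nested sequence of closed balls has a common point. -/
def SeqSphericallyComplete (k : Type*) [NormedField k] : Prop :=
  ∀ (c : ℕ → k) (r : ℕ → ℝ), (∀ i j, i ≤ j → ‖c i - c j‖ ≤ r i) → ∃ a, ∀ i, ‖a - c i‖ ≤ r i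

section Orthonormal

variable {k : Type*} [NormedField k] {M : Type*} [CommRing M] [Algebra k M]

/-- A family of elements of norm at most one satisfying `N (∑ c_i w_i) = max ‖c_i‖`. -/
def IsOrthonormal (k : Type*) [NormedField k] {M : Type*} [CommRing M] [Algebra k M]
    (N : UltraNorm M) {ι : Type*} [Fintype ι] (w : ι → M) : Prop :=
  (∀ i, N (w i) ≤ 1) ∧ ∀ (c : ι → k) (i : ι), ‖c i‖ ≤ N (∑ j, c j • w j)

/-- The norm is compatible with scalars and definite. -/
structure UltraNorm.IsNormOver (k : Type*) [NormedField k] {M : Type*} [CommRing M] [Algebra k M]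
    (N : UltraNorm M) : Prop where
  smul : ∀ (c : k) (x : M), N (c • x) = ‖c‖ * N x
  eq_zero : ∀ x, N x = 0 → x = 0

variable {N : UltraNorm M}

theorem UltraNorm.sub_comm (x y : M) : N (x - y) = N (y - x) := by
  rw [← neg_sub, N.neg']

theorem UltraNorm.sub_le (x y z : M) : N (x - z) ≤ max (N (x - y)) (N (y - z)) := by
  simpa using N.add' (x - y) (y - z)

/-- Orthonormality turns almost optimal approximations into nested balls in each coordinate, with
radii `d + 1 / (i + 1)`. A common point of these balls attains the infimum `d`. -/
theorem exists_forall_sub_le (hk : SeqSphericallyComplete k) (hN : N.IsNormOver k) {n : ℕ}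
    {w : Fin n → M} (hw : IsOrthonormal k N w) (v : M) :
    ∃ c : Fin n → k, ∀ c' : Fin n → k,
      N (v - ∑ i, c i • w i) ≤ N (v - ∑ i, c' i • w i) := by
  set d := ⨅ c : Fin n → k, N (v - ∑ i, c i • w i) with hd
  have hbdd : BddBelow (Set.range fun c : Fin n → k => N (v - ∑ i, c i • w i)) :=
    ⟨0, by rintro _ ⟨c, rfl⟩; exact N.nonneg' _⟩
  have hdle : ∀ c : Fin n → k, d ≤ N (v - ∑ i, c i • w i) := fun c => ciInf_le hbdd c
  have hex : ∀ m : ℕ, ∃ c : Fin n → k, N (v - ∑ i, c i • w i) < d + 1 / (m + 1) := fun m =>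
    exists_lt_of_ciInf_lt (lt_add_of_pos_right d (by positivity))
  choose c hc using hex
  have hcc : ∀ i j, i ≤ j → ∀ l, ‖c i l - c j l‖ ≤ d + 1 / ((i : ℝ) + 1) := by
    intro i j hij l
    have h1 := hw.2 (c i - c j) l
    refine h1.trans ?_
    have h2 : ∑ l, (c i - c j) l • w l = (∑ l, c i l • w l) - ∑ l, c j l • w l := by
      simp [sub_smul]
    rw [h2]
    refine (UltraNorm.sub_le _ v _).trans (max_le ?_ ?_)
    · rw [UltraNorm.sub_comm]; exact (hc i).le
    · refine (hc j).le.trans ?_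
      gcongr
  choose a ha using fun l => hk (fun i => c i l) (fun i => d + 1 / ((i : ℝ) + 1))
    fun i j hij => hcc i j hij l
  refine ⟨a, fun c' => le_trans ?_ (hdle c')⟩
  refine le_of_forall_pos_lt_add fun ε hε => ?_
  obtain ⟨m, hm⟩ := exists_nat_one_div_lt hε
  have hd0 : 0 ≤ d := Real.iInf_nonneg fun _ => N.nonneg' _
  have h3 : N (v - ∑ i, a i • w i) ≤ d + 1 / ((m : ℝ) + 1) := by
    refine (UltraNorm.sub_le _ (∑ i, c m i • w i) _).trans (max_le (hc m).le ?_)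
    rw [← Finset.sum_sub_distrib]
    refine N.sum_le _ _ (by positivity) fun l _ => ?_
    rw [← sub_smul, hN.smul, ← norm_neg, neg_sub]
    have := ha l m
    exact (mul_le_of_le_one_right (norm_nonneg _) (hw.1 l)).trans this
  linarith

/-- Gram-Schmidt: subtract from the last vector a best approximation by the previous ones and divide
by a scalar of the same norm, which exists by `hval`. -/
theorem exists_isOrthonormal (hk : SeqSphericallyComplete k)
    (hval : ∀ r : ℝ, 0 < r → ∃ c : k, ‖c‖ = r) (hN : N.IsNormOver k) {n : ℕ} (v : Fin n → M)
    (hv : LinearIndependent k v) :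
    ∃ w : Fin n → M, IsOrthonormal k N w ∧ ∀ i, w i ∈ Submodule.span k (Set.range v) := by
  induction n with
  | zero => exact ⟨v, ⟨fun i => i.elim0, fun _ i => i.elim0⟩, fun i => i.elim0⟩
  | succ n ih =>
    obtain ⟨hv1, hv2⟩ := linearIndependent_finSucc'.mp hv
    obtain ⟨w, hw, hspan⟩ := ih _ hv1
    obtain ⟨c, hc⟩ := exists_forall_sub_le hk hN hw (v (Fin.last n))
    have hsub : Submodule.span k (Set.range (Fin.init v)) ≤ Submodule.span k (Set.range v) :=
      Submodule.span_mono (by rintro _ ⟨i, rfl⟩; exact ⟨i.castSucc, rfl⟩)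
    set u := v (Fin.last n) - ∑ i, c i • w i with hu
    have hmem : ∑ i, c i • w i ∈ Submodule.span k (Set.range (Fin.init v)) :=
      sum_mem fun i _ => Submodule.smul_mem _ _ (hspan i)
    have hu0 : 0 < N u := by
      refine lt_of_le_of_ne (N.nonneg' _) fun h => hv2 ?_
      rw [sub_eq_zero.mp (hN.eq_zero u h.symm)]
      exact hmem
    obtain ⟨b, hb⟩ := hval _ hu0
    have hb0 : b ≠ 0 := by
      rintro rfl
      rw [norm_zero] at hb
      exact hu0.ne hb
    have hu1 : N (b⁻¹ • u) = 1 := by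
      rw [hN.smul, norm_inv, hb, inv_mul_cancel₀ hu0.ne']
    refine ⟨Fin.snoc w (b⁻¹ • u), ⟨fun i => ?_, fun a => ?_⟩, fun i => ?_⟩
    · refine Fin.lastCases ?_ (fun i => ?_) i
      · rw [Fin.snoc_last, hu1]
      · rw [Fin.snoc_castSucc]; exact hw.1 i
    · rw [Fin.sum_univ_castSucc]
      simp only [Fin.snoc_castSucc, Fin.snoc_last]
      set a' := a (Fin.last n) with ha'
      set s := ∑ i : Fin n, a i.castSucc • w i with hs
      -- After factoring out `a' / b`, the vector is the difference of the last `v` and some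
      -- combination of the `w i`, hence no shorter than the optimal difference `u`. The bounds for
      -- the other coefficients follow by subtracting the last term.
      have h1 : ‖a'‖ ≤ N (s + a' • b⁻¹ • u) := by
        by_cases ha0 : a' = 0
        · rw [ha0, norm_zero]; exact N.nonneg' _
        have h2 : s + a' • b⁻¹ • u =
            (a' * b⁻¹) • (v (Fin.last n) -
              ∑ i, (c i - (a' * b⁻¹)⁻¹ * a i.castSucc) • w i) := by
          have h3 : (a' * b⁻¹) • ∑ i, ((a' * b⁻¹)⁻¹ * a i.castSucc) • w i = s := by
            rw [Finset.smul_sum]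
            refine Finset.sum_congr rfl fun i _ => ?_
            rw [smul_smul, mul_inv_cancel_left₀ (mul_ne_zero ha0 (inv_ne_zero hb0))]
          simp only [sub_smul, Finset.sum_sub_distrib]
          rw [← sub_add, ← hu, smul_add, h3, smul_smul, add_comm]
        rw [h2, hN.smul, norm_mul, norm_inv, hb, mul_assoc]
        have h4 := hc fun i => c i - (a' * b⁻¹)⁻¹ * a i.castSucc
        refine le_mul_of_one_le_right (norm_nonneg _) ?_
        rw [inv_mul_eq_div, one_le_div hu0]
        exact h4
      intro i
      refine Fin.lastCases h1 (fun i => ?_) i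
      refine (hw.2 (fun i => a i.castSucc) i).trans ?_
      have h5 : s = (s + a' • b⁻¹ • u) + -(a' • b⁻¹ • u) := by abel
      have h6 := N.add' (s + a' • b⁻¹ • u) (-(a' • b⁻¹ • u))
      rw [← h5] at h6
      refine h6.trans (max_le le_rfl ?_)
      rw [N.neg', hN.smul, hu1, mul_one]
      exact h1
    · refine Fin.lastCases ?_ (fun i => ?_) i
      · rw [Fin.snoc_last]
        exact Submodule.smul_mem _ _ (sub_mem (Submodule.subset_span ⟨_, rfl⟩) (hsub hmem))
      · rw [Fin.snoc_castSucc]; exact hsub (hspan i)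

end Orthonormal

end AnalyticField
end

/-! ### The Gauss norm on a rational function field and its reduction. -/

noncomputable section

namespace AnalyticField

open Polynomial UltraNorm

section ResidueLemmas

variable {L : Type*} [NormedField L] [IsUltrametricDist L]

theorem residue_one : residue (1 : L) = 1 := red_one

theorem residue_mul {x y : L} (hx : ‖x‖ ≤ 1) (hy : ‖y‖ ≤ 1) :
    residue (x * y) = residue x * residue y := red_mul (N := ofField L) hx hy

theorem residue_sum {ι : Type*} (s : Finset ι) (f : ι → L) (h : ∀ i ∈ s, ‖f i‖ ≤ 1) :
    residue (∑ i ∈ s, f i) = ∑ i ∈ s, residue (f i) := red_sum (N := ofField L) s f h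

end ResidueLemmas

section Reflect

variable {k F : Type*} [Field k] [Field F] [Algebra k F] {t : F}

theorem aeval_inv_mul_pow (ht : t ≠ 0) {p : k[X]} {n : ℕ} (hn : p.natDegree ≤ n) :
    aeval t⁻¹ p * t ^ n = aeval t (reflect n p) := by
  let _ : Invertible t⁻¹ := invertibleOfNonzero (inv_ne_zero ht)
  have h := eval₂_reflect_mul_pow (algebraMap k F) t⁻¹ n p hn
  have h1 : ⅟(t⁻¹) = t := by rw [invOf_eq_inv, inv_inv]
  rw [h1] at h
  rw [aeval_def, aeval_def, ← h, mul_assoc, ← mul_pow, inv_mul_cancel₀ ht, one_pow, mul_one]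

theorem aeval_eq_aeval_inv (ht : t ≠ 0) {p : k[X]} {n : ℕ} (hn : p.natDegree ≤ n) :
    t⁻¹ ^ n * aeval t p = aeval t⁻¹ (reflect n p) := by
  have := aeval_inv_mul_pow (inv_ne_zero ht) hn
  rw [inv_inv] at this
  rw [← this, mul_comm]

end Reflect

section GaussGenerator

variable {k F : Type*} [NormedField k] [IsUltrametricDist k] [NormedField F]
  [IsUltrametricDist F] [NormedAlgebra k F]

/-- `F = k(t)` with the Gauss norm. -/
structure IsGaussGenerator (k : Type*) {F : Type*} [NormedField k] [NormedField F]
    [NormedAlgebra k F] (t : F) : Prop where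
  norm_eq_one : ‖t‖ = 1
  coeff_le : ∀ (p : k[X]) (i : ℕ), ‖p.coeff i‖ ≤ ‖aeval t p‖
  exists_mul_eq : ∀ a : F, ∃ p q : k[X], aeval t q ≠ 0 ∧ aeval t q * a = aeval t p

variable {t : F}

omit [IsUltrametricDist k] [IsUltrametricDist F] in
theorem IsGaussGenerator.ne_zero (ht : IsGaussGenerator k t) : t ≠ 0 := by
  rintro rfl
  simpa using ht.norm_eq_one

omit [IsUltrametricDist k] [IsUltrametricDist F] in
-- Reversing a polynomial permutes its coefficients. This provides the chart at infinity.
theorem IsGaussGenerator.inv (ht : IsGaussGenerator k t) : IsGaussGenerator k t⁻¹ where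
  norm_eq_one := by rw [norm_inv, ht.norm_eq_one, inv_one]
  coeff_le p i := by
    have h := aeval_inv_mul_pow ht.ne_zero (le_refl p.natDegree)
    have h1 := congrArg norm h
    rw [norm_mul, norm_pow, ht.norm_eq_one, one_pow, mul_one] at h1
    rw [h1]
    have := ht.coeff_le (reflect p.natDegree p) (revAt p.natDegree i)
    rwa [coeff_reflect, revAt_invol] at this
  exists_mul_eq a := by
    obtain ⟨p, q, hq, h⟩ := ht.exists_mul_eq a
    set n := max p.natDegree q.natDegree with hn
    have h1 := aeval_eq_aeval_inv ht.ne_zero (le_max_left p.natDegree q.natDegree)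
    have h2 := aeval_eq_aeval_inv ht.ne_zero (le_max_right p.natDegree q.natDegree)
    refine ⟨reflect n p, reflect n q, ?_, ?_⟩
    · rw [← h2]
      exact mul_ne_zero (pow_ne_zero _ (inv_ne_zero ht.ne_zero)) hq
    · rw [← h1, ← h2, mul_assoc, h]

theorem IsGaussGenerator.residue_notMem_range (ht : IsGaussGenerator k t) :
    residue t ∉ Set.range (algebraMap (Residue k) (Residue F)) := by
  rintro ⟨c, hc⟩
  obtain ⟨c, hc1, rfl⟩ := exists_red_eq c
  rw [algebraMap_residue hc1, eq_comm] at hc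
  have hc2 : ofField F (algebraMap k F c) ≤ 1 := by rwa [ofField_apply, norm_algebraMap']
  rw [red_eq_iff ht.norm_eq_one.le hc2] at hc
  have := ht.coeff_le (X - Polynomial.C c) 1
  simp only [coeff_sub, coeff_X_one, coeff_C_succ, sub_zero, norm_one, map_sub, aeval_X,
    aeval_C] at this
  exact not_lt.mpr this hc

omit [IsUltrametricDist k] in
theorem norm_aeval_le {s : F} (hs : ‖s‖ ≤ 1) {C : ℝ} (hC : 0 ≤ C) {p : k[X]}
    (hp : ∀ i, ‖p.coeff i‖ ≤ C) : ‖aeval s p‖ ≤ C := by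
  rw [aeval_eq_sum_range]
  refine (ofField F).sum_le _ _ hC fun i _ => ?_
  rw [ofField_apply, norm_smul, norm_pow]
  exact (mul_le_of_le_one_right (norm_nonneg _) (pow_le_one₀ (norm_nonneg _) hs)).trans (hp i)

/-- Coefficientwise reduction of a polynomial. -/
def redPoly (p : k[X]) : (Residue k)[X] :=
  ∑ i ∈ Finset.range (p.natDegree + 1), C (residue (p.coeff i)) * X ^ i

theorem aeval_redPoly {s : F} (hs : ‖s‖ ≤ 1) {p : k[X]} (hp : ∀ i, ‖p.coeff i‖ ≤ 1) :
    aeval (residue s) (redPoly p) = residue (aeval s p) := by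
  have h1 : ∀ i, ofField F (algebraMap k F (p.coeff i)) ≤ 1 := fun i => by
    rw [ofField_apply, norm_algebraMap']; exact hp i
  rw [redPoly, map_sum, aeval_eq_sum_range, residue_sum]
  · refine Finset.sum_congr rfl fun i _ => ?_
    rw [map_mul, aeval_C, map_pow, aeval_X, algebraMap_residue (hp i), Algebra.smul_def,
      residue_mul (h1 i) ((ofField F).pow_le_one hs i)]
    exact congrArg _ (red_pow (N := ofField F) hs i).symm
  · intro i _
    rw [Algebra.smul_def]
    exact (ofField F).mul_le_one (h1 i) ((ofField F).pow_le_one hs i)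

omit [IsUltrametricDist k] in
theorem exists_coeff_max (p : k[X]) (hp : p ≠ 0) :
    ∃ i, p.coeff i ≠ 0 ∧ ∀ j, ‖p.coeff j‖ ≤ ‖p.coeff i‖ := by
  obtain ⟨i, hi, hmax⟩ := p.support.exists_max_image (fun i => ‖p.coeff i‖)
    (support_nonempty.mpr hp)
  refine ⟨i, mem_support_iff.mp hi, fun j => ?_⟩
  by_cases hj : j ∈ p.support
  · exact hmax j hj
  · rw [notMem_support_iff.mp hj, norm_zero]; exact norm_nonneg _

omit [IsUltrametricDist k] in
theorem IsGaussGenerator.exists_mul_eq_normalized (ht : IsGaussGenerator k t) (a : F) :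
    ∃ p q : k[X], ‖aeval t q‖ = 1 ∧ aeval t q * a = aeval t p := by
  obtain ⟨p, q, hq, h⟩ := ht.exists_mul_eq a
  obtain ⟨i, hi0, hi⟩ := exists_coeff_max q (by rintro rfl; simp at hq)
  have hnorm : ‖aeval t q‖ = ‖q.coeff i‖ :=
    le_antisymm (norm_aeval_le ht.norm_eq_one.le (norm_nonneg _) hi) (ht.coeff_le q i)
  refine ⟨C (q.coeff i)⁻¹ * p, C (q.coeff i)⁻¹ * q, ?_, ?_⟩
  · rw [map_mul, aeval_C, norm_mul, norm_algebraMap', hnorm, norm_inv,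
      inv_mul_cancel₀ (norm_ne_zero_iff.mpr hi0)]
  · rw [map_mul, map_mul, mul_assoc, h]

theorem IsGaussGenerator.residue_exists_mul_eq (ht : IsGaussGenerator k t) (e : Residue F) :
    ∃ p q : (Residue k)[X], aeval (residue t) q ≠ 0 ∧
      aeval (residue t) q * e = aeval (residue t) p := by
  obtain ⟨a, ha, rfl⟩ : ∃ a : F, ‖a‖ ≤ 1 ∧ residue a = e := exists_red_eq e
  obtain ⟨p, q, hq, h⟩ := ht.exists_mul_eq_normalized a
  have hq1 : ∀ i, ‖q.coeff i‖ ≤ 1 := fun i => hq ▸ ht.coeff_le q i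
  have hp1 : ∀ i, ‖p.coeff i‖ ≤ 1 := fun i => by
    refine (ht.coeff_le p i).trans ?_
    rw [← h, norm_mul, hq, one_mul]
    exact ha
  refine ⟨redPoly p, redPoly q, ?_, ?_⟩
  · rw [aeval_redPoly ht.norm_eq_one.le hq1, Ne, residue_eq_zero_iff hq.le, hq]
    exact lt_irrefl _
  · rw [aeval_redPoly ht.norm_eq_one.le hq1, aeval_redPoly ht.norm_eq_one.le hp1, ← h,
      residue_mul hq.le ha]

end GaussGenerator

section Lift

variable {F M : Type*} [NormedField F] [IsUltrametricDist F] [CommRing M] [Algebra F M]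

/-- The structure map of the reduction of an `F`-algebra. -/
structure UltraNorm.RedCompat (F : Type*) {M : Type*} [NormedField F] [IsUltrametricDist F]
    [CommRing M] [Algebra F M] (N : UltraNorm M) [Algebra (Residue F) N.Red] : Prop where
  norm_algebraMap_le : ∀ a : F, N (algebraMap F M a) ≤ ‖a‖
  algebraMap_residue : ∀ a : F, ‖a‖ ≤ 1 →
    algebraMap (Residue F) N.Red (residue a) = N.red (algebraMap F M a)

variable {N : UltraNorm M} [Algebra (Residue F) N.Red]

theorem UltraNorm.RedCompat.smul_le (hN : N.RedCompat F) (a : F) (x : M) :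
    N (a • x) ≤ ‖a‖ * N x := by
  rw [Algebra.smul_def]
  exact (N.mul' _ _).trans (mul_le_mul_of_nonneg_right (hN.norm_algebraMap_le a) (N.nonneg' _))

theorem UltraNorm.RedCompat.residue_smul (hN : N.RedCompat F) {a : F} (ha : ‖a‖ ≤ 1) {x : M}
    (hx : N x ≤ 1) : residue a • N.red x = N.red (a • x) := by
  rw [Algebra.smul_def, Algebra.smul_def, hN.algebraMap_residue a ha,
    red_mul ((hN.norm_algebraMap_le a).trans ha) hx]

/-- Lifts of elements independent over the residue field are orthonormal. -/
theorem isOrthonormal_of_linearIndependent_red (hN : N.RedCompat F) {ι : Type*} [Fintype ι]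
    {w : ι → M} (hw : ∀ i, N (w i) ≤ 1)
    (hind : LinearIndependent (Residue F) fun i => N.red (w i)) : IsOrthonormal F N w := by
  refine ⟨hw, fun c i => ?_⟩
  obtain ⟨j, -, hj⟩ := Finset.univ.exists_max_image (fun i => ‖c i‖) ⟨i, Finset.mem_univ i⟩
  refine (hj i (Finset.mem_univ i)).trans ?_
  by_contra! hlt
  have hcj : c j ≠ 0 := by
    intro h
    rw [h, norm_zero] at hlt
    exact not_lt.mpr (N.nonneg' _) hlt
  have hb : ∀ i, ‖(c j)⁻¹ * c i‖ ≤ 1 := fun i => by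
    rw [norm_mul, norm_inv, inv_mul_eq_div, div_le_one (norm_pos_iff.mpr hcj)]
    exact hj i (Finset.mem_univ i)
  have hterm : ∀ i ∈ Finset.univ, N (((c j)⁻¹ * c i) • w i) ≤ 1 := fun i _ =>
    (hN.smul_le _ _).trans (mul_le_one₀ (hb i) (N.nonneg' _) (hw i))
  have hsum : N (∑ i, ((c j)⁻¹ * c i) • w i) < 1 := by
    have h1 : ∑ i, ((c j)⁻¹ * c i) • w i = (c j)⁻¹ • ∑ i, c i • w i := by
      rw [Finset.smul_sum]
      exact Finset.sum_congr rfl fun i _ => mul_smul _ _ _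
    rw [h1]
    refine (hN.smul_le _ _).trans_lt ?_
    rwa [norm_inv, inv_mul_eq_div, div_lt_one (norm_pos_iff.mpr hcj)]
  have h0 : ∑ i, residue ((c j)⁻¹ * c i) • N.red (w i) = 0 := by
    rw [← (red_eq_zero_iff hsum.le).mpr hsum, red_sum _ _ hterm]
    exact Finset.sum_congr rfl fun i _ => hN.residue_smul (hb i) (hw i)
  have := Fintype.linearIndependent_iff.mp hind _ h0 j
  rw [inv_mul_cancel₀ hcj, residue_one] at this
  exact one_ne_zero this

omit [IsUltrametricDist F] [Algebra (Residue F) N.Red] in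
theorem IsOrthonormal.linearIndependent {ι : Type*} [Fintype ι] {w : ι → M}
    (hw : IsOrthonormal F N w) : LinearIndependent F w := by
  rw [Fintype.linearIndependent_iff]
  intro c hc i
  have := hw.2 c i
  rw [hc, N.zero'] at this
  exact norm_le_zero_iff.mp this

/-- The reductions of an orthonormal family are independent. -/
theorem IsOrthonormal.linearIndependent_red (hN : N.RedCompat F) {ι : Type*} [Fintype ι] {w : ι → M}
    (hw : IsOrthonormal F N w) : LinearIndependent (Residue F) fun i => N.red (w i) := by
  rw [Fintype.linearIndependent_iff]
  intro c hc i
  choose b hb1 hb using fun i => exists_red_eq (c i)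
  have hterm : ∀ i ∈ Finset.univ, N (b i • w i) ≤ 1 := fun i _ =>
    (hN.smul_le _ _).trans (mul_le_one₀ (hb1 i) (N.nonneg' _) (hw.1 i))
  have h0 : N.red (∑ i, b i • w i) = 0 := by
    rw [red_sum _ _ hterm, ← hc]
    refine Finset.sum_congr rfl fun i _ => ?_
    rw [← hb i]
    exact (hN.residue_smul (hb1 i) (hw.1 i)).symm
  rw [red_eq_zero_iff (N.sum_le _ _ zero_le_one hterm)] at h0
  rw [← hb i, residue_eq_zero_iff (hb1 i)]
  exact (hw.2 b i).trans_lt h0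

theorem exists_lift_family (N : UltraNorm M) {ι : Type*} (a : ι → N.Red) :
    ∃ w : ι → M, (∀ i, N (w i) ≤ 1) ∧ ∀ i, N.red (w i) = a i := by
  choose w h1 h2 using fun i => exists_red_eq (a i)
  exact ⟨w, h1, h2⟩

/-- Lifts of independent residues are orthonormal, hence independent, so the residue degree is at
most the degree. -/
theorem finite_red [FiniteDimensional F M] (hN : N.RedCompat F) :
    FiniteDimensional (Residue F) N.Red := by
  have : Module.rank (Residue F) N.Red ≤ (Module.finrank F M : ℕ) := by
    refine rank_le fun s hs => ?_
    obtain ⟨w, hw1, hw⟩ := exists_lift_family N fun i : s => (i : N.Red)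
    have h := (isOrthonormal_of_linearIndependent_red hN hw1 (by simpa only [hw] using hs))
    simpa using h.linearIndependent.fintype_card_le_finrank
  exact Module.rank_lt_aleph0_iff.mp (this.trans_lt (Cardinal.natCast_lt_aleph0))

end Lift

end AnalyticField
end

/-! ### The stability theorem. -/

noncomputable section

namespace AnalyticField

open Polynomial UltraNorm

section Polar

variable {κ A : Type*} [Field κ] [CommRing A] [Algebra κ A]

theorem mem_polyIntegral_iff {s g : A} : g ∈ polyIntegral κ s ↔
    ∃ (n : ℕ) (a : ℕ → κ[X]), g ^ n + ∑ j ∈ Finset.range n, aeval s (a j) * g ^ j = 0 := by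
  constructor
  · rintro ⟨p, hp, hpg⟩
    refine ⟨p.natDegree, p.coeff, ?_⟩
    rw [eval₂_eq_sum_range, Finset.sum_range_succ, hp.coeff_natDegree, map_one, one_mul,
      add_comm] at hpg
    exact hpg
  · rintro ⟨n, a, h⟩
    refine ⟨X ^ n + ∑ j ∈ Finset.range n, C (a j) * X ^ j, monic_X_pow_add ?_, ?_⟩
    · refine (degree_sum_le _ _).trans_lt ((Finset.sup_lt_iff (WithBot.bot_lt_coe _)).mpr ?_)
      intro i hi
      exact (degree_C_mul_X_pow_le _ _).trans_lt (by exact_mod_cast Finset.mem_range.mp hi)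
    · rw [← h, eval₂_add, eval₂_finsetSum]
      simp

/-- The pole at infinity has finite order: for `c` the largest degree of a coefficient, multiplying
the integral equation by `s⁻¹ ^ (c * n)` turns all its coefficients into polynomials in `s⁻¹`. -/
theorem exists_inv_pow_mul_mem_polyIntegral {M : Type*} [Field M] [Algebra κ M] {s v : M}
    (hs : s ≠ 0) (hv : v ∈ polyIntegral κ s) :
    ∃ c : ℕ, ∀ m, c ≤ m → s⁻¹ ^ m * v ∈ polyIntegral κ s⁻¹ := by
  have hs' : s⁻¹ ∈ polyIntegral κ s⁻¹ := by simpa using aeval_mem_polyIntegral (κ := κ) s⁻¹ X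
  obtain ⟨n, a, h⟩ := mem_polyIntegral_iff.mp hv
  set c := (Finset.range n).sup fun j => (a j).natDegree with hc
  suffices s⁻¹ ^ c * v ∈ polyIntegral κ s⁻¹ by
    refine ⟨c, fun m hm => ?_⟩
    obtain ⟨d, rfl⟩ := Nat.exists_eq_add_of_le hm
    rw [add_comm, pow_add, mul_assoc]
    exact mul_mem (pow_mem hs' d) this
  refine mem_polyIntegral_iff.mpr ⟨n, fun j => reflect (c * (n - j)) (a j), ?_⟩
  rw [← mul_zero (s⁻¹ ^ (c * n)), ← h, mul_add, Finset.mul_sum, mul_pow, ← pow_mul]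
  refine congrArg _ (Finset.sum_congr rfl fun j hj => ?_)
  have hjn := Finset.mem_range.mp hj
  have hdeg : (a j).natDegree ≤ c * (n - j) :=
    (Finset.le_sup (f := fun j => (a j).natDegree) hj).trans
      (Nat.le_mul_of_pos_right _ (by omega))
  have hcn : c * n = c * (n - j) + c * j := by
    rw [← Nat.mul_add, Nat.sub_add_cancel hjn.le]
  rw [← aeval_eq_aeval_inv hs hdeg, hcn, pow_add, mul_pow, ← pow_mul]
  ring

end Polar

section Spectral

variable (F M : Type*) [NormedField F] [IsUltrametricDist F] [Field M] [Algebra F M]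
  [Algebra.IsAlgebraic F M]

/-- The spectral norm of an algebraic extension. -/
def spectralUltra : UltraNorm M where
  toFun := spectralNorm F M
  nonneg' := spectralNorm_nonneg
  zero' := spectralNorm_zero
  one' := spectralNorm_one.le
  neg' x := spectralNorm_neg (Algebra.IsAlgebraic.isAlgebraic x)
  add' := isNonarchimedean_spectralNorm
  mul' x y := spectralNorm_mul (Algebra.IsAlgebraic.isAlgebraic x)
    (Algebra.IsAlgebraic.isAlgebraic y)

variable {F M}

theorem spectralUltra_apply (x : M) : spectralUltra F M x = spectralNorm F M x := rfl

theorem isNormOver_spectralUltra (k : Type*) [NormedField k] [NormedAlgebra k F] [Algebra k M]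
    [IsScalarTower k F M] : (spectralUltra F M).IsNormOver k where
  smul c x := by
    rw [← algebraMap_smul F c x, spectralUltra_apply,
      spectralNorm_smul _ (Algebra.IsAlgebraic.isAlgebraic x), coe_nnnorm, norm_algebraMap']
    rfl
  eq_zero x hx := eq_zero_of_map_spectralNorm_eq_zero hx (Algebra.IsAlgebraic.isAlgebraic x)

instance : Algebra (Residue F) (spectralUltra F M).Red :=
  (Red.map (N := ofField F) (N' := spectralUltra F M) (algebraMap F M)
    fun x => (spectralNorm_extends (L := M) x).le).toAlgebra

theorem redCompat_spectralUltra : (spectralUltra F M).RedCompat F where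
  norm_algebraMap_le a := (spectralNorm_extends a).le
  algebraMap_residue _ ha := Red.map_red (N := ofField F) (N' := spectralUltra F M)
    (algebraMap F M) _ ha

/-- The spectral norm is power-multiplicative but not necessarily multiplicative, as `F` is not
assumed complete. So the reduction is a reduced ring and need not be a field, which is why the
estimates on poles were made for reduced algebras. -/
instance : IsReduced (spectralUltra F M).Red :=
  isReduced_red fun x _ hn => isPowMul_spectralNorm x hn

end Spectral

section Stability

variable {k F M : Type*} [NormedField k] [IsUltrametricDist k] [NormedField F]
  [IsUltrametricDist F] [NormedAlgebra k F] [Field M] [Algebra F M] [Algebra k M]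
  [IsScalarTower k F M]

omit [IsUltrametricDist k] [IsUltrametricDist F] in
theorem IsGaussGenerator.isFractionRing {s : F} (hs : IsGaussGenerator k s) :
    @IsFractionRing k[X] _ F _ (aeval s : k[X] →ₐ[k] F).toAlgebra := by
  let _ : Algebra k[X] F := (aeval s : k[X] →ₐ[k] F).toAlgebra
  have : FaithfulSMul k[X] F := by
    rw [faithfulSMul_iff_algebraMap_injective, injective_iff_map_eq_zero]
    intro p hp
    refine Polynomial.ext fun i => ?_
    have h1 : aeval s p = 0 := hp
    have := hs.coeff_le p i
    rw [h1, norm_zero, norm_le_zero_iff] at this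
    simpa using this
  refine IsFractionRing.of_field k[X] F fun a => ?_
  obtain ⟨p, q, hq, h⟩ := hs.exists_mul_eq a
  exact ⟨p, q, (eq_div_iff hq).mpr (by rw [mul_comm]; exact h)⟩

/-- Since `k[X]` is integrally closed, the minimal polynomial of `v` over `F` has coefficients in
`k[s]`. Spectral norm at most one bounds these coefficients by one, and the Gauss norm bounds their
own coefficients; so the whole equation can be reduced. -/
theorem red_mem_polyIntegral [Algebra.IsAlgebraic F M]
    [Algebra (Residue k) (spectralUltra F M).Red]
    [IsScalarTower (Residue k) (Residue F) (spectralUltra F M).Red] {s : F}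
    (hs : IsGaussGenerator k s) {v : M} (hv : v ∈ polyIntegral k (algebraMap F M s))
    (hNv : spectralUltra F M v ≤ 1) :
    (spectralUltra F M).red v ∈ polyIntegral (Residue k)
      (algebraMap (Residue F) (spectralUltra F M).Red (residue s)) := by
  let _ : Algebra k[X] F := (aeval s : k[X] →ₐ[k] F).toAlgebra
  let _ : Algebra k[X] M := ((algebraMap F M).comp (algebraMap k[X] F)).toAlgebra
  have : IsScalarTower k[X] F M := IsScalarTower.of_algebraMap_eq fun _ => rfl
  have : IsFractionRing k[X] F := hs.isFractionRing
  have halg : ∀ p : k[X], algebraMap k[X] M p = aeval (algebraMap F M s) p := fun p => by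
    rw [aeval_algebraMap_apply]; rfl
  have hint : IsIntegral k[X] v := by
    obtain ⟨p, hp, hpv⟩ := hv
    refine ⟨p, hp, ?_⟩
    rw [← hpv]
    exact congrArg (fun f => eval₂ f v p) (RingHom.ext halg)
  set P := minpoly k[X] v with hP
  have hmin : minpoly F v = P.map (algebraMap k[X] F) :=
    minpoly.isIntegrallyClosed_eq_field_fractions' F hint
  have hcoeff : ∀ j, ‖aeval s (P.coeff j)‖ ≤ 1 := fun j => by
    have h1 := (spectralValue_le_one_iff (minpoly.monic
      (Algebra.IsAlgebraic.isAlgebraic (R := F) v).isIntegral)).mp hNv j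
    rw [hmin, coeff_map] at h1
    exact h1
  have hcoeff' : ∀ j i, ‖(P.coeff j).coeff i‖ ≤ 1 := fun j i =>
    (hs.coeff_le _ _).trans (hcoeff j)
  have hc : (spectralUltra F M).RedCompat F := redCompat_spectralUltra
  refine mem_polyIntegral_iff.mpr ⟨P.natDegree, fun j => redPoly (P.coeff j), ?_⟩
  have hzero : v ^ P.natDegree +
      ∑ j ∈ Finset.range P.natDegree, algebraMap F M (aeval s (P.coeff j)) * v ^ j = 0 := by
    have h1 := minpoly.aeval k[X] v
    rw [aeval_eq_sum_range, ← hP, Finset.sum_range_succ, (minpoly.monic hint).coeff_natDegree,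
      one_smul, add_comm] at h1
    rw [← h1]
    refine congrArg _ (Finset.sum_congr rfl fun j _ => ?_)
    rw [Algebra.smul_def]
    rfl
  have hle : ∀ j, (spectralUltra F M) (algebraMap F M (aeval s (P.coeff j))) ≤ 1 := fun j =>
    (hc.norm_algebraMap_le _).trans (hcoeff j)
  have hterm : ∀ j ∈ Finset.range P.natDegree,
      (spectralUltra F M) (algebraMap F M (aeval s (P.coeff j)) * v ^ j) ≤ 1 := fun j _ =>
    (spectralUltra F M).mul_le_one (hle j) ((spectralUltra F M).pow_le_one hNv j)
  have h0 := congrArg (spectralUltra F M).red hzero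
  rw [red_zero, red_add ((spectralUltra F M).pow_le_one hNv _) ((spectralUltra F M).sum_le _ _ zero_le_one hterm),
    red_sum _ _ hterm, red_pow hNv] at h0
  rw [← h0]
  refine congrArg _ (Finset.sum_congr rfl fun j _ => ?_)
  rw [red_mul (hle j) ((spectralUltra F M).pow_le_one hNv j), red_pow hNv, ← hc.algebraMap_residue _ (hcoeff j),
    ← aeval_redPoly hs.norm_eq_one.le (hcoeff' j), aeval_algebraMap_apply]

theorem residue_inv {t : F} (ht : ‖t‖ = 1) : (residue t)⁻¹ = residue t⁻¹ := by
  have h1 : ‖t⁻¹‖ = 1 := by rw [norm_inv, ht, inv_one]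
  refine inv_eq_of_mul_eq_one_right ?_
  rw [← residue_mul ht.le h1.le, mul_inv_cancel₀ (by rintro rfl; simp at ht), residue_one]

omit [IsUltrametricDist k] [IsUltrametricDist F] in
theorem exists_basis_polyIntegral [FiniteDimensional F M] {t : F} (ht : IsGaussGenerator k t) :
    ∃ f : Fin (Module.finrank F M) → M, LinearIndependent F f ∧
      ∀ i, f i ∈ polyIntegral k (algebraMap F M t) := by
  let _ : Algebra k[X] F := (aeval t : k[X] →ₐ[k] F).toAlgebra
  let _ : Algebra k[X] M := ((algebraMap F M).comp (algebraMap k[X] F)).toAlgebra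
  have : IsScalarTower k[X] F M := IsScalarTower.of_algebraMap_eq fun _ => rfl
  have : IsFractionRing k[X] F := ht.isFractionRing
  have halg : ∀ p : k[X], algebraMap k[X] M p = aeval (algebraMap F M t) p := fun p => by
    rw [aeval_algebraMap_apply]; rfl
  let b := Module.finBasis F M
  have hex : ∀ i, ∃ y ≠ (0 : k[X]), IsIntegral k[X] (y • b i) := fun i =>
    ((IsFractionRing.isAlgebraic_iff k[X] F M).mpr
      (Algebra.IsAlgebraic.isAlgebraic (b i))).exists_integral_multiple
  choose y hy hint using hex
  have hy' : ∀ i, algebraMap k[X] F (y i) ≠ 0 := fun i h =>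
    hy i ((IsFractionRing.injective k[X] F) (by rw [h, map_zero]))
  refine ⟨fun i => y i • b i, ?_, fun i => ?_⟩
  · have := b.linearIndependent.units_smul fun i => Units.mk0 _ (hy' i)
    have h2 : (fun i => y i • b i) = (fun i => Units.mk0 _ (hy' i)) • ⇑b := by
      funext i
      rw [Pi.smul_apply', Units.smul_def, Units.val_mk0, algebraMap_smul]
    rw [h2]
    exact this
  · obtain ⟨p, hp, hpv⟩ := hint i
    refine ⟨p, hp, ?_⟩
    rw [← hpv]
    exact congrArg (fun f => eval₂ f _ p) (RingHom.ext fun q => (halg q).symm)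

/-- The stability theorem: a finite extension of `k(t)` with the Gauss norm has no defect. -/
theorem finrank_le_finrank_red [IsAlgClosed k] [FiniteDimensional F M]
    (hk : SeqSphericallyComplete k) (hval : ∀ r : ℝ, 0 < r → ∃ c : k, ‖c‖ = r) {t : F}
    (ht : IsGaussGenerator k t) :
    Module.finrank F M ≤ Module.finrank (Residue F) (spectralUltra F M).Red := by
  let _ : Algebra (Residue k) (spectralUltra F M).Red :=
    ((algebraMap (Residue F) (spectralUltra F M).Red).comp
      (algebraMap (Residue k) (Residue F))).toAlgebra
  have : IsScalarTower (Residue k) (Residue F) (spectralUltra F M).Red :=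
    IsScalarTower.of_algebraMap_eq fun _ => rfl
  have hcF : (spectralUltra F M).RedCompat F := redCompat_spectralUltra
  have hck : (spectralUltra F M).RedCompat k :=
    { norm_algebraMap_le := fun a => by
        rw [IsScalarTower.algebraMap_apply k F M]
        exact (hcF.norm_algebraMap_le _).trans (norm_algebraMap' F a).le
      algebraMap_residue := fun a ha => by
        rw [IsScalarTower.algebraMap_apply k F M, ← hcF.algebraMap_residue _
          ((norm_algebraMap' F a).le.trans ha), ← algebraMap_residue ha]
        rfl }
  have := finite_red hcF
  set D := Module.finrank F M with hD
  set m := Module.finrank (Residue F) (spectralUltra F M).Red with hm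
  obtain ⟨f, hf, hfint⟩ := exists_basis_polyIntegral (k := k) (M := M) ht
  set s := algebraMap F M t with hs
  have hs0 : s ≠ 0 := by simpa [hs] using ht.ne_zero
  have hsinv : algebraMap F M t⁻¹ = s⁻¹ := map_inv₀ _ _
  have hsmem : s ∈ polyIntegral k s := by simpa using aeval_mem_polyIntegral (κ := k) s X
  have hsmem' : s⁻¹ ∈ polyIntegral k s⁻¹ := by simpa using aeval_mem_polyIntegral (κ := k) s⁻¹ X
  choose c hc using fun i => exists_inv_pow_mul_mem_polyIntegral hs0 (hfint i)
  set c0 := Finset.univ.sup c with hc0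
  -- The products `t ^ j * f i` with `j ≤ l` span a space of dimension `(l + 1) * D` over `k`. The
  -- reductions of an orthonormal basis of it are independent and have poles of order at most `l +
  -- c0`, where `rank_polarSubmodule_le` applies.
  have hkey : ∀ l : ℕ, (l + 1) * D ≤ m * (l + c0 + 1) := by
    intro l
    have hpow : LinearIndependent k fun j : Fin (l + 1) => t ^ (j : ℕ) := by
      rw [Fintype.linearIndependent_iff]
      intro a ha j
      have h1 : aeval t (∑ j : Fin (l + 1), C (a j) * X ^ (j : ℕ)) = 0 := by
        rw [map_sum, ← ha]
        refine Finset.sum_congr rfl fun j _ => ?_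
        rw [map_mul, aeval_C, map_pow, aeval_X, Algebra.smul_def]
      have h2 := ht.coeff_le (∑ j : Fin (l + 1), C (a j) * X ^ (j : ℕ)) j
      rw [h1, norm_zero, norm_le_zero_iff, finsetSum_coeff] at h2
      rw [← h2, Finset.sum_eq_single j]
      · simp
      · intro i _ hij
        rw [coeff_C_mul_X_pow, if_neg (fun h => hij (Fin.ext h.symm))]
      · simp
    have hv := (linearIndependent_smul hpow hf).comp _ (finProdFinEquiv (m := l + 1)
      (n := D)).symm.injective
    obtain ⟨w, hw, hspan⟩ := exists_isOrthonormal hk hval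
      (isNormOver_spectralUltra (F := F) (M := M) k) _ hv
    have hw1 : ∀ i, w i ∈ polyIntegral k s := fun i => by
      refine (Submodule.span_le.mpr ?_ :
        Submodule.span k _ ≤ (polyIntegral k s).toSubmodule) (hspan i)
      rintro _ ⟨i, rfl⟩
      simp only [Function.comp_apply, Algebra.smul_def, map_pow]
      exact (polyIntegral k s).mul_mem (pow_mem hsmem _) (hfint _)
    have hw2 : ∀ i, s⁻¹ ^ (l + c0) * w i ∈ polyIntegral k s⁻¹ := fun i => by
      refine (Submodule.span_le.mpr ?_ : Submodule.span k _ ≤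
        (polyIntegral k s⁻¹).toSubmodule.comap
          (LinearMap.mulLeft k (s⁻¹ ^ (l + c0)))) (hspan i)
      · rintro _ ⟨i, rfl⟩
        simp only [Function.comp_apply, Algebra.smul_def, map_pow]
        set j := (finProdFinEquiv.symm i).1
        set i' := (finProdFinEquiv.symm i).2
        have hjl : (j : ℕ) ≤ l := Nat.lt_succ_iff.mp j.2
        have h1 : s⁻¹ ^ (l + c0) * (s ^ (j : ℕ) * f i') =
            s⁻¹ ^ (l - j) * (s⁻¹ ^ c0 * f i') := by
          obtain ⟨e, he⟩ := Nat.exists_eq_add_of_le hjl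
          have h2 : s⁻¹ ^ (j : ℕ) * s ^ (j : ℕ) = 1 := by
            rw [← mul_pow, inv_mul_cancel₀ hs0, one_pow]
          have h3 : l - (j : ℕ) = e := by omega
          rw [h3, show l + c0 = (j : ℕ) + e + c0 by omega, pow_add, pow_add]
          linear_combination (s⁻¹ ^ e * s⁻¹ ^ c0 * f i') * h2
        change s⁻¹ ^ (l + c0) * (s ^ (j : ℕ) * f i') ∈ polyIntegral k s⁻¹
        rw [h1]
        exact (polyIntegral k s⁻¹).mul_mem (pow_mem hsmem' _) (hc _ _ (Finset.le_sup (Finset.mem_univ _)))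
    have hsN : (spectralUltra F M) s⁻¹ ≤ 1 := by
      rw [← hsinv]
      exact (hcF.norm_algebraMap_le _).trans ht.inv.norm_eq_one.le
    have hmem : ∀ i, (spectralUltra F M).red (w i) ∈ polarSubmodule (Residue k) (residue t) (l + c0) := by
      intro i
      refine ⟨red_mem_polyIntegral ht (hw1 i) (hw.1 i), ?_⟩
      have h1 := red_mem_polyIntegral ht.inv (v := s⁻¹ ^ (l + c0) * w i) (by
        rw [hsinv]; exact hw2 i) ((spectralUltra F M).mul_le_one ((spectralUltra F M).pow_le_one hsN _) (hw.1 i))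
      rw [red_mul ((spectralUltra F M).pow_le_one hsN _) (hw.1 i), red_pow hsN, ← hsinv,
        ← hcF.algebraMap_residue _ ht.inv.norm_eq_one.le, ← residue_inv ht.norm_eq_one] at h1
      exact h1
    have hind := hw.linearIndependent_red hck
    have hind' : LinearIndependent (Residue k) fun i =>
        (⟨(spectralUltra F M).red (w i), hmem i⟩ : polarSubmodule (Residue k) (A := (spectralUltra F M).Red) (residue t) (l + c0)) :=
      LinearIndependent.of_comp (Submodule.subtype _) hind
    have h0 := hind'.cardinal_lift_le_rank
    rw [Cardinal.mk_fin, Cardinal.lift_natCast, Cardinal.lift_id'.{0}] at h0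
    have h1 := h0.trans
      (rank_polarSubmodule_le ht.residue_notMem_range ht.residue_exists_mul_eq (l + c0))
    exact_mod_cast h1
  by_contra! hlt
  -- Letting `l` grow would give `D ≤ m`; `l = D * c0` is already large enough to contradict `m ≤ D
  -- - 1`.
  have h1 := hkey (D * c0)
  have h2 : m * (D * c0 + c0 + 1) ≤ (D - 1) * (D * c0 + c0 + 1) :=
    Nat.mul_le_mul_right _ (by omega)
  obtain ⟨e, he⟩ : ∃ e, D = e + 1 := ⟨D - 1, by omega⟩
  rw [he, Nat.add_sub_cancel] at h2
  rw [he] at h1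
  nlinarith

end Stability

end AnalyticField
end

/-! ### Simple residual equations in extensions without defect. -/

noncomputable section

namespace AnalyticField

open Polynomial UltraNorm

section Unramified

variable {F M : Type*} [NormedField F] [IsUltrametricDist F] [NormedField M]
  [IsUltrametricDist M] [NormedAlgebra F M] [FiniteDimensional F M]

instance : FiniteDimensional (Residue F) (spectralUltra F M).Red :=
  finite_red redCompat_spectralUltra

theorem norm_le_spectralUltra (x : M) : ‖x‖ ≤ spectralUltra F M x := by
  let f : AlgebraNorm F M :=
    { toFun := fun x => ‖x‖
      map_zero' := norm_zero
      add_le' := norm_add_le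
      neg' := norm_neg
      mul_le' := fun x y => (norm_mul x y).le
      eq_zero_of_map_eq_zero' := fun x => norm_eq_zero.mp
      smul' := fun a x => norm_smul a x }
  exact norm_le_spectralNorm (f := f) (fun x n _ => norm_pow x n)
    (fun x y => IsUltrametricDist.norm_add_le_max x y) (Algebra.IsAlgebraic.isAlgebraic x)

/-- The reduction of the extension maps to its residue field. -/
def redToResidue : (spectralUltra F M).Red →ₐ[Residue F] Residue M :=
  { Red.map (N := spectralUltra F M) (N' := ofField M) (RingHom.id M) norm_le_spectralUltra with
    commutes' := fun a => by
      obtain ⟨a, ha, rfl⟩ : ∃ x : F, ‖x‖ ≤ 1 ∧ residue x = a := exists_red_eq a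
      have h := redCompat_spectralUltra (F := F) (M := M)
      rw [h.algebraMap_residue a ha, algebraMap_residue ha]
      exact Red.map_red (N := spectralUltra F M) (N' := ofField M) (RingHom.id M)
        norm_le_spectralUltra ((h.norm_algebraMap_le a).trans ha) }

theorem redToResidue_red {x : M} (hx : spectralUltra F M x ≤ 1) :
    redToResidue (F := F) ((spectralUltra F M).red x) = residue x :=
  Red.map_red (N := spectralUltra F M) (N' := ofField M) (RingHom.id M)
    norm_le_spectralUltra hx

/-- The reduction map on the ring of integers of `F`. -/
def ballResidue (L : Type*) [NormedField L] [IsUltrametricDist L] :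
    (ofField L).ball →+* Residue L := Ideal.Quotient.mk _

theorem ballResidue_apply {L : Type*} [NormedField L] [IsUltrametricDist L]
    (x : (ofField L).ball) : ballResidue L x = residue (x : L) :=
  (red_of_le (N := ofField L) x.2).symm

omit [IsUltrametricDist M] in
-- A basis of the reduction lifts to an orthonormal family, which is a basis of `M` because there is
-- no defect. In it, multiplication by `θ` has an integral matrix that reduces to the matrix of
-- multiplication by the reduction of `θ`.
theorem exists_integral_charpoly
    (hst : Module.finrank F M ≤ Module.finrank (Residue F) (spectralUltra F M).Red) {θ : M}
    (hθ : spectralUltra F M θ ≤ 1) :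
    ∃ P : (ofField F).ball[X], P.Monic ∧
      P.map (ofField F).ball.subtype = (LinearMap.mulLeft F θ).charpoly ∧
      P.map (ballResidue F) =
        (LinearMap.mulLeft (Residue F) ((spectralUltra F M).red θ)).charpoly := by
  have hc : (spectralUltra F M).RedCompat F := redCompat_spectralUltra
  let b := Module.finBasis (Residue F) (spectralUltra F M).Red
  obtain ⟨w, hw1, hw⟩ := exists_lift_family (spectralUltra F M) b
  have hort : IsOrthonormal F (spectralUltra F M) w :=
    isOrthonormal_of_linearIndependent_red hc hw1 (by simpa only [hw] using b.linearIndependent)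
  have hli := hort.linearIndependent
  have hcard : Fintype.card (Fin (Module.finrank (Residue F) (spectralUltra F M).Red)) =
      Module.finrank F M := by
    refine le_antisymm hli.fintype_card_le_finrank ?_
    rwa [Fintype.card_fin]
  have hne : Nonempty (Fin (Module.finrank (Residue F) (spectralUltra F M).Red)) := by
    rw [← Fintype.card_pos_iff, hcard]
    exact Module.finrank_pos
  let B := basisOfLinearIndependentOfCardEqFinrank hli hcard
  have hB : ∀ i, B i = w i := fun i => by
    rw [coe_basisOfLinearIndependentOfCardEqFinrank]
  let T0 := LinearMap.toMatrix B B (LinearMap.mulLeft F θ)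
  have hcol : ∀ j, ∑ i, T0 i j • w i = θ * w j := fun j => by
    have := B.sum_repr (θ * w j)
    simp only [hB] at this
    rw [← this]
    refine Finset.sum_congr rfl fun i _ => ?_
    rw [show T0 i j = B.repr (LinearMap.mulLeft F θ (B j)) i from LinearMap.toMatrix_apply ..,
      LinearMap.mulLeft_apply, hB]
  have hT0 : ∀ i j, ‖T0 i j‖ ≤ 1 := fun i j => by
    refine (hort.2 (fun i => T0 i j) i).trans ?_
    rw [hcol]
    exact (spectralUltra F M).mul_le_one hθ (hw1 j)
  let T : Matrix _ _ (ofField F).ball := Matrix.of fun i j => ⟨T0 i j, hT0 i j⟩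
  refine ⟨T.charpoly, T.charpoly_monic, ?_, ?_⟩
  · rw [← Matrix.charpoly_map, ← LinearMap.charpoly_toMatrix _ B]
    rfl
  · rw [← Matrix.charpoly_map, ← LinearMap.charpoly_toMatrix _ b]
    congr 1
    ext i j
    have h1 : (spectralUltra F M).red θ * b j = ∑ i, residue (T0 i j) • b i := by
      rw [← hw j, ← red_mul hθ (hw1 j), ← hcol, red_sum]
      · exact Finset.sum_congr rfl fun i _ => by
          rw [← hw i, hc.residue_smul (hT0 i j) (hw1 i)]
      · exact fun i _ => (hc.smul_le _ _).trans
          (mul_le_one₀ (hT0 i j) ((spectralUltra F M).nonneg' _) (hw1 i))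
    rw [LinearMap.toMatrix_apply, LinearMap.mulLeft_apply, h1, map_sum]
    simp only [map_smul, Module.Basis.repr_self, Finsupp.coe_finsetSum, Finset.sum_apply,
      Finsupp.smul_apply, smul_eq_mul]
    rw [Finset.sum_eq_single i]
    · rw [Finsupp.single_eq_same, mul_one, Matrix.map_apply, ballResidue_apply]
      rfl
    · intro l _ hl
      rw [Finsupp.single_eq_of_ne (Ne.symm hl), mul_zero]
    · simp

/-- When there is no defect and the residue extension is separable, all elements close to a
suitable one are simple roots modulo the maximal ideal of monic integral polynomials. -/
theorem exists_simple_root [Algebra.IsSeparable (Residue F) (Residue M)]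
    (hst : Module.finrank F M ≤ Module.finrank (Residue F) (spectralUltra F M).Red) :
    ∃ θ : M, spectralUltra F M θ ≤ 1 ∧ ∀ θ', spectralUltra F M (θ' - θ) < 1 →
      ∃ Q : F[X], Q.Monic ∧ (∀ i, ‖Q.coeff i‖ ≤ 1) ∧ aeval θ' Q = 0 ∧
        ‖aeval θ' (derivative Q)‖ = 1 := by
  have hc : (spectralUltra F M).RedCompat F := redCompat_spectralUltra
  -- The residue field of `M` is a separable quotient of the reduced algebra, so some `a` is mapped
  -- to a simple root of its characteristic polynomial. For every lift of `a`, the characteristic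
  -- polynomial over `F` reduces to this one, so its derivative at the lift has norm one.
  obtain ⟨a, ha⟩ := exists_eval_derivative_charpoly_ne_zero
    (redToResidue (F := F) (M := M))
  obtain ⟨θ, hθ, rfl⟩ := exists_red_eq a
  refine ⟨θ, hθ, fun θ' hθ' => ?_⟩
  have hθ'1 : spectralUltra F M θ' ≤ 1 := by
    have := (spectralUltra F M).add' (θ' - θ) θ
    rw [sub_add_cancel] at this
    exact this.trans (max_le hθ'.le hθ)
  have hred : (spectralUltra F M).red θ' = (spectralUltra F M).red θ :=
    (red_eq_iff hθ'1 hθ).mpr hθ'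
  obtain ⟨P, hPm, hPθ, hPred⟩ := exists_integral_charpoly hst hθ'1
  rw [hred] at hPred
  set Q := (LinearMap.mulLeft F θ').charpoly with hQ
  have hθM : ‖θ'‖ ≤ 1 := (norm_le_spectralUltra (F := F) θ').trans hθ'1
  let f : (ofField F).ball →+* (ofField M).ball :=
    (algebraMap F M).restrict _ _ fun x hx => (norm_algebraMap' M x).le.trans hx
  let z : (ofField M).ball := ⟨θ', hθM⟩
  have hcoe : ((P.derivative.eval₂ f z : (ofField M).ball) : M) = aeval θ' (derivative Q) := by
    have h1 := hom_eval₂ P.derivative f (ofField M).ball.subtype z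
    rw [← hPθ, derivative_map, aeval_def, eval₂_map]
    exact h1
  have hres : ballResidue M (P.derivative.eval₂ f z) =
      aeval (redToResidue (F := F) ((spectralUltra F M).red θ))
        (derivative (LinearMap.mulLeft (Residue F) ((spectralUltra F M).red θ)).charpoly) := by
    rw [← hPred, ← hred, redToResidue_red hθ'1, derivative_map, aeval_def, eval₂_map, hom_eval₂,
      ballResidue_apply]
    congr 1
  refine ⟨Q, LinearMap.charpoly_monic _, fun i => ?_, ?_, ?_⟩
  · rw [← hPθ, coeff_map]
    exact (P.coeff i).2
  · have h1 := LinearMap.aeval_self_charpoly (LinearMap.mulLeft F θ')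
    have h2 : aeval (LinearMap.mulLeft F θ') (LinearMap.mulLeft F θ').charpoly =
        Algebra.lmul F M (aeval θ' (LinearMap.mulLeft F θ').charpoly) := by
      rw [← aeval_algHom_apply]; rfl
    rw [h2] at h1
    simpa using congrArg (fun f => f 1) h1
  · rw [← hcoe]
    refine le_antisymm (P.derivative.eval₂ f z).2 ?_
    by_contra! hlt
    refine ha ?_
    rw [← hres, ballResidue_apply]
    exact (residue_eq_zero_iff (P.derivative.eval₂ f z).2).mpr hlt

end Unramified

end AnalyticField
end

/-! ### Hensel's lemma for power series over the unit ball. -/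

noncomputable section

namespace AnalyticField

open Polynomial UltraNorm

section HenselLift

variable {W : Type*} [NormedField W] [IsUltrametricDist W]

theorem exists_map_eq_of_weightedBound {G : PowerSeries W} (hG : WeightedBound 1 1 G) :
    ∃ G' : PowerSeries (ofField W).ball, PowerSeries.map (ofField W).ball.subtype G' = G := by
  refine ⟨PowerSeries.mk fun n => ⟨PowerSeries.coeff n G,
    show ‖PowerSeries.coeff n G‖ ≤ 1 by simpa using hG n⟩, ?_⟩
  ext n
  simp

theorem weightedBound_map (G : PowerSeries (ofField W).ball) :
    WeightedBound 1 1 (PowerSeries.map (ofField W).ball.subtype G) := fun n => by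
  rw [one_pow, mul_one, PowerSeries.coeff_map]
  exact (PowerSeries.coeff n G).2

theorem constantCoeff_map_powerSeries {R S : Type*} [CommRing R] [CommRing S] (f : R →+* S)
    (G : PowerSeries R) : PowerSeries.constantCoeff (PowerSeries.map f G) =
      f (PowerSeries.constantCoeff G) := by
  rw [← PowerSeries.coeff_zero_eq_constantCoeff_apply, PowerSeries.coeff_map,
    PowerSeries.coeff_zero_eq_constantCoeff_apply]

theorem isUnit_ball {x : (ofField W).ball} (hx : ‖(x : W)‖ = 1) : IsUnit x := by
  refine isUnit_iff_exists_inv.mpr ⟨⟨(x : W)⁻¹, ?_⟩, Subtype.ext (mul_inv_cancel₀ ?_)⟩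
  · change ‖(x : W)⁻¹‖ ≤ 1
    rw [norm_inv, hx, inv_one]
  · intro h
    rw [h, norm_zero] at hx
    exact zero_ne_one hx

variable {k : Subfield W}

theorem weightedBound_aeval_shift {t : W} (ht : ‖t‖ = 1) {p : k[X]}
    (hp : ∀ i, ‖p.coeff i‖ ≤ 1) : WeightedBound 1 1 (aeval (shift t) p) := by
  have hs := weightedBound_shift t
  rw [ht] at hs
  rw [aeval_eq_sum_range]
  refine WeightedBound.sum zero_le_one zero_le_one _ _ fun i _ => ?_
  rw [Algebra.smul_def, algebraMap_powerSeries]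
  have := ((weightedBound_C (r := 1) (p.coeff i : W)).mono (hp i)).mul zero_le_one
    (hs.pow zero_le_one i)
  simpa using this

variable {F : Type*} [NormedField F] [IsUltrametricDist F] [NormedAlgebra k F]
  [NormedAlgebra F W] [IsScalarTower k F W]

/-- Write `a = p(t) / q(t)` with `‖q(t)‖ = 1` and replace `t` by `t + X`. The denominator is a unit
over the unit ball since its constant term has norm one. -/
theorem exists_series_lift {t : F} (ht : IsGaussGenerator k t) {a : F} (ha : ‖a‖ ≤ 1) :
    ∃ (G : PowerSeries (ofField W).ball) (p q : k[X]),
      aeval t q ≠ 0 ∧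
      aeval (shift (algebraMap F W t)) q * PowerSeries.map (ofField W).ball.subtype G =
        aeval (shift (algebraMap F W t)) p ∧
      ((PowerSeries.constantCoeff G : (ofField W).ball) : W) = algebraMap F W a := by
  set s := algebraMap F W t with hs
  have hs1 : ‖s‖ = 1 := by rw [hs, norm_algebraMap', ht.norm_eq_one]
  obtain ⟨p, q, hq, h⟩ := ht.exists_mul_eq_normalized a
  have hq1 : ∀ i, ‖q.coeff i‖ ≤ 1 := fun i => hq ▸ ht.coeff_le q i
  have hp1 : ∀ i, ‖p.coeff i‖ ≤ 1 := fun i => by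
    refine (ht.coeff_le p i).trans ?_
    rw [← h, norm_mul, hq, one_mul]
    exact ha
  have hcc : ∀ p : k[X], PowerSeries.constantCoeff (aeval (shift s) p) =
      algebraMap F W (aeval t p) := fun p => by
    rw [constantCoeff_aeval, constantCoeff_shift, hs, aeval_algebraMap_apply]
  obtain ⟨S, hS⟩ := exists_map_eq_of_weightedBound (weightedBound_aeval_shift hs1 hq1)
  obtain ⟨P, hP⟩ := exists_map_eq_of_weightedBound (weightedBound_aeval_shift hs1 hp1)
  have hS0 : ((PowerSeries.constantCoeff S : (ofField W).ball) : W) =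
      algebraMap F W (aeval t q) := by
    rw [← hcc, ← hS, constantCoeff_map_powerSeries]; rfl
  have hP0 : ((PowerSeries.constantCoeff P : (ofField W).ball) : W) =
      algebraMap F W (aeval t p) := by
    rw [← hcc, ← hP, constantCoeff_map_powerSeries]; rfl
  have hu : IsUnit S := by
    rw [PowerSeries.isUnit_iff_constantCoeff]
    exact isUnit_ball (by rw [hS0, norm_algebraMap', hq])
  obtain ⟨V, hV⟩ := isUnit_iff_exists_inv.mp hu
  have hq0 : aeval t q ≠ 0 := fun h0 => by simp [h0] at hq
  refine ⟨V * P, p, q, hq0, ?_, ?_⟩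
  · rw [← hS, ← map_mul, ← mul_assoc, hV, one_mul, hP]
  · have h1 : PowerSeries.constantCoeff S * PowerSeries.constantCoeff (V * P) =
        PowerSeries.constantCoeff P := by
      rw [← map_mul, ← mul_assoc, hV, one_mul]
    have h2 := congrArg (fun x : (ofField W).ball => (x : W)) h1
    simp only [Subring.coe_mul, hS0, hP0] at h2
    rw [← h, map_mul (algebraMap F W)] at h2
    exact mul_left_cancel₀ ((_root_.map_ne_zero (algebraMap F W)).mpr hq0) h2

omit [IsUltrametricDist W] in
theorem isAlgebraic_of_mul_eq_aeval {s : W} {n : ℕ} {p q : ℕ → k[X]} {G : ℕ → PowerSeries W}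
    (hq : ∀ i, aeval s (q i) ≠ 0)
    (hG : ∀ i, aeval (shift s) (q i) * G i = aeval (shift s) (p i)) {Θ : PowerSeries W}
    (h : Θ ^ n + ∑ i ∈ Finset.range n, G i * Θ ^ i = 0) :
    IsAlgebraic (Algebra.adjoin k {shift s}) Θ := by
  let e : k[X] → Algebra.adjoin k {shift s} := fun p =>
    ⟨aeval (shift s) p, aeval_mem_adjoin_singleton k (shift s)⟩
  set D : k[X] := ∏ i ∈ Finset.range n, q i with hD
  set b : ℕ → k[X] := fun i => (∏ j ∈ (Finset.range n).erase i, q j) * p i with hb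
  have hdeg : (∑ i ∈ Finset.range n, C (e (b i)) * X ^ i).degree < (n : WithBot ℕ) := by
    refine (degree_sum_le _ _).trans_lt ((Finset.sup_lt_iff (WithBot.bot_lt_coe _)).mpr ?_)
    intro i hi
    exact (degree_C_mul_X_pow_le _ _).trans_lt (by exact_mod_cast Finset.mem_range.mp hi)
  refine ⟨C (e D) * X ^ n + ∑ i ∈ Finset.range n, C (e (b i)) * X ^ i, fun h0 => ?_, ?_⟩
  · have h1 := congrArg (fun P => P.coeff n) h0
    simp only [coeff_add, coeff_C_mul, coeff_X_pow, if_true, mul_one, coeff_zero,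
      coeff_eq_zero_of_degree_lt hdeg, add_zero] at h1
    have h2 : aeval (shift s) D = 0 := congrArg Subtype.val h1
    have h3 := congrArg PowerSeries.constantCoeff h2
    rw [constantCoeff_aeval, constantCoeff_shift, map_zero, hD, map_prod,
      Finset.prod_eq_zero_iff] at h3
    obtain ⟨i, -, hi⟩ := h3
    exact hq i hi
  · have hDi : ∀ i ∈ Finset.range n, aeval (shift s) (b i) = aeval (shift s) D * G i := by
      intro i hi
      rw [hb, hD, ← Finset.prod_erase_mul _ _ hi, map_mul, map_mul, mul_assoc, hG]
    have hval : ∀ p, algebraMap (Algebra.adjoin k {shift s}) (PowerSeries W) (e p) =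
        aeval (shift s) p := fun p => rfl
    rw [map_add, map_mul, aeval_C, map_pow, aeval_X, map_sum, hval,
      ← mul_zero (aeval (shift s) D), ← h, mul_add, Finset.mul_sum]
    refine congrArg _ (Finset.sum_congr rfl fun i hi => ?_)
    rw [map_mul, aeval_C, map_pow, aeval_X, hval, hDi i hi, mul_assoc]

/-- A simple root modulo the maximal ideal of an integral monic polynomial over `k(t)` is good. -/
theorem mem_goodElements_of_simple_root {t : F} (ht : IsGaussGenerator k t) {θ : W}
    (hθ : ‖θ‖ ≤ 1) {Q : F[X]} (hQ : Q.Monic) (hQ1 : ∀ i, ‖Q.coeff i‖ ≤ 1)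
    (h0 : aeval θ Q = 0) (h1 : ‖aeval θ (derivative Q)‖ = 1) :
    θ ∈ goodElements k (algebraMap F W t) := by
  set s := algebraMap F W t with hs
  have hs1 : ‖s‖ = 1 := by rw [hs, norm_algebraMap', ht.norm_eq_one]
  choose G p q hq hG hG0 using fun i => exists_series_lift (W := W) ht (hQ1 i)
  set n := Q.natDegree with hn
  -- This is `Q` with `t` replaced by `t + X` in its coefficients; setting `X = 0` gives back `Q`.
  set Q' : (PowerSeries (ofField W).ball)[X] :=
    X ^ n + ∑ i ∈ Finset.range n, C (G i) * X ^ i with hQ'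
  have hdeg : (∑ i ∈ Finset.range n, C (G i) * X ^ i).degree < (n : WithBot ℕ) := by
    refine (degree_sum_le _ _).trans_lt ((Finset.sup_lt_iff (WithBot.bot_lt_coe _)).mpr ?_)
    intro i hi
    exact (degree_C_mul_X_pow_le _ _).trans_lt (by exact_mod_cast Finset.mem_range.mp hi)
  let θ' : (ofField W).ball := ⟨θ, hθ⟩
  let c : PowerSeries (ofField W).ball →+* (ofField W).ball := PowerSeries.constantCoeff
  let ψ : PowerSeries (ofField W).ball →+* W := (ofField W).ball.subtype.comp c
  have hmap : Q'.map ψ = Q.map (algebraMap F W) := by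
    conv_rhs => rw [hQ.as_sum]
    rw [hQ', Polynomial.map_add, Polynomial.map_add, Polynomial.map_pow, Polynomial.map_pow,
      map_X, map_X, Polynomial.map_sum, Polynomial.map_sum]
    refine congrArg _ (Finset.sum_congr rfl fun i _ => ?_)
    rw [Polynomial.map_mul, Polynomial.map_mul, map_C, map_C, Polynomial.map_pow,
      Polynomial.map_pow, map_X, map_X, ← hG0 i]
    rfl
  have hψθ : ψ (PowerSeries.C θ') = θ := by
    change ((PowerSeries.constantCoeff (PowerSeries.C θ') : (ofField W).ball) : W) = θ
    rw [PowerSeries.constantCoeff_C]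
  have heval : ψ (Q'.eval (PowerSeries.C θ')) = aeval θ Q := by
    rw [← eval_map_apply, hψθ, hmap, eval_map_algebraMap]
  have heval' : ψ (Q'.derivative.eval (PowerSeries.C θ')) = aeval θ (derivative Q) := by
    rw [← eval_map_apply, hψθ, ← derivative_map, hmap, derivative_map, eval_map_algebraMap]
  -- The constant series `θ` is a simple root modulo `X`, so it lifts `X`-adically. The root has
  -- coefficients in the unit ball, which is the required bound at radius `‖t‖ = 1`.
  obtain ⟨a, ha, hac⟩ := HenselianRing.is_henselian
    (I := Ideal.span {(PowerSeries.X : PowerSeries (ofField W).ball)}) Q' (monic_X_pow_add hdeg)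
    (PowerSeries.C θ') (by
      rw [Ideal.mem_span_singleton, PowerSeries.X_dvd_iff]
      exact Subtype.ext (heval.trans h0)) (by
      refine IsUnit.map _ ?_
      rw [PowerSeries.isUnit_iff_constantCoeff]
      refine isUnit_ball ?_
      rw [← h1, ← heval']
      rfl)
  rw [Ideal.mem_span_singleton, PowerSeries.X_dvd_iff, map_sub, PowerSeries.constantCoeff_C,
    sub_eq_zero] at hac
  refine ⟨PowerSeries.map (ofField W).ball.subtype a, ⟨⟨1, ?_⟩, ?_⟩, ?_⟩
  · rw [hs1]; exact weightedBound_map a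
  · refine isAlgebraic_of_mul_eq_aeval (n := n) (p := p) (q := q)
      (G := fun i => PowerSeries.map (ofField W).ball.subtype (G i)) (fun i => ?_) hG ?_
    · rw [aeval_algebraMap_apply]
      simpa using hq i
    · have h2 := congrArg (PowerSeries.map (ofField W).ball.subtype) ha
      rw [hQ', eval_add, eval_finsetSum] at h2
      simpa using h2
  · rw [constantCoeff_map_powerSeries, hac]
    rfl

/-- Finite extensions of `k(t)` with separable residue extension consist of good elements. -/
theorem coe_mem_goodElements_of_isSeparable [IsAlgClosed k] (hk : SeqSphericallyComplete k)
    (hval : ∀ r : ℝ, 0 < r → ∃ c : k, ‖c‖ = r) {t : F} (ht : IsGaussGenerator k t)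
    {M : Type*} [NormedField M] [IsUltrametricDist M] [NormedAlgebra F M] [NormedAlgebra k M]
    [NormedAlgebra M W] [IsScalarTower k F M] [IsScalarTower F M W] [IsScalarTower k M W]
    [FiniteDimensional F M] [Algebra.IsSeparable (Residue F) (Residue M)] (f : M) :
    algebraMap M W f ∈ goodElements k (algebraMap F W t) := by
  obtain ⟨θ, hθ, h⟩ := exists_simple_root (finrank_le_finrank_red (M := M) hk hval ht)
  have hgood : ∀ θ' : M, spectralUltra F M (θ' - θ) < 1 →
      algebraMap M W θ' ∈ goodElements k (algebraMap F W t) := by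
    intro θ' hθ'
    obtain ⟨Q, hQ, hQ1, h0, h1⟩ := h θ' hθ'
    have hθ1 : ‖θ'‖ ≤ 1 := by
      refine (norm_le_spectralUltra (F := F) θ').trans ?_
      have := (spectralUltra F M).add' (θ' - θ) θ
      rw [sub_add_cancel] at this
      exact this.trans (max_le hθ'.le hθ)
    refine mem_goodElements_of_simple_root ht ?_ hQ hQ1 ?_ ?_
    · rwa [norm_algebraMap']
    · rw [aeval_algebraMap_apply, h0, map_zero]
    · rw [aeval_algebraMap_apply, norm_algebraMap', h1]
  -- With this `c`, both `θ` and `θ + c • f` lie in the residue class of good elements, and `f` is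
  -- recovered from their difference.
  obtain ⟨c, hc⟩ := hval (spectralUltra F M f + 1)⁻¹
    (inv_pos.mpr (by have := (spectralUltra F M).nonneg' f; linarith))
  have hpos : 0 < spectralUltra F M f + 1 := by
    have := (spectralUltra F M).nonneg' f; linarith
  have hc0 : c ≠ 0 := by
    rintro rfl
    rw [norm_zero] at hc
    exact (inv_pos.mpr hpos).ne hc
  have h1 := hgood θ (by rw [sub_self, (spectralUltra F M).zero']; exact one_pos)
  have h2 := hgood (θ + c • f) (by
    rw [add_sub_cancel_left, (isNormOver_spectralUltra (F := F) (M := M) k).smul, hc,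
      inv_mul_eq_div, div_lt_one hpos]
    linarith)
  have h3 : algebraMap M W f =
      (c⁻¹ : k) * (algebraMap M W (θ + c • f) - algebraMap M W θ) := by
    rw [← map_sub, add_sub_cancel_left, Algebra.smul_def, map_mul,
      ← IsScalarTower.algebraMap_apply k M W]
    have : algebraMap k W c = (c : W) := rfl
    rw [this, ← mul_assoc, ← Subfield.coe_mul, inv_mul_cancel₀ hc0]
    simp
  rw [h3]
  exact mul_mem (coe_mem_goodElements k _ _) (sub_mem h2 h1)

end HenselLift

end AnalyticField
end

/-! ### Exchange, separating elements and elements with the Gauss norm. -/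

noncomputable section

namespace AnalyticField

open Polynomial UltraNorm

section OneDimensional

variable {κ L : Type*} [Field κ] [Field L] [Algebra κ L]

/-- Exchange for algebraic dependence. -/
theorem isAlgebraic_adjoin_exchange {x a b : L} (ha : IsAlgebraic (Algebra.adjoin κ {x}) a)
    (hb : IsAlgebraic (Algebra.adjoin κ {x}) b) (hat : Transcendental κ a) :
    IsAlgebraic (Algebra.adjoin κ {a}) b := by
  let m := AlgebraicIndependent.matroid κ L
  have hmem : ∀ (s : Set L) (y : L), y ∈ m.closure s ↔ IsAlgebraic (Algebra.adjoin κ s) y :=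
    fun s y => by rw [AlgebraicIndependent.matroid_closure_eq]; rfl
  have h1 : a ∈ m.closure (insert x ∅) \ m.closure ∅ := by
    refine ⟨by rw [insert_empty_eq]; exact (hmem _ _).mpr ha, fun h => hat ?_⟩
    rw [hmem, Algebra.adjoin_empty] at h
    have : Algebra.IsAlgebraic κ (⊥ : Subalgebra κ L) := ⟨fun y => by
      obtain ⟨c, hc⟩ := Algebra.mem_bot.mp y.2
      rw [show y = algebraMap κ _ c from Subtype.ext hc.symm]
      exact isAlgebraic_algebraMap c⟩
    exact h.restrictScalars κ
  have h2 := (Matroid.closure_exchange h1).1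
  rw [insert_empty_eq] at h2
  have h3 : m.closure {x} ⊆ m.closure {a} :=
    m.closure_subset_closure_of_subset_closure (Set.singleton_subset_iff.mpr h2)
  exact (hmem _ _).mp (h3 ((hmem _ _).mpr hb))

/-- Over an algebraically closed field, a finitely generated extension of transcendence degree one
has a separating element. -/
theorem exists_separating_element [IsAlgClosed κ] [Algebra.EssFiniteType κ L] {x : L}
    (hx : Transcendental κ x) (hL : ∀ b : L, IsAlgebraic (Algebra.adjoin κ {x}) b) :
    ∃ τ : L, Transcendental κ τ ∧ Algebra.IsSeparable (IntermediateField.adjoin κ {τ}) L := by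
  obtain ⟨s, hs, hsep⟩ := exists_isTranscendenceBasis_and_isSeparable_of_perfectField κ L
  have hne : Nonempty s := hs.nonempty_iff_transcendental.mpr ⟨⟨x, hx⟩⟩
  obtain ⟨τ⟩ := hne
  have hτ : Transcendental κ (τ : L) := hs.1.transcendental τ
  have hall : ∀ y ∈ s, y = τ := by
    intro y hy
    by_contra hne
    have h1 := (hs.1.transcendental_adjoin_iff (s := {τ}) (i := ⟨y, hy⟩)).mpr
      (fun h => hne (congrArg Subtype.val h))
    rw [Set.image_singleton] at h1
    exact h1 (isAlgebraic_adjoin_exchange (hL _) (hL _) hτ)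
  have hs' : (s : Set L) = {(τ : L)} :=
    Set.eq_singleton_iff_unique_mem.mpr ⟨τ.2, hall⟩
  rw [hs'] at hsep
  exact ⟨τ, hτ, hsep⟩

theorem isSeparable_of_adjoin_le {E : Type*} [Field E] [Algebra E L] {S : Set L}
    (hκ : ∀ c : κ, algebraMap κ L c ∈ (algebraMap E L).fieldRange)
    (hS : S ⊆ (algebraMap E L).fieldRange)
    [Algebra.IsSeparable (IntermediateField.adjoin κ S) L] : Algebra.IsSeparable E L := by
  have hle : ∀ y ∈ IntermediateField.adjoin κ S, y ∈ (algebraMap E L).fieldRange := by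
    intro y hy
    have : IntermediateField.adjoin κ S ≤
        { (algebraMap E L).fieldRange with algebraMap_mem' := hκ } :=
      IntermediateField.adjoin_le_iff.mpr hS
    exact this hy
  refine ⟨fun y => ?_⟩
  set p := minpoly (IntermediateField.adjoin κ S) y with hp
  have hsep : p.Separable := Algebra.IsSeparable.isSeparable (IntermediateField.adjoin κ S) y
  have hlift : p.map (algebraMap (IntermediateField.adjoin κ S) L) ∈ lifts (algebraMap E L) := by
    rw [lifts_iff_coeff_lifts]
    intro n
    rw [coeff_map]
    exact hle _ (p.coeff n).2
  obtain ⟨q, hq⟩ := (mem_lifts _).mp hlift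
  have hqs : q.Separable := by
    rw [← separable_map (algebraMap E L), hq, separable_map]
    exact hsep
  refine hqs.of_dvd (minpoly.dvd E y ?_)
  rw [← eval_map_algebraMap, hq, eval_map_algebraMap, hp, minpoly.aeval]

end OneDimensional

section Instances

instance {W : Type*} [NormedField W] (k : Subfield W) : NormedAlgebra k W where
  norm_smul_le c x := (norm_mul (c : W) x).le

instance {k M : Type*} [NormedField k] [NormedField M] [NormedAlgebra k M]
    (F : IntermediateField k M) : NormedAlgebra F M where
  norm_smul_le c x := (norm_mul (c : M) x).le

end Instances

section GaussGenerator

variable {k M : Type*} [NormedField k] [IsUltrametricDist k] [NormedField M]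
  [IsUltrametricDist M] [NormedAlgebra k M] {s : M}

theorem norm_coeff_mul_le {p q : k[X]} {a b : ℝ} (hb : 0 ≤ b)
    (hp : ∀ i, ‖p.coeff i‖ ≤ a) (hq : ∀ i, ‖q.coeff i‖ ≤ b) (i : ℕ) :
    ‖(p * q).coeff i‖ ≤ a * b := by
  have ha : 0 ≤ a := (norm_nonneg _).trans (hp 0)
  rw [coeff_mul]
  refine (ofField k).sum_le _ _ (by positivity) fun j _ => ?_
  rw [ofField_apply, norm_mul]
  exact mul_le_mul (hp _) (hq _) (norm_nonneg _) ha

/-- Split `p` into linear factors. As `s` has distance at least one from `k`, both coefficients of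
`X - c` are at most `‖s - c‖`, and coefficient bounds multiply. -/
theorem norm_coeff_le_aeval [IsAlgClosed k] (hs1 : ‖s‖ = 1)
    (hs : ∀ c : k, 1 ≤ ‖s - algebraMap k M c‖) (p : k[X]) (i : ℕ) :
    ‖p.coeff i‖ ≤ ‖aeval s p‖ := by
  have h := (IsAlgClosed.splits p).eq_prod_roots
  generalize p.roots = m at h
  generalize p.leadingCoeff = l at h
  subst h
  induction m using Multiset.induction_on generalizing i with
  | empty =>
    rw [Multiset.map_zero, Multiset.prod_zero, mul_one, aeval_C, norm_algebraMap', coeff_C]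
    split_ifs <;> simp
  | cons c m ih =>
    rw [Multiset.map_cons, Multiset.prod_cons, mul_left_comm, map_mul, norm_mul]
    refine norm_coeff_mul_le (norm_nonneg _) (fun j => ?_) ih i
    rw [map_sub, aeval_X, aeval_C]
    rcases j with _ | _ | j
    · rw [coeff_sub, coeff_X_zero, coeff_C_zero, zero_sub, norm_neg]
      have h1 := IsUltrametricDist.norm_add_le_max (-(s - algebraMap k M c)) s
      rw [neg_sub, sub_add_cancel, norm_algebraMap', hs1, norm_sub_rev] at h1
      exact h1.trans (max_le le_rfl (hs c))
    · simpa using hs c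
    · simp [coeff_X]

theorem isGaussGenerator_gen [IsAlgClosed k] (hs1 : ‖s‖ = 1)
    (hs : ∀ c : k, 1 ≤ ‖s - algebraMap k M c‖) :
    IsGaussGenerator k (IntermediateField.AdjoinSimple.gen k s) where
  norm_eq_one := hs1
  coeff_le p i := by
    have h := aeval_algebraMap_apply M (IntermediateField.AdjoinSimple.gen k s) p
    rw [IntermediateField.AdjoinSimple.algebraMap_gen] at h
    exact (norm_coeff_le_aeval hs1 hs p i).trans (le_of_eq (congrArg norm h))
  exists_mul_eq a := by
    obtain ⟨p, q, h⟩ := (IntermediateField.mem_adjoin_simple_iff k (a : M)).mp a.2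
    have hcoe : ∀ r : k[X], ((aeval (IntermediateField.AdjoinSimple.gen k s) r :
        IntermediateField.adjoin k {s}) : M) = aeval s r := fun r => by
      have := aeval_algebraMap_apply M (IntermediateField.AdjoinSimple.gen k s) r
      rw [IntermediateField.AdjoinSimple.algebraMap_gen] at this
      exact this.symm
    by_cases hq : aeval s q = 0
    · refine ⟨0, 1, by simp, Subtype.ext ?_⟩
      rw [hq, div_zero] at h
      simp [h]
    · refine ⟨p, q, fun h0 => hq ?_, Subtype.ext ?_⟩
      · rw [← hcoe, h0]; rfl
      · rw [IntermediateField.coe_mul, hcoe, hcoe, h, mul_div_cancel₀ _ hq]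

end GaussGenerator

end AnalyticField
end

/-! ### A parameter with separable residue extension. -/

noncomputable section

namespace AnalyticField

open Polynomial UltraNorm

theorem transcendental_of_notMem_range {κ L : Type*} [Field κ] [Field L] [Algebra κ L]
    [IsAlgClosed κ] {a : L} (ha : a ∉ Set.range (algebraMap κ L)) : Transcendental κ a := by
  intro h
  exact ha (minpoly.mem_range_of_degree_eq_one κ a
    (IsAlgClosed.degree_eq_one_of_irreducible κ (minpoly.irreducible h.isIntegral)))

theorem isAlgebraic_adjoin_of_le {κ E L : Type*} [Field κ] [Field E] [Field L] [Algebra κ L]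
    [Algebra E L] {S : Set L} (h : ∀ e : E, algebraMap E L e ∈ IntermediateField.adjoin κ S)
    {b : L} (hb : IsAlgebraic E b) : IsAlgebraic (Algebra.adjoin κ S) b := by
  rw [← IntermediateField.isAlgebraic_adjoin_iff]
  let f : E →+* IntermediateField.adjoin κ S :=
    (algebraMap E L).codRestrict (IntermediateField.adjoin κ S) h
  obtain ⟨p, hp, hpb⟩ := hb
  refine ⟨p.map f, (Polynomial.map_ne_zero_iff f.injective).mpr hp, ?_⟩
  rw [aeval_def, eval₂_map]
  exact hpb

section Residue

variable {k M : Type*} [NormedField k] [IsUltrametricDist k] [NormedField M]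
  [IsUltrametricDist M] [NormedAlgebra k M] {s : M}

theorem residue_notMem_range_iff (hs1 : ‖s‖ = 1) :
    residue s ∉ Set.range (algebraMap (Residue k) (Residue M)) ↔
      ∀ c : k, 1 ≤ ‖s - algebraMap k M c‖ := by
  constructor
  · intro h c
    by_contra! hc
    have h1 : ‖algebraMap k M c‖ ≤ 1 := by
      have := IsUltrametricDist.norm_add_le_max (-(s - algebraMap k M c)) s
      rw [neg_sub, sub_add_cancel, norm_sub_rev] at this
      exact this.trans (max_le hc.le hs1.le)
    refine h ⟨residue c, ?_⟩
    rw [norm_algebraMap'] at h1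
    rw [algebraMap_residue h1, eq_comm, red_eq_iff (N := ofField M) hs1.le]
    · exact hc
    · rwa [ofField_apply, norm_algebraMap']
  · rintro h ⟨c, hc⟩
    obtain ⟨c, hc1, rfl⟩ := exists_red_eq c
    rw [algebraMap_residue hc1, eq_comm] at hc
    have hc2 : ofField M (algebraMap k M c) ≤ 1 := by rwa [ofField_apply, norm_algebraMap']
    rw [red_eq_iff hs1.le hc2] at hc
    exact not_lt.mpr (h c) hc

variable {F : Type*} [NormedField F] [IsUltrametricDist F] [NormedAlgebra k F]

instance [NormedAlgebra F M] [IsScalarTower k F M] :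
    IsScalarTower (Residue k) (Residue F) (Residue M) := by
  refine IsScalarTower.of_algebraMap_eq fun c => ?_
  obtain ⟨c, hc, rfl⟩ := exists_red_eq c
  have hc2 : ‖algebraMap k F c‖ ≤ 1 := by rwa [norm_algebraMap']
  rw [algebraMap_residue hc, algebraMap_residue hc, algebraMap_residue hc2,
    ← IsScalarTower.algebraMap_apply]

theorem redCompat_ofField [NormedAlgebra F M] : (ofField M).RedCompat F where
  norm_algebraMap_le a := (norm_algebraMap' M a).le
  algebraMap_residue _ ha := algebraMap_residue ha

instance finite_residue [NormedAlgebra F M] [FiniteDimensional F M] :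
    FiniteDimensional (Residue F) (Residue M) := finite_red (F := F) redCompat_ofField

theorem IsGaussGenerator.adjoin_residue {t : F} (ht : IsGaussGenerator k t) :
    IntermediateField.adjoin (Residue k) {residue t} = ⊤ := by
  refine eq_top_iff.mpr fun e _ => ?_
  obtain ⟨p, q, hq, h⟩ := ht.residue_exists_mul_eq e
  exact (IntermediateField.mem_adjoin_simple_iff _ _).mpr ⟨p, q, by
    rw [← h, mul_div_cancel_left₀ _ hq]⟩

theorem IsGaussGenerator.essFiniteType {t : F} (ht : IsGaussGenerator k t) :
    Algebra.EssFiniteType (Residue k) (Residue F) := by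
  rw [← IntermediateField.fg_top_iff, ← ht.adjoin_residue]
  exact IntermediateField.fg_adjoin_of_finite (Set.finite_singleton _)

end Residue

section Parameter

variable {W : Type*} [NormedField W] [IsUltrametricDist W] {k : Subfield W}

/-- Spherical completeness provides a nearest point `a` of `k` to `z`, and `hval` a scalar that
makes the distance one. -/
theorem exists_unit_distance (hk : SeqSphericallyComplete k)
    (hval : ∀ r : ℝ, 0 < r → ∃ c : k, ‖c‖ = r) {z : W} (hz : z ∉ k) :
    ∃ a b : k, b ≠ 0 ∧ ‖b * (z - a)‖ = 1 ∧ ∀ c : k, 1 ≤ ‖b * (z - a) - c‖ := by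
  have hN : (ofField W).IsNormOver k :=
    ⟨fun c x => by
      rw [Algebra.smul_def, ofField_apply, norm_mul, norm_algebraMap', ofField_apply],
      fun x hx => norm_eq_zero.mp hx⟩
  have hw : IsOrthonormal k (ofField W) ![(1 : W)] := by
    refine ⟨fun i => by simp [ofField_apply], fun c i => ?_⟩
    rw [Subsingleton.elim i 0]
    simp [ofField_apply, Algebra.smul_def]
  obtain ⟨a, ha⟩ := exists_forall_sub_le hk hN hw z
  have ha' : ∀ c : k, ‖z - a 0‖ ≤ ‖z - c‖ := fun c => by
    have h := ha fun _ => c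
    simp only [ofField_apply, Algebra.smul_def, Finset.univ_unique, Finset.sum_singleton,
      Matrix.cons_val_fin_one, mul_one] at h
    exact h
  have hza : z - a 0 ≠ 0 := fun h => hz (by rw [sub_eq_zero.mp h]; exact (a 0).2)
  have hpos := norm_pos_iff.mpr hza
  obtain ⟨b, hb⟩ := hval ‖z - a 0‖⁻¹ (inv_pos.mpr hpos)
  have hb' : ‖(b : W)‖ = ‖z - a 0‖⁻¹ := hb
  have hb0 : (b : W) ≠ 0 := by
    rw [← norm_pos_iff, hb']; exact inv_pos.mpr hpos
  refine ⟨a 0, b, fun h => hb0 (by rw [h]; rfl), ?_, fun c => ?_⟩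
  · rw [norm_mul, hb', inv_mul_cancel₀ hpos.ne']
  · have h1 := ha' (a 0 + b⁻¹ * c)
    have h2 : (b : W) * (z - a 0) - c = b * (z - (a 0 + b⁻¹ * c : k)) := by
      push_cast
      field_simp
      ring
    rw [h2, norm_mul, hb', inv_mul_eq_div, one_le_div hpos]
    exact h1

theorem finiteDimensional_adjoin_simple {k M : Type*} [Field k] [Field M] [Algebra k M]
    {S : Set M} [Finite S] (hS : IntermediateField.adjoin k S = ⊤) {s : M}
    (hs : ∀ z ∈ S, IsAlgebraic (Algebra.adjoin k {s}) z) :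
    FiniteDimensional (IntermediateField.adjoin k {s}) M := by
  have h := IntermediateField.finiteDimensional_adjoin (K := IntermediateField.adjoin k {s})
    (S := S) fun z hz => (IntermediateField.isAlgebraic_adjoin_iff.mpr (hs z hz)).isIntegral
  have htop : IntermediateField.adjoin (IntermediateField.adjoin k {s}) S = ⊤ := by
    refine eq_top_iff.mpr fun y _ => ?_
    have : IntermediateField.adjoin k S ≤
        (IntermediateField.adjoin (IntermediateField.adjoin k {s}) S).restrictScalars k :=
      IntermediateField.adjoin_le_iff.mpr (IntermediateField.subset_adjoin _ S)
    exact this (hS ▸ IntermediateField.mem_top)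
  rw [htop] at h
  exact Module.Finite.equiv (IntermediateField.topEquiv (F := IntermediateField.adjoin k {s})
    (E := M)).toLinearEquiv

/-- `M` is finite over `k(x)`, whose residue field is generated by the residue of `x` over that of
`k`. So the residue field of `M` is finitely generated of transcendence degree one over an
algebraically closed field and has a separating element. Any lift `t` of it is a Gauss generator of
`k(t)`, and the residue extension of `M / k(t)` is separable. -/
theorem exists_forall_mem_goodElements [IsAlgClosed k] (hk : SeqSphericallyComplete k)
    (hval : ∀ r : ℝ, 0 < r → ∃ c : k, ‖c‖ = r)
    {M : Type*} [NormedField M] [IsUltrametricDist M] [NormedAlgebra k M]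
    [NormedAlgebra M W] [IsScalarTower k M W] {S : Set M} [Finite S]
    (hS : IntermediateField.adjoin k S = ⊤) {x : M} (hx1 : ‖x‖ = 1)
    (hx : ∀ c : k, 1 ≤ ‖x - algebraMap k M c‖)
    (hxS : ∀ z ∈ S, IsAlgebraic (Algebra.adjoin k {x}) z) :
    ∃ t : M, ‖t‖ = 1 ∧ (∀ c : k, 1 ≤ ‖t - algebraMap k M c‖) ∧
      ∀ f : M, algebraMap M W f ∈ goodElements k (algebraMap M W t) := by
  have hfin : FiniteDimensional (IntermediateField.adjoin k {x}) M :=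
    finiteDimensional_adjoin_simple hS hxS
  have hgx := isGaussGenerator_gen hx1 hx
  have : Algebra.EssFiniteType (Residue k) (Residue (IntermediateField.adjoin k {x})) :=
    hgx.essFiniteType
  have : Algebra.EssFiniteType (Residue k) (Residue M) :=
    Algebra.EssFiniteType.comp (Residue k) (Residue (IntermediateField.adjoin k {x})) (Residue M)
  have hxt : Transcendental (Residue k) (residue x) :=
    transcendental_of_notMem_range ((residue_notMem_range_iff hx1).mpr hx)
  have halg : ∀ b : Residue M, IsAlgebraic (Algebra.adjoin (Residue k) {residue x}) b := by
    intro b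
    have hb : IsAlgebraic (Residue (IntermediateField.adjoin k {x})) b :=
      Algebra.IsAlgebraic.isAlgebraic b
    refine isAlgebraic_adjoin_of_le (fun e => ?_) hb
    have he : e ∈ IntermediateField.adjoin (Residue k)
        {residue (IntermediateField.AdjoinSimple.gen k x)} := by
      rw [hgx.adjoin_residue]
      exact IntermediateField.mem_top
    obtain ⟨p, q, rfl⟩ := (IntermediateField.mem_adjoin_simple_iff _ _).mp he
    have hgen : algebraMap (Residue (IntermediateField.adjoin k {x})) (Residue M)
        (residue (IntermediateField.AdjoinSimple.gen k x)) = residue x :=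
      algebraMap_residue hx1.le
    refine (IntermediateField.mem_adjoin_simple_iff _ _).mpr ⟨p, q, ?_⟩
    rw [map_div₀, ← aeval_algebraMap_apply, ← aeval_algebraMap_apply, hgen]
  obtain ⟨τ, hτ, hsep⟩ := exists_separating_element hxt halg
  obtain ⟨t, ht1, rfl⟩ : ∃ t : M, ‖t‖ ≤ 1 ∧ residue t = τ := exists_red_eq τ
  have ht1 : ‖t‖ = 1 := by
    refine le_antisymm ht1 (not_lt.mp fun h => hτ ?_)
    rw [(residue_eq_zero_iff ht1).mpr h]
    exact isAlgebraic_zero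
  have ht : ∀ c : k, 1 ≤ ‖t - algebraMap k M c‖ := (residue_notMem_range_iff ht1).mp
    fun ⟨c, hc⟩ => hτ (hc ▸ isAlgebraic_algebraMap c)
  refine ⟨t, ht1, ht, fun f => ?_⟩
  have hgt := isGaussGenerator_gen ht1 ht
  have hM : ∀ m : M, IsAlgebraic (Algebra.adjoin k {x}) m := fun m => IntermediateField.isAlgebraic_adjoin_iff.mp
    (Algebra.IsAlgebraic.isAlgebraic (R := IntermediateField.adjoin k {x}) m)
  have htrans : Transcendental k t := transcendental_of_notMem_range fun ⟨c, hc⟩ => by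
    have := ht c
    rw [hc, sub_self, norm_zero] at this
    exact absurd this (by norm_num)
  have : FiniteDimensional (IntermediateField.adjoin k {t}) M :=
    finiteDimensional_adjoin_simple hS fun z hz => isAlgebraic_adjoin_exchange (hM t) (hM z) htrans
  have : Algebra.IsSeparable (Residue (IntermediateField.adjoin k {t})) (Residue M) := by
    refine isSeparable_of_adjoin_le (κ := Residue k) (S := {residue t}) (fun c => ?_) ?_
    · rw [IsScalarTower.algebraMap_apply (Residue k) (Residue (IntermediateField.adjoin k {t}))]
      exact ⟨_, rfl⟩
    · rw [Set.singleton_subset_iff]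
      exact ⟨residue (IntermediateField.AdjoinSimple.gen k t), algebraMap_residue ht1.le⟩
  let _ : NormedAlgebra (IntermediateField.adjoin k {t}) W :=
    { (inferInstance : Algebra (IntermediateField.adjoin k {t}) W) with
      norm_smul_le := fun c y => ((congrArg norm (Algebra.smul_def c y)).trans <|
        (norm_mul _ y).trans (congrArg (· * ‖y‖) (norm_algebraMap' W (c : M)))).le }
  have : IsScalarTower (IntermediateField.adjoin k {t}) M W :=
    IsScalarTower.of_algebraMap_eq fun _ => rfl
  have : IsScalarTower k (IntermediateField.adjoin k {t}) W :=
    IsScalarTower.of_algebraMap_eq fun c => IsScalarTower.algebraMap_apply k M W c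
  exact coe_mem_goodElements_of_isSeparable hk hval hgt f

end Parameter

end AnalyticField
end

/-! ### Good parameters for pairs of dependent elements. -/

noncomputable section

namespace AnalyticField

open Polynomial UltraNorm

variable {W : Type*} [NormedField W] [IsUltrametricDist W] {k : Subfield W}

theorem isAlgebraic_adjoin_coe {k M W : Type*} [Field k] [Field M] [Field W] [Algebra k M]
    [Algebra M W] [Algebra k W] [IsScalarTower k M W] {x z : M}
    (h : IsAlgebraic (Algebra.adjoin k {algebraMap M W x}) (algebraMap M W z)) :
    IsAlgebraic (Algebra.adjoin k {x}) z := by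
  let e := (Algebra.adjoin k {x}).equivMapOfInjective (IsScalarTower.toAlgHom k M W)
    (algebraMap M W).injective
  have hm : Algebra.adjoin k {algebraMap M W x} =
      (Algebra.adjoin k {x}).map (IsScalarTower.toAlgHom k M W) := by
    rw [AlgHom.map_adjoin, Set.image_singleton]; rfl
  let e' := (Subalgebra.equivOfEq _ _ hm).trans e.symm
  have he' : ∀ c, algebraMap M W (e' c : M) = c := by
    intro c
    have : ((e (e' c) : _) : W) = c := by
      simp only [e', AlgEquiv.trans_apply, AlgEquiv.apply_symm_apply]
      rfl
    exact this
  obtain ⟨p, hp, hpz⟩ := h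
  refine ⟨p.map (e' : _ →+* Algebra.adjoin k {x}),
    (Polynomial.map_ne_zero_iff e'.injective).mpr hp, (algebraMap M W).injective ?_⟩
  rw [map_zero, ← hpz, aeval_def, aeval_def, eval₂_map, hom_eval₂]
  exact congrArg (fun f => eval₂ f _ p) (RingHom.ext he')

/-- Two algebraically dependent elements lie in a field of good elements, for `k` algebraically
closed, spherically complete and with all positive reals as values. -/
theorem exists_mem_goodElements_pair [IsAlgClosed k] (hk : SeqSphericallyComplete k)
    (hval : ∀ r : ℝ, 0 < r → ∃ c : k, ‖c‖ = r) {z₁ z₂ : W} (h₁ : z₁ ∉ k)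
    (h₂ : IsAlgebraic (Algebra.adjoin k {z₁}) z₂) :
    ∃ t : W, t ≠ 0 ∧ t ∉ k ∧ z₁ ∈ goodElements k t ∧ z₂ ∈ goodElements k t := by
  let M := IntermediateField.adjoin k {z₁, z₂}
  let Z₁ : M := ⟨z₁, IntermediateField.subset_adjoin _ _ (by simp)⟩
  let Z₂ : M := ⟨z₂, IntermediateField.subset_adjoin _ _ (by simp)⟩
  have : IsUltrametricDist M := IsUltrametricDist.isUltrametricDist_of_forall_norm_add_le_max_norm
    fun x y => IsUltrametricDist.norm_add_le_max (x : W) y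
  let _ : NormedAlgebra M W :=
    { (inferInstance : Algebra M W) with
      norm_smul_le := fun c x => (norm_mul (c : W) x).le }
  obtain ⟨a, b, hb, hx1, hx⟩ := exists_unit_distance hk hval h₁
  let x : M := b • (Z₁ - algebraMap k M a)
  have hxW : algebraMap M W x = b * (z₁ - a) := rfl
  have htop : IntermediateField.adjoin k {Z₁, Z₂} = ⊤ := by
    refine IntermediateField.lift_injective M ?_
    rw [IntermediateField.lift_adjoin, IntermediateField.lift_top, Set.image_pair]
  have halg : ∀ w : W, IsAlgebraic (Algebra.adjoin k {z₁}) w →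
      IsAlgebraic (Algebra.adjoin k {b * (z₁ - a)}) w := by
    intro w hw
    refine isAlgebraic_adjoin_of_le (E := IntermediateField.adjoin k {z₁}) (fun e => ?_)
      (IntermediateField.isAlgebraic_adjoin_iff.mpr hw)
    have hle : IntermediateField.adjoin k {z₁} ≤
        IntermediateField.adjoin k {(b : W) * (z₁ - a)} := by
      rw [IntermediateField.adjoin_simple_le_iff]
      have h1 : z₁ = algebraMap k W b⁻¹ * (b * (z₁ - a)) + algebraMap k W a := by
        have : (b : W) ≠ 0 := fun h => hb (Subtype.ext h)
        have h2 : algebraMap k W b⁻¹ = (b : W)⁻¹ := rfl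
        have h3 : algebraMap k W a = a := rfl
        rw [h2, h3, inv_mul_cancel_left₀ this, sub_add_cancel]
      have h4 := (IntermediateField.adjoin k {(b : W) * (z₁ - a)}).add_mem
        (mul_mem (IntermediateField.algebraMap_mem _ b⁻¹)
          (IntermediateField.mem_adjoin_simple_self k ((b : W) * (z₁ - a))))
        (IntermediateField.algebraMap_mem _ a)
      rwa [← h1] at h4
    exact hle e.2
  obtain ⟨t, ht1, ht, h⟩ := exists_forall_mem_goodElements (W := W) hk hval htop (x := x) hx1
    hx (fun z hz => by
      refine isAlgebraic_adjoin_coe (W := W) (halg _ ?_)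
      rcases hz with rfl | rfl
      · exact isAlgebraic_algebraMap (⟨z₁, Algebra.subset_adjoin rfl⟩ : Algebra.adjoin k {z₁})
      · exact h₂)
  refine ⟨t, ?_, ?_, h Z₁, h Z₂⟩
  · rintro h0
    have : ‖(t : W)‖ = 1 := ht1
    rw [h0, norm_zero] at this
    exact zero_ne_one this
  · intro htk
    have : (1 : ℝ) ≤ ‖(t : W) - t‖ := ht ⟨t, htk⟩
    rw [sub_self, norm_zero] at this
    exact absurd this (by norm_num)

end AnalyticField
end

/-! ### One-dimensional extensions of a trivially valued field. -/

noncomputable section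

namespace AnalyticField

open Polynomial UltraNorm

section Leading

variable {W : Type*} [NormedField W] [IsUltrametricDist W] {k : Subfield W} {s : W}

/-- `a` has leading term `c * s ^ n`. -/
def HasLeadingTerm (k : Subfield W) (s a : W) : Prop :=
  ∃ (n : ℤ) (c : W), c ∈ k ∧ c ≠ 0 ∧ ‖a - c * s ^ n‖ < ‖s‖ ^ n

theorem norm_eq_of_sub_lt {a b : W} (h : ‖a - b‖ < ‖b‖) : ‖a‖ = ‖b‖ := by
  have := IsUltrametricDist.norm_add_eq_max_of_norm_ne_norm h.ne
  rwa [sub_add_cancel, max_eq_right h.le] at this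

theorem norm_eq_of_leading (hk : ∀ c ∈ k, c ≠ 0 → ‖c‖ = 1) {n : ℤ} {a c : W} (hc : c ∈ k)
    (hc0 : c ≠ 0) (h : ‖a - c * s ^ n‖ < ‖s‖ ^ n) : ‖a‖ = ‖s‖ ^ n := by
  have h1 : ‖c * s ^ n‖ = ‖s‖ ^ n := by rw [norm_mul, hk c hc hc0, norm_zpow, one_mul]
  rw [← h1] at h ⊢
  exact norm_eq_of_sub_lt h

theorem HasLeadingTerm.norm_eq (hk : ∀ c ∈ k, c ≠ 0 → ‖c‖ = 1) {a : W}
    (h : HasLeadingTerm k s a) : ∃ n : ℤ, ‖a‖ = ‖s‖ ^ n :=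
  let ⟨n, _, hc, hc0, hn⟩ := h
  ⟨n, norm_eq_of_leading hk hc hc0 hn⟩

theorem HasLeadingTerm.mul (hk : ∀ c ∈ k, c ≠ 0 → ‖c‖ = 1) (hs : s ≠ 0) {a b : W}
    (ha : HasLeadingTerm k s a) (hb : HasLeadingTerm k s b) : HasLeadingTerm k s (a * b) := by
  obtain ⟨n, c, hc, hc0, hn⟩ := ha
  obtain ⟨m, d, hd, hd0, hm⟩ := hb
  have hpos := norm_pos_iff.mpr hs
  have hna := norm_eq_of_leading hk hc hc0 hn
  refine ⟨n + m, c * d, mul_mem hc hd, mul_ne_zero hc0 hd0, ?_⟩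
  have h1 : a * b - c * d * s ^ (n + m) = a * (b - d * s ^ m) + (a - c * s ^ n) * (d * s ^ m) := by
    rw [zpow_add₀ hs]; ring
  rw [h1, zpow_add₀ hpos.ne']
  refine (IsUltrametricDist.norm_add_le_max _ _).trans_lt (max_lt ?_ ?_)
  · rw [norm_mul, hna]
    exact mul_lt_mul_of_pos_left hm (zpow_pos hpos n)
  · rw [norm_mul, norm_mul, hk d hd hd0, one_mul, norm_zpow]
    exact mul_lt_mul_of_pos_right hn (zpow_pos hpos m)

theorem HasLeadingTerm.inv (hk : ∀ c ∈ k, c ≠ 0 → ‖c‖ = 1) (hs : s ≠ 0) {a : W}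
    (ha : HasLeadingTerm k s a) : HasLeadingTerm k s a⁻¹ := by
  obtain ⟨n, c, hc, hc0, hn⟩ := ha
  have hpos := norm_pos_iff.mpr hs
  have hna := norm_eq_of_leading hk hc hc0 hn
  have ha0 : a ≠ 0 := by
    rw [← norm_pos_iff, hna]; exact zpow_pos hpos n
  refine ⟨-n, c⁻¹, inv_mem hc, inv_ne_zero hc0, ?_⟩
  have hsn : s ^ n ≠ 0 := zpow_ne_zero n hs
  have h1 : a⁻¹ - c⁻¹ * s ^ (-n) = -(a - c * s ^ n) * (a⁻¹ * (c⁻¹ * (s ^ n)⁻¹)) := by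
    rw [zpow_neg]; field_simp; ring
  rw [h1, norm_mul, norm_neg, norm_mul, norm_mul, norm_inv, norm_inv, norm_inv, norm_zpow, hna,
    hk c hc hc0, inv_one, one_mul, zpow_neg]
  have h2 := zpow_pos hpos n
  calc _ < ‖s‖ ^ n * ((‖s‖ ^ n)⁻¹ * (‖s‖ ^ n)⁻¹) :=
        mul_lt_mul_of_pos_right hn (by positivity)
    _ = _ := by rw [← mul_assoc, mul_inv_cancel₀ h2.ne', one_mul]

omit [IsUltrametricDist W] in
theorem norm_le_one_of_mem (hk : ∀ c ∈ k, c ≠ 0 → ‖c‖ = 1) (c : k) : ‖(c : W)‖ ≤ 1 := by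
  by_cases h : (c : W) = 0
  · rw [h, norm_zero]; exact zero_le_one
  · exact (hk c c.2 h).le

/-- With trivially valued coefficients and `‖s‖ < 1`, the monomial of lowest degree strictly
dominates all others. -/
theorem hasLeadingTerm_aeval (hk : ∀ c ∈ k, c ≠ 0 → ‖c‖ = 1) (hs : s ≠ 0) (hs1 : ‖s‖ < 1)
    {p : k[X]} (hp : aeval s p ≠ 0) : HasLeadingTerm k s (aeval s p) := by
  have hp0 : p ≠ 0 := by rintro rfl; exact hp (map_zero _)
  obtain ⟨q, hq, hq0⟩ : ∃ q : k[X], p = X ^ p.natTrailingDegree * q ∧ q.coeff 0 ≠ 0 := by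
    obtain ⟨q, hq⟩ := X_pow_dvd_iff.mpr
      (fun d (hd : d < p.natTrailingDegree) => coeff_eq_zero_of_lt_natTrailingDegree hd)
    refine ⟨q, hq, ?_⟩
    have h1 : p.coeff p.natTrailingDegree ≠ 0 := trailingCoeff_nonzero_iff_nonzero.mpr hp0
    generalize p.natTrailingDegree = n at *
    rw [hq] at h1
    simpa [coeff_X_pow_mul'] using h1
  rw [hq, map_mul, map_pow, aeval_X]
  refine HasLeadingTerm.mul hk hs ⟨p.natTrailingDegree, 1, one_mem _, one_ne_zero, ?_⟩
    ⟨0, q.coeff 0, (q.coeff 0).2, fun h => hq0 (Subtype.ext h), ?_⟩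
  · rw [one_mul, zpow_natCast, sub_self, norm_zero]
    exact zpow_pos (norm_pos_iff.mpr hs) _
  · have h1 : aeval s q - (q.coeff 0 : W) * s ^ (0 : ℤ) = s * aeval s q.divX := by
      have h2 : aeval s q = s * aeval s q.divX + (q.coeff 0 : W) := by
        conv_lhs => rw [← divX_mul_X_add q]
        rw [map_add, map_mul, aeval_X, aeval_C, mul_comm]
        rfl
      rw [h2, zpow_zero, mul_one, add_sub_cancel_right]
    rw [h1, zpow_zero, norm_mul]
    refine (mul_le_of_le_one_right (norm_nonneg _) ?_).trans_lt hs1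
    exact norm_aeval_le hs1.le zero_le_one fun i => norm_le_one_of_mem hk _

theorem hasLeadingTerm_of_mem (hk : ∀ c ∈ k, c ≠ 0 → ‖c‖ = 1) (hs : s ≠ 0) (hs1 : ‖s‖ < 1)
    {a : W} (ha : a ∈ IntermediateField.adjoin k {s}) (ha0 : a ≠ 0) : HasLeadingTerm k s a := by
  obtain ⟨p, q, rfl⟩ := (IntermediateField.mem_adjoin_simple_iff _ _).mp ha
  rw [div_eq_mul_inv] at ha0 ⊢
  exact (hasLeadingTerm_aeval hk hs hs1 (left_ne_zero_of_mul ha0)).mul hk hs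
    ((hasLeadingTerm_aeval hk hs hs1 (fun h => right_ne_zero_of_mul ha0 (by rw [h, inv_zero]))).inv hk hs)

theorem exists_residue_of_mem (hk : ∀ c ∈ k, c ≠ 0 → ‖c‖ = 1) (hs : s ≠ 0) (hs1 : ‖s‖ < 1)
    {a : W} (ha : a ∈ IntermediateField.adjoin k {s}) (ha1 : ‖a‖ ≤ 1) :
    ∃ c : k, ‖a - c‖ < 1 := by
  rcases ha1.lt_or_eq with h | h
  · exact ⟨0, by simpa using h⟩
  · obtain ⟨n, c, hc, hc0, hn⟩ := hasLeadingTerm_of_mem hk hs hs1 ha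
      (by rintro rfl; simp at h)
    have h1 := norm_eq_of_leading hk hc hc0 hn
    rw [h] at h1
    have hpos := norm_pos_iff.mpr hs
    have hn0 : n = 0 := by
      by_contra hne
      rcases lt_or_gt_of_ne hne with h2 | h2
      · exact (one_lt_zpow_of_neg₀ hpos hs1 h2).ne h1
      · exact (zpow_lt_one₀ hpos hs1 h2).ne h1.symm
    subst hn0
    exact ⟨⟨c, hc⟩, by simpa using hn⟩

/-- A nonzero relation of degree at most `D`. -/
def HasRelation (E : Set W) (D : ℕ) (f : W) : Prop :=
  ∃ c : ℕ → W, (∀ i, c i ∈ E) ∧ (∃ i ∈ Finset.range (D + 1), c i ≠ 0) ∧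
    ∑ i ∈ Finset.range (D + 1), c i * f ^ i = 0

/-- In a vanishing ultrametric sum two different terms attain the largest norm. Comparing them
expresses a power of `‖f‖` with exponent at most `D` by the norms of coefficients, which are powers
of `‖s‖`. -/
theorem exists_pow_norm_eq (hk : ∀ c ∈ k, c ≠ 0 → ‖c‖ = 1) (hs : s ≠ 0) (hs1 : ‖s‖ < 1) {D : ℕ}
    {f : W} (hf : HasRelation (IntermediateField.adjoin k {s} : Set W) D f) (hf0 : f ≠ 0) :
    ∃ j : ℕ, 1 ≤ j ∧ j ≤ D ∧ ∃ n : ℤ, ‖f‖ ^ j = ‖s‖ ^ n := by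
  obtain ⟨c, hc, ⟨i₀, hi₀, hci₀⟩, hsum⟩ := hf
  obtain ⟨i, hi, hmax⟩ := (Finset.range (D + 1)).exists_max_image (fun i => ‖c i * f ^ i‖) ⟨i₀, hi₀⟩
  have hpos : 0 < ‖c i * f ^ i‖ :=
    (norm_pos_iff.mpr (mul_ne_zero hci₀ (pow_ne_zero _ hf0))).trans_le (hmax i₀ hi₀)
  obtain ⟨j, hj, hij⟩ : ∃ j ∈ (Finset.range (D + 1)).erase i, ‖c i * f ^ i‖ ≤ ‖c j * f ^ j‖ := by
    by_contra! h
    rw [← Finset.add_sum_erase _ _ hi] at hsum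
    have h1 : ‖∑ j ∈ (Finset.range (D + 1)).erase i, c j * f ^ j‖ < ‖c i * f ^ i‖ := by
      rcases ((Finset.range (D + 1)).erase i).eq_empty_or_nonempty with he | hne
      · rw [he, Finset.sum_empty, norm_zero]; exact hpos
      · obtain ⟨l, hl, hle⟩ := IsUltrametricDist.exists_norm_finsetSum_le_of_nonempty hne
          fun j => c j * f ^ j
        exact hle.trans_lt (h l hl)
    rw [← neg_eq_of_add_eq_zero_right hsum, norm_neg] at h1
    exact lt_irrefl _ h1
  have hjr := Finset.mem_of_mem_erase hj
  have heq : ‖c j * f ^ j‖ = ‖c i * f ^ i‖ := le_antisymm (hmax j hjr) hij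
  have hcz : ∀ l, ‖c l * f ^ l‖ = ‖c i * f ^ i‖ → ∃ n : ℤ, ‖c l‖ = ‖s‖ ^ n := fun l hl => by
    refine (hasLeadingTerm_of_mem hk hs hs1 (hc l) ?_).norm_eq hk
    intro h0
    rw [h0, zero_mul, norm_zero] at hl
    exact hpos.ne hl
  have key : ∀ a b, a < b → b ≤ D → ‖c a * f ^ a‖ = ‖c i * f ^ i‖ →
      ‖c b * f ^ b‖ = ‖c i * f ^ i‖ → ∃ j : ℕ, 1 ≤ j ∧ j ≤ D ∧ ∃ n : ℤ, ‖f‖ ^ j = ‖s‖ ^ n := by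
    intro a b hab hb ha' hb'
    obtain ⟨n, hn⟩ := hcz a ha'
    obtain ⟨m, hm⟩ := hcz b hb'
    refine ⟨b - a, by omega, by omega, n - m, ?_⟩
    have h2 : ‖c a * f ^ a‖ = ‖c b * f ^ b‖ := ha'.trans hb'.symm
    have hs0 := (norm_pos_iff.mpr hs).ne'
    have hf0' := (norm_pos_iff.mpr hf0).ne'
    rw [norm_mul, norm_mul, hn, hm, norm_pow, norm_pow, show b = a + (b - a) by omega,
      pow_add, mul_left_comm, mul_comm] at h2
    rw [zpow_sub₀ hs0, eq_div_iff (zpow_ne_zero m hs0), mul_comm]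
    exact (mul_left_cancel₀ (pow_ne_zero a hf0') h2).symm
  have hne : i ≠ j := (Finset.ne_of_mem_erase hj).symm
  have hiD := Finset.mem_range.mp hi
  have hjD := Finset.mem_range.mp hjr
  rcases lt_or_gt_of_ne hne with h | h
  · exact key i j h (by omega) rfl heq
  · exact key j i h (by omega) heq rfl

/-- Divide the relation by its largest coefficient and replace each coefficient by its residue in
`k`. The resulting nonzero polynomial over `k` is less than one at `f`, so one of its linear factors
is too. -/
theorem exists_residue_of_relation [IsAlgClosed k] (hk : ∀ c ∈ k, c ≠ 0 → ‖c‖ = 1) (hs : s ≠ 0)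
    (hs1 : ‖s‖ < 1) {D : ℕ} {f : W}
    (hf : HasRelation (IntermediateField.adjoin k {s} : Set W) D f) (hf1 : ‖f‖ = 1) :
    ∃ c : k, ‖f - c‖ < 1 := by
  obtain ⟨c, hc, ⟨i₀, hi₀, hci₀⟩, hsum⟩ := hf
  obtain ⟨i, hi, hmax⟩ := (Finset.range (D + 1)).exists_max_image (fun i => ‖c i‖) ⟨i₀, hi₀⟩
  have hpos : 0 < ‖c i‖ := (norm_pos_iff.mpr hci₀).trans_le (hmax i₀ hi₀)
  have hb1 : ∀ j ∈ Finset.range (D + 1), ‖c j * (c i)⁻¹‖ ≤ 1 := fun j hj => by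
    rw [norm_mul, norm_inv, ← div_eq_mul_inv, div_le_one hpos]
    exact hmax j hj
  have hex : ∀ j, ∃ e : k, j ∈ Finset.range (D + 1) → ‖c j * (c i)⁻¹ - e‖ < 1 := fun j => by
    by_cases hj : j ∈ Finset.range (D + 1)
    · obtain ⟨e, he⟩ := exists_residue_of_mem hk hs hs1
        (mul_mem (hc j) (inv_mem (hc i))) (hb1 j hj)
      exact ⟨e, fun _ => he⟩
    · exact ⟨0, fun h => absurd h hj⟩
  choose e he using hex
  set P : k[X] := ∑ j ∈ Finset.range (D + 1), C (e j) * X ^ j with hP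
  have hP0 : P ≠ 0 := by
    intro h
    have h1 : P.coeff i = e i := by
      rw [hP, finsetSum_coeff, Finset.sum_eq_single i]
      · simp
      · intro j _ hj; simp [coeff_X_pow, hj.symm]
      · exact fun h => absurd hi h
    rw [h, coeff_zero] at h1
    have h2 := he i hi
    rw [← h1, mul_inv_cancel₀ (norm_pos_iff.mp hpos)] at h2
    simp at h2
  have hPf : ‖aeval f P‖ < 1 := by
    have h1 : aeval f P = -∑ j ∈ Finset.range (D + 1), (c j * (c i)⁻¹ - e j) * f ^ j := by
      have h2 : ∑ j ∈ Finset.range (D + 1), c j * (c i)⁻¹ * f ^ j = 0 := by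
        rw [← zero_mul (c i)⁻¹, ← hsum, Finset.sum_mul]
        exact Finset.sum_congr rfl fun j _ => by ring
      simp only [sub_mul, Finset.sum_sub_distrib, h2, zero_sub, neg_neg]
      rw [hP, map_sum]
      refine Finset.sum_congr rfl fun j _ => ?_
      rw [map_mul, map_pow, aeval_X, aeval_C]
      rfl
    rw [h1, norm_neg]
    obtain ⟨l, hl, hle⟩ := IsUltrametricDist.exists_norm_finsetSum_le_of_nonempty
      (⟨i, hi⟩ : (Finset.range (D + 1)).Nonempty) fun j => (c j * (c i)⁻¹ - e j) * f ^ j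
    refine hle.trans_lt ?_
    rw [norm_mul, norm_pow, hf1, one_pow, mul_one]
    exact he l hl
  by_contra! hfar
  have h := (IsAlgClosed.splits P).eq_prod_roots
  have hl : ‖(P.leadingCoeff : W)‖ = 1 :=
    hk _ (P.leadingCoeff).2 fun h => hP0 (leadingCoeff_eq_zero.mp (Subtype.ext h))
  generalize P.leadingCoeff = l at h hl
  generalize P.roots = m at h
  rw [h, map_mul, aeval_C, norm_mul] at hPf
  have hl' : ‖algebraMap k W l‖ = 1 := hl
  rw [hl', one_mul] at hPf
  refine not_le.mpr hPf ?_
  clear h hPf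
  induction m using Multiset.induction_on with
  | empty => simp
  | cons a m ih =>
    rw [Multiset.map_cons, Multiset.prod_cons, map_mul, norm_mul, map_sub, aeval_X, aeval_C]
    exact one_le_mul_of_one_le_of_one_le (hfar a) ih

/-- By `exists_pow_norm_eq` every norm in `[‖s‖, 1)` is a `j`th root of `‖s‖ ^ n` with `n ≤ j ≤ D`.
There are finitely many of them, and the largest is attained. -/
theorem exists_uniformizer (hk : ∀ c ∈ k, c ≠ 0 → ‖c‖ = 1) (hs : s ≠ 0) (hs1 : ‖s‖ < 1) {D : ℕ}
    {M : Set W} (hsM : s ∈ M)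
    (hM : ∀ f ∈ M, HasRelation (IntermediateField.adjoin k {s} : Set W) D f) :
    ∃ t ∈ M, t ≠ 0 ∧ ‖t‖ < 1 ∧ ∀ f ∈ M, ‖f‖ < 1 → ‖f‖ ≤ ‖t‖ := by
  have hpos := norm_pos_iff.mpr hs
  have hfin : {r : ℝ | ∃ f ∈ M, ‖s‖ ≤ ‖f‖ ∧ ‖f‖ < 1 ∧ ‖f‖ = r}.Finite := by
    refine Set.Finite.subset ((Finset.range (D + 1) ×ˢ Finset.range (D + 1)).image
      fun p : ℕ × ℕ => (‖s‖ ^ p.1) ^ ((p.2 : ℝ)⁻¹)).finite_toSet ?_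
    rintro r ⟨f, hf, hsf, hf1, rfl⟩
    obtain ⟨j, hj1, hjD, n, hn⟩ := exists_pow_norm_eq hk hs hs1 (hM f hf)
      (norm_pos_iff.mp (hpos.trans_le hsf))
    have hn0 : 0 ≤ n := by
      by_contra! h
      have h1 := one_lt_zpow_of_neg₀ hpos hs1 h
      rw [← hn] at h1
      exact not_le.mpr h1 (pow_le_one₀ (norm_nonneg _) hf1.le)
    lift n to ℕ using hn0
    rw [zpow_natCast] at hn
    have hnj : n ≤ j := by
      have h1 : ‖s‖ ^ j ≤ ‖s‖ ^ n := hn ▸ pow_le_pow_left₀ hpos.le hsf j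
      exact (pow_le_pow_iff_right_of_lt_one₀ hpos hs1).mp h1
    simp only [Finset.coe_image, Set.mem_image, Finset.mem_coe, Finset.mem_product,
      Finset.mem_range, Prod.exists]
    refine ⟨n, j, ⟨by omega, by omega⟩, ?_⟩
    rw [← hn]
    exact Real.pow_rpow_inv_natCast (norm_nonneg _) (by omega)
  obtain ⟨r, ⟨t, htM, hst, ht1, rfl⟩, hmax⟩ := hfin.exists_maximal ⟨‖s‖, s, hsM, le_rfl, hs1, rfl⟩
  refine ⟨t, htM, norm_pos_iff.mp (hpos.trans_le hst), ht1, fun f hf hf1 => ?_⟩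
  by_contra! h
  exact not_le.mpr h (hmax ⟨f, hf, hst.trans h.le, hf1, rfl⟩ h.le)

omit [IsUltrametricDist W] in
/-- Successive approximation by Laurent polynomials in a uniformizer. -/
theorem exists_approx_of_uniformizer {M : IntermediateField k W} {t : W} (htM : t ∈ M) (ht : t ≠ 0) (ht1 : ‖t‖ < 1)
    (hmax : ∀ f ∈ M, ‖f‖ < 1 → ‖f‖ ≤ ‖t‖) (hres : ∀ f ∈ M, ‖f‖ = 1 → ∃ c : k, ‖f - c‖ < 1)
    {A : Subring W} (hA : ∀ c : k, (c : W) ∈ A) (htA : t ∈ A) (htA' : t⁻¹ ∈ A) {f : W}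
    (hf : f ∈ M) {ε : ℝ} (hε : 0 < ε) : ∃ g ∈ A, g ∈ M ∧ ‖f - g‖ ≤ ε := by
  have hpos := norm_pos_iff.mpr ht
  have hzA : ∀ n : ℤ, t ^ n ∈ A := fun n => by
    rcases n with n | n
    · simpa using pow_mem htA n
    · rw [zpow_negSucc, ← inv_pow]; exact pow_mem htA' _
  have hkM : ∀ c : k, (c : W) ∈ M := fun c => M.algebraMap_mem c
  have hstep : ∀ f ∈ M, ∃ g ∈ A, g ∈ M ∧ ‖f - g‖ ≤ ‖t‖ * ‖f‖ := by
    intro f hf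
    by_cases hf0 : f = 0
    · exact ⟨0, zero_mem _, zero_mem _, by simp [hf0]⟩
    obtain ⟨n, hn, hn'⟩ := exists_mem_Ioc_zpow (norm_pos_iff.mpr hf0) (one_lt_inv₀ hpos |>.mpr ht1)
    set m : ℤ := -(n + 1) with hm
    have hfm : ‖f * t ^ (-m)‖ = ‖f‖ * ‖t‖ ^ (n + 1) := by
      rw [norm_mul, norm_zpow, hm, neg_neg]
    have hM : f * t ^ (-m) ∈ M := mul_mem hf (zpow_mem htM _)
    have hz := zpow_pos hpos (n + 1)
    rw [inv_zpow'] at hn hn'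
    have h1 : ‖f * t ^ (-m)‖ = 1 := by
      refine le_antisymm ?_ (not_lt.mp fun hlt => ?_)
      · rw [hfm]
        refine (mul_le_mul_of_nonneg_right hn' hz.le).trans (le_of_eq ?_)
        rw [← zpow_add₀ hpos.ne', neg_add_cancel, zpow_zero]
      · have h2 := hmax _ hM hlt
        rw [hfm, zpow_add₀ hpos.ne', zpow_one, ← mul_assoc] at h2
        have h3 := le_of_mul_le_mul_right (h2.trans_eq (one_mul _).symm) hpos
        have h4 := mul_lt_mul_of_pos_right hn (zpow_pos hpos n)
        rw [← zpow_add₀ hpos.ne', neg_add_cancel, zpow_zero] at h4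
        exact not_le.mpr h4 h3
    obtain ⟨c, hc⟩ := hres _ hM h1
    have htm : t ^ (-m) * t ^ m = 1 := by rw [← zpow_add₀ ht, neg_add_cancel, zpow_zero]
    refine ⟨c * t ^ m, mul_mem (hA c) (hzA m), mul_mem (hkM c) (zpow_mem htM _), ?_⟩
    have h5 : f - c * t ^ m = (f * t ^ (-m) - c) * t ^ m := by
      rw [sub_mul, mul_assoc, htm, mul_one]
    have h6 : ‖f‖ = ‖t ^ m‖ := by
      have : ‖f * t ^ (-m) * t ^ m‖ = ‖f‖ := by rw [mul_assoc, htm, mul_one]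
      rw [← this, norm_mul, h1, one_mul]
    rw [h5, norm_mul, h6]
    exact mul_le_mul_of_nonneg_right (hmax _ (sub_mem hM (hkM c)) hc) (norm_nonneg _)
  have hiter : ∀ N : ℕ, ∃ g ∈ A, g ∈ M ∧ ‖f - g‖ ≤ ‖t‖ ^ N * ‖f‖ := by
    intro N
    induction N with
    | zero => exact ⟨0, zero_mem _, zero_mem _, by simp⟩
    | succ N ih =>
      obtain ⟨g, hgA, hgM, hg⟩ := ih
      obtain ⟨g', hgA', hgM', hg'⟩ := hstep _ (sub_mem hf hgM)
      refine ⟨g + g', add_mem hgA hgA', add_mem hgM hgM', ?_⟩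
      rw [← sub_sub, pow_succ', mul_assoc]
      exact hg'.trans (mul_le_mul_of_nonneg_left hg hpos.le)
  have hlim := (tendsto_pow_atTop_nhds_zero_of_lt_one hpos.le ht1).mul_const ‖f‖
  rw [zero_mul] at hlim
  obtain ⟨N, hN⟩ := (hlim.eventually (gt_mem_nhds hε)).exists
  obtain ⟨g, hgA, hgM, hg⟩ := hiter N
  exact ⟨g, hgA, hgM, hg.trans hN.le⟩

theorem norm_eq_one_of_isAlgebraic {E : Subfield W} (hE : ∀ c ∈ E, c ≠ 0 → ‖c‖ = 1) {a : W}
    (ha : IsAlgebraic E a) (ha0 : a ≠ 0) : ‖a‖ = 1 := by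
  have hle : ∀ b : W, IsAlgebraic E b → b ≠ 0 → ‖b‖ ≤ 1 := by
    intro b hb hb0
    by_contra! h
    have hint := hb.isIntegral
    have hmon := minpoly.monic hint
    have h0 := minpoly.aeval E b
    rw [aeval_eq_sum_range, Finset.sum_range_succ, hmon.coeff_natDegree, one_smul] at h0
    have hn := minpoly.natDegree_pos hint
    have h1 : ‖b ^ (minpoly E b).natDegree‖ ≤ ‖b‖ ^ ((minpoly E b).natDegree - 1) := by
      rw [← neg_eq_of_add_eq_zero_right h0, norm_neg]
      refine (ofField W).sum_le _ _ (by positivity) fun i hi => ?_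
      rw [ofField_apply, norm_smul, norm_pow]
      have h2 : ‖b‖ ^ i ≤ ‖b‖ ^ ((minpoly E b).natDegree - 1) :=
        pow_le_pow_right₀ h.le (by have := Finset.mem_range.mp hi; omega)
      refine (mul_le_of_le_one_left (by positivity) ?_).trans h2
      exact norm_le_one_of_mem hE _
    rw [norm_pow] at h1
    have := (pow_lt_pow_iff_right₀ h).mpr (by omega : (minpoly E b).natDegree - 1 < (minpoly E b).natDegree)
    exact not_le.mpr this h1
  refine le_antisymm (hle a ha ha0) ?_
  have h1 := hle a⁻¹ ha.inv (inv_ne_zero ha0)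
  rw [norm_inv] at h1
  exact (inv_le_one₀ (norm_pos_iff.mpr ha0)).mp h1

omit [IsUltrametricDist W] in
theorem hasRelation_of_finite (E : Type*) {M : Type*} [Field E] [Field M] [Algebra E M]
    [Algebra M W] [Algebra E W] [IsScalarTower E M W] [FiniteDimensional E M] (f : M) :
    HasRelation (Set.range (algebraMap E W)) (Module.finrank E M) (algebraMap M W f) := by
  have hint : IsIntegral E f := (Algebra.IsIntegral.of_finite E M).isIntegral f
  have hdeg := minpoly.natDegree_le (A := E) f
  refine ⟨fun i => algebraMap E W ((minpoly E f).coeff i), fun i => ⟨_, rfl⟩,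
    ⟨(minpoly E f).natDegree, Finset.mem_range.mpr (by omega), ?_⟩, ?_⟩
  · dsimp only
    rw [(minpoly.monic hint).coeff_natDegree, map_one]
    exact one_ne_zero
  · have h0 := congrArg (algebraMap M W) (minpoly.aeval E f)
    rw [aeval_eq_sum_range' (Nat.lt_succ_of_le hdeg), map_zero, map_sum] at h0
    rw [← h0]
    refine Finset.sum_congr rfl fun i _ => ?_
    rw [Algebra.smul_def, map_mul, map_pow, ← IsScalarTower.algebraMap_apply]

omit [IsUltrametricDist W] in
theorem exists_hasRelation {S : Set W} [Finite S] (E : IntermediateField k W)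
    (hS : ∀ z ∈ S, IsAlgebraic E z) : ∃ (D : ℕ) (M : IntermediateField k W), E ≤ M ∧ S ⊆ M ∧
      ∀ f ∈ M, HasRelation (E : Set W) D f ∧ IsAlgebraic E f := by
  have hfin : FiniteDimensional E (IntermediateField.adjoin E S) :=
    IntermediateField.finiteDimensional_adjoin fun z hz => (hS z hz).isIntegral
  refine ⟨Module.finrank E (IntermediateField.adjoin E S),
    (IntermediateField.adjoin E S).restrictScalars k,
    fun c hc => (IntermediateField.adjoin E S).algebraMap_mem ⟨c, hc⟩,
    IntermediateField.subset_adjoin E S, fun f hf => ?_⟩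
  obtain ⟨c, hc, h⟩ := hasRelation_of_finite (W := W) E (⟨f, hf⟩ : IntermediateField.adjoin E S)
  refine ⟨⟨c, fun i => by obtain ⟨e, he⟩ := hc i; exact he ▸ e.2, h⟩, ?_⟩
  exact (((Algebra.IsIntegral.of_finite E _).isIntegral
    (⟨f, hf⟩ : IntermediateField.adjoin E S)).isAlgebraic).algebraMap (A := W)

/-- Over a trivially valued algebraically closed field, two elements of a one-dimensional
extension which is not trivially valued are approximated by good elements. -/
theorem exists_mem_goodElements_near [IsAlgClosed k] (hk : ∀ c ∈ k, c ≠ 0 → ‖c‖ = 1) {x z₁ z₂ : W}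
    (hx : ∃ u : W, IsAlgebraic (Algebra.adjoin k {x}) u ∧ u ≠ 0 ∧ ‖u‖ ≠ 1)
    (hz₁ : IsAlgebraic (Algebra.adjoin k {x}) z₁) (hz₂ : IsAlgebraic (Algebra.adjoin k {x}) z₂)
    (hz₁k : z₁ ∉ k) {ε : ℝ} (hε : 0 < ε) :
    ∃ s t f₁ f₂ : W, t ≠ 0 ∧ t ∉ k ∧ f₁ ∈ goodElements k t ∧ f₂ ∈ goodElements k t ∧
      ‖z₁ - f₁‖ ≤ ε ∧ ‖z₂ - f₂‖ ≤ ε ∧ IsAlgebraic (Algebra.adjoin k {s}) f₁ ∧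
      IsAlgebraic (Algebra.adjoin k {s}) f₂ := by
  have htr : ∀ z, z ∉ k → Transcendental k z := fun z hz =>
    transcendental_of_notMem_range fun ⟨c, hc⟩ => hz (hc ▸ c.2)
  -- If `k(z₁)` were trivially valued, so would be everything algebraic over it. By exchange this
  -- includes `u`.
  obtain ⟨s, hs, hsz, hs1⟩ : ∃ s : W, s ≠ 0 ∧ s ∈ IntermediateField.adjoin k {z₁} ∧ ‖s‖ < 1 := by
    by_contra! hno
    obtain ⟨u, hu, hu0, hu1⟩ := hx
    refine hu1 (norm_eq_one_of_isAlgebraic (E := (IntermediateField.adjoin k {z₁}).toSubfield)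
      (fun c hc hc0 => le_antisymm ?_ (hno c hc0 hc)) ?_ hu0)
    · have := hno c⁻¹ (inv_ne_zero hc0) (inv_mem hc)
      rw [norm_inv] at this
      exact (one_le_inv₀ (norm_pos_iff.mpr hc0)).mp this
    · exact IntermediateField.isAlgebraic_adjoin_iff.mpr
        (isAlgebraic_adjoin_exchange hz₁ hu (htr z₁ hz₁k))
  have hsk : s ∉ k := fun h => hs1.ne (hk s h hs)
  have hsalg : IsAlgebraic (Algebra.adjoin k {z₁}) s :=
    IntermediateField.isAlgebraic_adjoin_iff.mp
      (isAlgebraic_algebraMap (⟨s, hsz⟩ : IntermediateField.adjoin k {z₁}))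
  have hz₁' : IsAlgebraic (Algebra.adjoin k {z₁}) z₁ :=
    isAlgebraic_algebraMap (⟨z₁, Algebra.subset_adjoin rfl⟩ : Algebra.adjoin k {z₁})
  have hz₂' := isAlgebraic_adjoin_exchange hz₁ hz₂ (htr z₁ hz₁k)
  obtain ⟨D, M, hEM, hzM, hrel⟩ := exists_hasRelation (S := {z₁, z₂})
    (IntermediateField.adjoin k {s}) fun z hz => by
      rw [IntermediateField.isAlgebraic_adjoin_iff]
      rcases hz with rfl | rfl
      · exact isAlgebraic_adjoin_exchange hsalg hz₁' (htr s hsk)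
      · exact isAlgebraic_adjoin_exchange hsalg hz₂' (htr s hsk)
  have hsM : s ∈ M := hEM (IntermediateField.mem_adjoin_simple_self k s)
  have hzM₁ : z₁ ∈ M := hzM (by simp)
  have hzM₂ : z₂ ∈ M := hzM (by simp)
  obtain ⟨t, htM, ht, ht1, hmax⟩ := exists_uniformizer hk hs hs1 hsM fun f hf => (hrel f hf).1
  have htA : t ∈ goodElements k t := self_mem_goodElements k t
  have htA' : t⁻¹ ∈ goodElements k t := by
    have := inv_sub_mem_goodElements k ht (c := 0) (by simp)
    simpa using this
  have happ : ∀ z ∈ M, ∃ g ∈ goodElements k t, g ∈ M ∧ ‖z - g‖ ≤ ε := fun z hz =>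
    exists_approx_of_uniformizer htM ht ht1 hmax
      (fun f hf hf1 => exists_residue_of_relation hk hs hs1 (hrel f hf).1 hf1)
      (coe_mem_goodElements k t) htA htA' hz hε
  obtain ⟨f₁, hf₁, hM₁, h₁⟩ := happ z₁ hzM₁
  obtain ⟨f₂, hf₂, hM₂, h₂⟩ := happ z₂ hzM₂
  exact ⟨s, t, f₁, f₂, ht, fun h => ht1.ne (hk t h ht), hf₁, hf₂, h₁, h₂,
    IntermediateField.isAlgebraic_adjoin_iff.mp (hrel f₁ hM₁).2,
    IntermediateField.isAlgebraic_adjoin_iff.mp (hrel f₂ hM₂).2⟩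

end Leading

end AnalyticField
end

/-! ### Approximate exchange through good pairs. -/

noncomputable section

namespace AnalyticField

open Polynomial

section NearPair

variable {W : Type*} [NormedField W] {k : Subfield W}

theorem exists_evalXY_eq_zero {z₁ z₂ : W} (h : IsAlgebraic (Algebra.adjoin k {z₁}) z₂) :
    ∃ R : k[X][X], R ≠ 0 ∧ evalXY z₁ z₂ R = 0 := by
  obtain ⟨p, hp, hpz⟩ := h
  have hlift : ∀ c : Algebra.adjoin k {z₁}, ∃ q : k[X], aeval z₁ q = (c : W) := fun c => by
    exact (Algebra.adjoin_singleton_eq_range_aeval k z₁).le c.2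
  choose q hq using hlift
  set R : k[X][X] := ∑ i ∈ Finset.range (p.natDegree + 1), C (q (p.coeff i)) * X ^ i with hR
  refine ⟨R, fun h0 => hp ?_, ?_⟩
  · have h1 : R.coeff p.natDegree = q p.leadingCoeff := by
      rw [hR, finsetSum_coeff, Finset.sum_eq_single p.natDegree]
      · simp
      · intro j _ hj; simp [coeff_X_pow, hj.symm]
      · intro h; simp at h
    rw [h0, coeff_zero] at h1
    have h2 := hq p.leadingCoeff
    rw [← h1, map_zero] at h2
    exact leadingCoeff_eq_zero.mp (Subtype.ext h2.symm)
  · rw [← hpz, hR, map_sum, aeval_eq_sum_range]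
    refine Finset.sum_congr rfl fun i _ => ?_
    rw [map_mul, map_pow, Algebra.smul_def]
    simp only [evalXY, coe_eval₂RingHom, eval₂_C, eval₂_X]
    exact congrArg (· * z₂ ^ i) (hq (p.coeff i))

theorem isAlgebraic_of_evalXY_eq_zero [IsAlgClosed k] {y α : W} (hy : y ∉ k) {R : k[X][X]}
    (hR : R ≠ 0) (h : evalXY y α R = 0) : IsAlgebraic (Algebra.adjoin k {y}) α := by
  let f : k[X] →+* Algebra.adjoin k {y} :=
    (aeval (⟨y, Algebra.subset_adjoin rfl⟩ : Algebra.adjoin k {y}) : k[X] →ₐ[k] _)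
  have hf : ∀ q, algebraMap (Algebra.adjoin k {y}) W (f q) = aeval y q := fun q =>
    (aeval_algebraMap_apply W (⟨y, Algebra.subset_adjoin rfl⟩ : Algebra.adjoin k {y}) q).symm
  have htr : Transcendental k y := transcendental_of_notMem_range fun ⟨c, hc⟩ => hy (hc ▸ c.2)
  have hinj : Function.Injective f := by
    rw [injective_iff_map_eq_zero]
    intro q hq
    refine (transcendental_iff.mp htr) q ?_
    rw [← hf, hq, map_zero]
  refine ⟨R.map f, (Polynomial.map_ne_zero_iff hinj).mpr hR, ?_⟩
  rw [← h, evalXY_eq_eval_map, aeval_def, eval₂_map, eval_map]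
  exact congrArg (fun g => eval₂ g α R) (RingHom.ext hf)

/-- One of `y₁`, `y₂` is within `ε` of an element algebraic over `k` and the other one. -/
def NearOrNear (k : Subfield W) (y₁ y₂ : W) (ε : ℝ) : Prop :=
  (∃ α, IsAlgebraic (Algebra.adjoin k {y₁}) α ∧ ‖α - y₂‖ ≤ ε) ∨
    ∃ α, IsAlgebraic (Algebra.adjoin k {y₂}) α ∧ ‖α - y₁‖ ≤ ε

theorem nearOrNear_of_mem {y₁ y₂ z : W} {ε : ℝ} (hz : z ∈ k) (h : ‖y₁ - z‖ ≤ ε) :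
    NearOrNear k y₁ y₂ ε :=
  Or.inr ⟨z, isAlgebraic_algebraMap (⟨z, Subalgebra.algebraMap_mem _ (⟨z, hz⟩ : k)⟩ :
    Algebra.adjoin k {y₂}), by rwa [norm_sub_rev]⟩

variable [IsUltrametricDist W] [IsAlgClosed W] [IsAlgClosed k]

/-- If some `fᵢ` is within `ε` of a constant, this constant also approximates `yᵢ`. Otherwise both
are farther than `ε` from `k`, and the comparison of discs in `near_or_near_of_mem_goodElements`
applies. -/
theorem nearOrNear_of_mem_goodElements {t f₁ f₂ y₁ y₂ : W} (ht : t ≠ 0) (htk : t ∉ k)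
    (hf₁ : f₁ ∈ goodElements k t) (hf₂ : f₂ ∈ goodElements k t)
    (hf : IsAlgebraic (Algebra.adjoin k {f₁}) f₂) {ε : ℝ} (hε : 0 < ε)
    (hy₁ : ‖y₁ - f₁‖ ≤ ε) (hy₂ : ‖y₂ - f₂‖ ≤ ε) : NearOrNear k y₁ y₂ ε := by
  have hmax : ∀ {a b c : W}, ‖a - b‖ ≤ ε → ‖b - c‖ ≤ ε → ‖a - c‖ ≤ ε := fun {a b c} h₁ h₂ => by
    rw [← sub_add_sub_cancel a b c]
    exact (IsUltrametricDist.norm_add_le_max _ _).trans (max_le h₁ h₂)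
  by_cases h₁ : ∃ c ∈ k, ‖f₁ - c‖ ≤ ε
  · obtain ⟨c, hc, h⟩ := h₁
    refine Or.inr ⟨c, isAlgebraic_algebraMap (⟨c, Subalgebra.algebraMap_mem _ (⟨c, hc⟩ : k)⟩ :
      Algebra.adjoin k {y₂}), ?_⟩
    rw [norm_sub_rev]
    exact hmax hy₁ h
  by_cases h₂ : ∃ c ∈ k, ‖f₂ - c‖ ≤ ε
  · obtain ⟨c, hc, h⟩ := h₂
    refine Or.inl ⟨c, isAlgebraic_algebraMap (⟨c, Subalgebra.algebraMap_mem _ (⟨c, hc⟩ : k)⟩ :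
      Algebra.adjoin k {y₁}), ?_⟩
    rw [norm_sub_rev]
    exact hmax hy₂ h
  push Not at h₁ h₂
  have hnk : ∀ {f y : W}, (∀ c ∈ k, ε < ‖f - c‖) → ‖y - f‖ ≤ ε → y ∉ k := fun {f y} h hy hyk =>
    not_le.mpr (h y hyk) (by rwa [norm_sub_rev])
  have hf₁k : f₁ ∉ k := hnk h₁ (by rw [sub_self, norm_zero]; exact hε.le)
  have hf₂k : f₂ ∉ k := hnk h₂ (by rw [sub_self, norm_zero]; exact hε.le)
  have hf' : IsAlgebraic (Algebra.adjoin k {f₂}) f₁ := isAlgebraic_adjoin_exchange hf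
    (isAlgebraic_algebraMap (⟨f₁, Algebra.subset_adjoin rfl⟩ : Algebra.adjoin k {f₁}))
    (transcendental_of_notMem_range fun ⟨c, hc⟩ => hf₂k (hc ▸ c.2))
  obtain ⟨R₁, hR₁, hR₁0⟩ := exists_evalXY_eq_zero hf
  obtain ⟨R₂, hR₂, hR₂0⟩ := exists_evalXY_eq_zero hf'
  rcases near_or_near_of_mem_goodElements ht htk hf₁ hf₂ hR₁ hR₂ hR₁0 hR₂0 hε hε hε h₁ h₂ hy₁ hy₂
    with ⟨α, hα, h⟩ | ⟨α, hα, h⟩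
  · rw [max_self] at h
    refine Or.inl ⟨α, isAlgebraic_of_evalXY_eq_zero (hnk h₁ hy₁) hR₁ hα, ?_⟩
    rw [← sub_add_sub_cancel α f₂ y₂]
    exact (IsUltrametricDist.norm_add_le_max _ _).trans (max_le h (by rwa [norm_sub_rev]))
  · rw [max_self] at h
    refine Or.inr ⟨α, isAlgebraic_of_evalXY_eq_zero (hnk h₂ hy₂) hR₂ hα, ?_⟩
    rw [← sub_add_sub_cancel α f₁ y₁]
    exact (IsUltrametricDist.norm_add_le_max _ _).trans (max_le h (by rwa [norm_sub_rev]))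

theorem nearOrNear_of_sphericallyComplete (hk : SeqSphericallyComplete k)
    (hval : ∀ r : ℝ, 0 < r → ∃ c : k, ‖c‖ = r) {x z₁ z₂ y₁ y₂ : W}
    (hz₁ : IsAlgebraic (Algebra.adjoin k {x}) z₁) (hz₂ : IsAlgebraic (Algebra.adjoin k {x}) z₂)
    {ε : ℝ} (hε : 0 < ε) (hy₁ : ‖y₁ - z₁‖ ≤ ε) (hy₂ : ‖y₂ - z₂‖ ≤ ε) : NearOrNear k y₁ y₂ ε := by
  by_cases hz₁k : z₁ ∈ k
  · exact nearOrNear_of_mem hz₁k hy₁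
  have h := isAlgebraic_adjoin_exchange hz₁ hz₂
    (transcendental_of_notMem_range fun ⟨c, hc⟩ => hz₁k (hc ▸ c.2))
  obtain ⟨t, ht, htk, h₁, h₂⟩ := exists_mem_goodElements_pair hk hval hz₁k h
  exact nearOrNear_of_mem_goodElements ht htk h₁ h₂ h hε hy₁ hy₂

theorem nearOrNear_of_trivial (hk : ∀ c ∈ k, c ≠ 0 → ‖c‖ = 1) {x z₁ z₂ y₁ y₂ : W}
    (hx : ∃ u : W, IsAlgebraic (Algebra.adjoin k {x}) u ∧ u ≠ 0 ∧ ‖u‖ ≠ 1)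
    (hz₁ : IsAlgebraic (Algebra.adjoin k {x}) z₁) (hz₂ : IsAlgebraic (Algebra.adjoin k {x}) z₂)
    {ε : ℝ} (hε : 0 < ε) (hy₁ : ‖y₁ - z₁‖ ≤ ε) (hy₂ : ‖y₂ - z₂‖ ≤ ε) : NearOrNear k y₁ y₂ ε := by
  have hmax : ∀ {a b c : W}, ‖a - b‖ ≤ ε → ‖b - c‖ ≤ ε → ‖a - c‖ ≤ ε := fun {a b c} h₁ h₂ => by
    rw [← sub_add_sub_cancel a b c]
    exact (IsUltrametricDist.norm_add_le_max _ _).trans (max_le h₁ h₂)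
  by_cases hz₁k : z₁ ∈ k
  · exact nearOrNear_of_mem hz₁k hy₁
  obtain ⟨s, t, f₁, f₂, ht, htk, hf₁, hf₂, h₁, h₂, hs₁, hs₂⟩ :=
    exists_mem_goodElements_near hk hx hz₁ hz₂ hz₁k hε
  by_cases hf₁k : f₁ ∈ k
  · exact nearOrNear_of_mem hf₁k (hmax hy₁ h₁)
  have h := isAlgebraic_adjoin_exchange hs₁ hs₂
    (transcendental_of_notMem_range fun ⟨c, hc⟩ => hf₁k (hc ▸ c.2))
  exact nearOrNear_of_mem_goodElements ht htk hf₁ hf₂ h hε (hmax hy₁ h₁) (hmax hy₂ h₂)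

end NearPair

end AnalyticField
end

/-! ### Ultrapowers of a normed field. -/

noncomputable section

namespace AnalyticField

open Polynomial Filter Topology

section Ultrapower

variable (W : Type*) [NormedField W]

/-- Bounded sequences. -/
def boundedSeq : Subring (ℕ → W) where
  carrier := {a | ∃ C, ∀ n, ‖a n‖ ≤ C}
  zero_mem' := ⟨0, fun n => by simp⟩
  one_mem' := ⟨1, fun n => by simp⟩
  add_mem' := by
    rintro a b ⟨C, hC⟩ ⟨D, hD⟩
    exact ⟨C + D, fun n => (norm_add_le _ _).trans (add_le_add (hC n) (hD n))⟩
  mul_mem' := by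
    rintro a b ⟨C, hC⟩ ⟨D, hD⟩
    refine ⟨C * D, fun n => ?_⟩
    rw [Pi.mul_apply, norm_mul]
    exact mul_le_mul (hC n) (hD n) (norm_nonneg _) ((norm_nonneg _).trans (hC n))
  neg_mem' := by
    rintro a ⟨C, hC⟩
    exact ⟨C, fun n => by simpa using hC n⟩

variable {W}

theorem exists_tendsto_norm (a : boundedSeq W) :
    ∃ r, Tendsto (fun n => ‖a.1 n‖) (hyperfilter ℕ : Ultrafilter ℕ) (𝓝 r) := by
  obtain ⟨C, hC⟩ := a.2
  obtain ⟨r, -, hr⟩ := isCompact_Icc.ultrafilter_le_nhds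
    ((hyperfilter ℕ : Ultrafilter ℕ).map fun n => ‖a.1 n‖) (s := Set.Icc (0 : ℝ) C) (by
      rw [Filter.le_principal_iff]
      exact Filter.mem_map.mpr (Filter.univ_mem' fun n => ⟨norm_nonneg _, hC n⟩))
  exact ⟨r, hr⟩

/-- The limit of the norms along the ultrafilter. -/
def limNorm (a : boundedSeq W) : ℝ := Classical.choose (exists_tendsto_norm a)

theorem tendsto_limNorm (a : boundedSeq W) :
    Tendsto (fun n => ‖a.1 n‖) (hyperfilter ℕ : Ultrafilter ℕ) (𝓝 (limNorm a)) :=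
  Classical.choose_spec (exists_tendsto_norm a)

theorem limNorm_eq {a : boundedSeq W} {r : ℝ}
    (h : Tendsto (fun n => ‖a.1 n‖) (hyperfilter ℕ : Ultrafilter ℕ) (𝓝 r)) : limNorm a = r :=
  tendsto_nhds_unique (tendsto_limNorm a) h

theorem limNorm_mul (a b : boundedSeq W) : limNorm (a * b) = limNorm a * limNorm b :=
  limNorm_eq (by simpa using (tendsto_limNorm a).mul (tendsto_limNorm b))

theorem limNorm_neg (a : boundedSeq W) : limNorm (-a) = limNorm a :=
  limNorm_eq (by simpa using tendsto_limNorm a)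

theorem limNorm_nonneg (a : boundedSeq W) : 0 ≤ limNorm a :=
  ge_of_tendsto' (tendsto_limNorm a) fun _ => norm_nonneg _

theorem limNorm_zero : limNorm (0 : boundedSeq W) = 0 := limNorm_eq (by simp)

theorem limNorm_add_le (a b : boundedSeq W) : limNorm (a + b) ≤ limNorm a + limNorm b :=
  le_of_tendsto_of_tendsto' (tendsto_limNorm _) ((tendsto_limNorm a).add (tendsto_limNorm b))
    fun _ => norm_add_le _ _

theorem limNorm_le {a : boundedSeq W} {r : ℝ}
    (h : ∀ᶠ n in (hyperfilter ℕ : Filter ℕ), ‖a.1 n‖ ≤ r) : limNorm a ≤ r :=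
  le_of_tendsto (tendsto_limNorm a) h

variable (W) in
/-- Sequences which tend to zero along the ultrafilter. -/
def nullSeq : Ideal (boundedSeq W) where
  carrier := {a | limNorm a = 0}
  zero_mem' := limNorm_zero
  add_mem' := by
    intro a b ha hb
    refine le_antisymm ((limNorm_add_le a b).trans ?_) (limNorm_nonneg _)
    rw [ha, hb, add_zero]
  smul_mem' := by
    intro c a ha
    change limNorm (c * a) = 0
    rw [limNorm_mul, ha, mul_zero]

variable (W) in
/-- The ultrapower of a normed field. -/
def Ultrapower : Type _ := boundedSeq W ⧸ nullSeq W

instance : CommRing (Ultrapower W) := inferInstanceAs (CommRing (boundedSeq W ⧸ nullSeq W))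

/-- The class of a bounded sequence. -/
def Ultrapower.mk : boundedSeq W →+* Ultrapower W := Ideal.Quotient.mk (nullSeq W)

theorem Ultrapower.mk_surjective : Function.Surjective (Ultrapower.mk (W := W)) :=
  Ideal.Quotient.mk_surjective

theorem Ultrapower.mk_eq_zero_iff {a : boundedSeq W} : Ultrapower.mk a = 0 ↔ limNorm a = 0 :=
  Ideal.Quotient.eq_zero_iff_mem

theorem Ultrapower.exists_inv {k : Subfield W} {a : boundedSeq W} (ha : limNorm a ≠ 0)
    (hak : ∀ n, a.1 n ∈ k) : ∃ b : boundedSeq W, (∀ n, b.1 n ∈ k) ∧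
      Ultrapower.mk a * Ultrapower.mk b = 1 := by
  have hpos : 0 < limNorm a := (limNorm_nonneg a).lt_of_ne' ha
  classical
  -- Inverting only the entries above half the limit keeps the sequence bounded; this covers a set
  -- of indices in the ultrafilter.
  let b : ℕ → W := fun n => if limNorm a / 2 < ‖a.1 n‖ then (a.1 n)⁻¹ else 0
  have hb : b ∈ boundedSeq W := ⟨(limNorm a / 2)⁻¹, fun n => by
    dsimp only [b]
    split_ifs with h
    · rw [norm_inv]
      exact inv_anti₀ (by positivity) h.le
    · rw [norm_zero]; positivity⟩
  refine ⟨⟨b, hb⟩, fun n => ?_, ?_⟩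
  · change (if _ then _ else _) ∈ k
    split_ifs
    exacts [inv_mem (hak n), zero_mem k]
  · rw [← map_mul, ← sub_eq_zero, ← map_one (Ultrapower.mk (W := W)), ← map_sub,
      Ultrapower.mk_eq_zero_iff]
    refine le_antisymm (limNorm_le ?_) (limNorm_nonneg _)
    filter_upwards [(tendsto_limNorm a).eventually (lt_mem_nhds (half_lt_self hpos))] with n hn
    have h0 : a.1 n ≠ 0 := norm_pos_iff.mp ((half_pos hpos).trans hn)
    change ‖a.1 n * (if _ then _ else _) - 1‖ ≤ 0
    rw [if_pos hn, mul_inv_cancel₀ h0, sub_self, norm_zero]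

theorem limNorm_one : limNorm (1 : boundedSeq W) = 1 := limNorm_eq (by simp)

instance : Field (Ultrapower W) := IsField.toField
  { exists_pair_ne := ⟨0, 1, fun h => by
      rw [← map_one (Ultrapower.mk (W := W)), eq_comm, Ultrapower.mk_eq_zero_iff, limNorm_one] at h
      exact one_ne_zero h⟩
    mul_comm := mul_comm
    mul_inv_cancel := fun {x} hx => by
      obtain ⟨a, rfl⟩ := Ultrapower.mk_surjective x
      obtain ⟨b, -, hb⟩ := Ultrapower.exists_inv (k := ⊤)
        (fun h => hx (Ultrapower.mk_eq_zero_iff.mpr h)) fun _ => trivial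
      exact ⟨_, hb⟩ }

theorem limNorm_eq_of_mk_eq {a b : boundedSeq W} (h : Ultrapower.mk a = Ultrapower.mk b) :
    limNorm a = limNorm b := by
  rw [← sub_eq_zero, ← map_sub, Ultrapower.mk_eq_zero_iff] at h
  have h1 := limNorm_add_le (a - b) b
  have h2 := limNorm_add_le (-(a - b)) a
  rw [sub_add_cancel, h, zero_add] at h1
  rw [neg_sub, sub_add_cancel, ← neg_sub, limNorm_neg, h, zero_add] at h2
  exact le_antisymm h1 h2

instance : Norm (Ultrapower W) where
  norm x := limNorm (Ultrapower.mk_surjective x).choose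

theorem Ultrapower.norm_mk (a : boundedSeq W) : ‖Ultrapower.mk a‖ = limNorm a :=
  limNorm_eq_of_mk_eq (Ultrapower.mk_surjective (Ultrapower.mk a)).choose_spec

instance : NormedField (Ultrapower W) where
  dist x y := ‖x - y‖
  dist_self x := by rw [sub_self, ← map_zero Ultrapower.mk, Ultrapower.norm_mk, limNorm_zero]
  dist_comm x y := by
    obtain ⟨a, rfl⟩ := Ultrapower.mk_surjective x
    obtain ⟨b, rfl⟩ := Ultrapower.mk_surjective y
    rw [← map_sub, ← map_sub, Ultrapower.norm_mk, Ultrapower.norm_mk, ← limNorm_neg, neg_sub]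
  dist_triangle x y z := by
    obtain ⟨a, rfl⟩ := Ultrapower.mk_surjective x
    obtain ⟨b, rfl⟩ := Ultrapower.mk_surjective y
    obtain ⟨c, rfl⟩ := Ultrapower.mk_surjective z
    rw [← map_sub, ← map_sub, ← map_sub, Ultrapower.norm_mk, Ultrapower.norm_mk,
      Ultrapower.norm_mk, ← sub_add_sub_cancel a b c]
    exact limNorm_add_le _ _
  eq_of_dist_eq_zero {x y} h := by
    obtain ⟨a, rfl⟩ := Ultrapower.mk_surjective x
    obtain ⟨b, rfl⟩ := Ultrapower.mk_surjective y
    rwa [← map_sub, Ultrapower.norm_mk, ← Ultrapower.mk_eq_zero_iff, map_sub, sub_eq_zero] at h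
  dist_eq x y := by
    obtain ⟨a, rfl⟩ := Ultrapower.mk_surjective x
    obtain ⟨b, rfl⟩ := Ultrapower.mk_surjective y
    rw [neg_add_eq_sub, ← map_sub, ← map_sub, Ultrapower.norm_mk, Ultrapower.norm_mk,
      ← limNorm_neg, neg_sub]
  norm_mul x y := by
    obtain ⟨a, rfl⟩ := Ultrapower.mk_surjective x
    obtain ⟨b, rfl⟩ := Ultrapower.mk_surjective y
    rw [← map_mul, Ultrapower.norm_mk, Ultrapower.norm_mk, Ultrapower.norm_mk, limNorm_mul]

instance [IsUltrametricDist W] : IsUltrametricDist (Ultrapower W) :=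
  IsUltrametricDist.isUltrametricDist_of_forall_norm_add_le_max_norm fun x y => by
    obtain ⟨a, rfl⟩ := Ultrapower.mk_surjective x
    obtain ⟨b, rfl⟩ := Ultrapower.mk_surjective y
    rw [← map_add, Ultrapower.norm_mk, Ultrapower.norm_mk, Ultrapower.norm_mk]
    exact le_of_tendsto_of_tendsto' (tendsto_limNorm _)
      ((tendsto_limNorm a).max (tendsto_limNorm b)) fun _ => IsUltrametricDist.norm_add_le_max _ _

/-- Constant sequences. -/
def constSeq : W →+* boundedSeq W :=
  (Pi.constRingHom ℕ W).codRestrict (boundedSeq W) fun a => ⟨‖a‖, fun _ => le_rfl⟩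

/-- The diagonal embedding. -/
def Ultrapower.diag : W →+* Ultrapower W := Ultrapower.mk.comp constSeq

theorem Ultrapower.norm_diag (a : W) : ‖Ultrapower.diag a‖ = ‖a‖ :=
  (Ultrapower.norm_mk _).trans (limNorm_eq tendsto_const_nhds)

/-- The bounded sequences with values in a subfield. -/
def boundedSeqIn (k : Subfield W) : Subring (boundedSeq W) where
  carrier := {a | ∀ n, a.1 n ∈ k}
  zero_mem' _ := zero_mem k
  one_mem' _ := one_mem k
  add_mem' ha hb n := add_mem (ha n) (hb n)
  mul_mem' ha hb n := mul_mem (ha n) (hb n)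
  neg_mem' ha n := neg_mem (ha n)

/-- The ultrapower of a subfield. -/
def Ultrapower.subfield (k : Subfield W) : Subfield (Ultrapower W) :=
  { (boundedSeqIn k).map Ultrapower.mk with
    inv_mem' := by
      rintro _ ⟨a, ha, rfl⟩
      by_cases h : limNorm a = 0
      · rw [Ultrapower.mk_eq_zero_iff.mpr h, inv_zero]
        exact ⟨0, zero_mem (boundedSeqIn k), map_zero _⟩
      · obtain ⟨b, hb, hab⟩ := Ultrapower.exists_inv h ha
        exact ⟨b, hb, eq_inv_of_mul_eq_one_right hab⟩ }

theorem Ultrapower.mem_subfield {k : Subfield W} {x : Ultrapower W} :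
    x ∈ Ultrapower.subfield k ↔ ∃ a : boundedSeq W, (∀ n, a.1 n ∈ k) ∧ Ultrapower.mk a = x :=
  Iff.rfl

theorem norm_le_of_monic_root [IsUltrametricDist W] {x : W} {n : ℕ} (hn : n ≠ 0) {c : ℕ → W}
    {C : ℝ} (hC : ∀ i, ‖c i‖ ≤ C) (h : x ^ n + ∑ i ∈ Finset.range n, c i * x ^ i = 0) :
    ‖x‖ ≤ max 1 C := by
  by_contra! hlt
  obtain ⟨h1, hCx⟩ := max_lt_iff.mp hlt
  have h2 : ‖x ^ n‖ ≤ C * ‖x‖ ^ (n - 1) := by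
    rw [eq_neg_of_add_eq_zero_left h, norm_neg]
    obtain ⟨l, hl, hle⟩ := IsUltrametricDist.exists_norm_finsetSum_le_of_nonempty
      (Finset.nonempty_range_iff.mpr hn) fun i => c i * x ^ i
    refine hle.trans ?_
    rw [norm_mul, norm_pow]
    exact mul_le_mul (hC l) (pow_le_pow_right₀ h1.le (by have := Finset.mem_range.mp hl; omega))
      (by positivity) ((norm_nonneg _).trans (hC l))
  rw [norm_pow] at h2
  have h3 : ‖x‖ ^ n = ‖x‖ * ‖x‖ ^ (n - 1) := by rw [← pow_succ']; congr 1; omega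
  rw [h3] at h2
  exact not_lt.mpr h2 (mul_lt_mul_of_pos_right hCx (pow_pos (one_pos.trans h1) _))

/-- Roots are chosen in `k` index by index; `norm_le_of_monic_root` bounds them by the coefficients,
so they form a bounded sequence. -/
theorem exists_monic_root [IsUltrametricDist W] {k : Subfield W} [IsAlgClosed k] {n : ℕ}
    (hn : n ≠ 0) (a : ℕ → boundedSeq W) (ha : ∀ i m, (a i).1 m ∈ k) :
    ∃ x : boundedSeq W, (∀ m, x.1 m ∈ k) ∧ x ^ n + ∑ i ∈ Finset.range n, a i * x ^ i = 0 := by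
  have hroot : ∀ m, ∃ x : k, (x : W) ^ n + ∑ i ∈ Finset.range n, (a i).1 m * (x : W) ^ i = 0 := by
    intro m
    set P : k[X] := X ^ n + ∑ i ∈ Finset.range n, C (⟨(a i).1 m, ha i m⟩ : k) * X ^ i with hP
    have hdeg : (∑ i ∈ Finset.range n, C (⟨(a i).1 m, ha i m⟩ : k) * X ^ i).degree <
        (n : WithBot ℕ) := by
      refine (degree_sum_le _ _).trans_lt ((Finset.sup_lt_iff (WithBot.bot_lt_coe _)).mpr ?_)
      intro i hi
      exact (degree_C_mul_X_pow_le _ _).trans_lt (by exact_mod_cast Finset.mem_range.mp hi)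
    have hPd : P.degree = n := by
      rw [hP, degree_add_eq_left_of_degree_lt (by rwa [degree_X_pow]), degree_X_pow]
    obtain ⟨x, hx⟩ := IsAlgClosed.exists_root P (by rw [hPd]; exact_mod_cast hn)
    refine ⟨x, ?_⟩
    rw [IsRoot.def, hP, eval_add, eval_finsetSum] at hx
    have h := congrArg (algebraMap k W) hx
    rw [eval_pow, eval_X, map_add, map_pow, map_sum, map_zero] at h
    rw [← h]
    refine congrArg _ (Finset.sum_congr rfl fun i _ => ?_)
    rw [eval_mul, eval_C, eval_pow, eval_X, map_mul, map_pow]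
    rfl
  choose x hx using hroot
  choose C hC using fun i => (a i).2
  have hb : (fun m => (x m : W)) ∈ boundedSeq W := by
    refine ⟨max 1 (∑ i ∈ Finset.range n, |C i|), fun m => ?_⟩
    refine norm_le_of_monic_root hn (c := fun i => if i ∈ Finset.range n then (a i).1 m else 0)
      (fun i => ?_) ?_
    · split_ifs with hi
      · exact ((hC i m).trans (le_abs_self _)).trans
          (Finset.single_le_sum (f := fun i => |C i|) (fun _ _ => abs_nonneg _) hi)
      · rw [norm_zero]; positivity
    · rw [← hx m]
      exact congrArg _ (Finset.sum_congr rfl fun i hi => by rw [if_pos hi])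
  refine ⟨⟨_, hb⟩, fun m => (x m).2, Subtype.ext (funext fun m => ?_)⟩
  simpa using hx m

theorem Ultrapower.isAlgClosed_aux [IsUltrametricDist W] {k : Subfield W} [IsAlgClosed k]
    {p : (Ultrapower W)[X]} (hp : p.Monic) (hd : p.natDegree ≠ 0)
    (hpk : ∀ i, p.coeff i ∈ Ultrapower.subfield k) :
    ∃ x ∈ Ultrapower.subfield k, p.eval x = 0 := by
  choose a ha hap using fun i => Ultrapower.mem_subfield.mp (hpk i)
  obtain ⟨x, hxk, hx⟩ := exists_monic_root hd a ha
  refine ⟨Ultrapower.mk x, Ultrapower.mem_subfield.mpr ⟨x, hxk, rfl⟩, ?_⟩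
  have h := congrArg Ultrapower.mk hx
  rw [map_add, map_pow, map_sum, map_zero] at h
  rw [eval_eq_sum_range, Finset.sum_range_succ, hp.coeff_natDegree, one_mul, add_comm, ← h]
  refine congrArg _ (Finset.sum_congr rfl fun i _ => ?_)
  rw [map_mul, map_pow, hap]

instance Ultrapower.isAlgClosed_subfield [IsUltrametricDist W] {k : Subfield W} [IsAlgClosed k] :
    IsAlgClosed (Ultrapower.subfield k) := by
  refine IsAlgClosed.of_exists_root _ fun p hp hirr => ?_
  obtain ⟨x, hxk, hx⟩ := Ultrapower.isAlgClosed_aux (k := k)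
    (p := p.map (algebraMap (Ultrapower.subfield k) (Ultrapower W))) (hp.map _)
    (by rw [natDegree_map]; exact hirr.natDegree_pos.ne')
    (fun i => by rw [coeff_map]; exact (p.coeff i).2)
  refine ⟨⟨x, hxk⟩, (algebraMap (Ultrapower.subfield k) (Ultrapower W)).injective ?_⟩
  rw [map_zero, ← hx]
  exact (eval_map_apply (algebraMap (Ultrapower.subfield k) (Ultrapower W)) _).symm

instance Ultrapower.isAlgClosed [IsUltrametricDist W] [IsAlgClosed W] :
    IsAlgClosed (Ultrapower W) := by
  have : IsAlgClosed (⊤ : Subfield W) := IsAlgClosed.of_ringEquiv W _ Subfield.topEquiv.symm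
  refine IsAlgClosed.of_exists_root _ fun p hp hirr => ?_
  obtain ⟨x, -, hx⟩ := Ultrapower.isAlgClosed_aux (k := ⊤) hp hirr.natDegree_pos.ne' fun i => by
    obtain ⟨a, ha⟩ := Ultrapower.mk_surjective (p.coeff i)
    exact Ultrapower.mem_subfield.mpr ⟨a, fun _ => trivial, ha⟩
  exact ⟨x, hx⟩

end Ultrapower

end AnalyticField
end

/-! ### Saturation of ultrapowers and descent of approximations. -/

noncomputable section

namespace AnalyticField

open Polynomial Filter Topology

section UltrapowerComplete

variable {W : Type*} [NormedField W] {k : Subfield W}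

/-- Countable saturation of ultrapowers: a diagonal choice of index. -/
theorem exists_diagonal (S : ℕ → Set ℕ) (hS : ∀ m, S m ∈ (hyperfilter ℕ : Filter ℕ)) :
    ∃ d : ℕ → ℕ, (∀ n, d n = 0 ∨ n ∈ S (d n)) ∧
      ∀ m, ∀ᶠ n in (hyperfilter ℕ : Filter ℕ), m ≤ d n ∧ n ∈ S (d n) := by
  classical
  refine ⟨fun n => Nat.findGreatest (fun m => n ∈ S m) n, fun n => ?_, fun m => ?_⟩
  · rcases (Nat.findGreatest (fun m => n ∈ S m) n).eq_zero_or_pos with h | h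
    · exact Or.inl h
    · exact Or.inr (Nat.findGreatest_of_ne_zero (P := fun m => n ∈ S m) rfl h.ne')
  · have hm : ∀ᶠ n in (hyperfilter ℕ : Filter ℕ), m ≤ n := by
      refine Nat.hyperfilter_le_atTop ?_
      exact eventually_ge_atTop m
    filter_upwards [hm, hS m] with n hn hnm
    exact ⟨Nat.le_findGreatest hn hnm, Nat.findGreatest_spec (P := fun m => n ∈ S m) hn hnm⟩

/-- Countable saturation: a common point is the diagonal sequence of centres `(a (d n)).1 n`. The
index `d n` eventually exceeds any given number along the ultrafilter, so the errors `1 / (d n + 1)`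
disappear in the limit. -/
theorem Ultrapower.seqSphericallyComplete_subfield :
    SeqSphericallyComplete (Ultrapower.subfield k) := by
  intro c r hc
  choose a hak ha using fun i => Ultrapower.mem_subfield.mp (c i).2
  have hnorm : ∀ i j, i ≤ j → limNorm (a i - a j) ≤ r i := fun i j hij => by
    rw [← Ultrapower.norm_mk, map_sub, ha, ha]
    exact hc i j hij
  let S : ℕ → Set ℕ := fun m => {n | ∀ i ≤ m, ‖(a i).1 n - (a m).1 n‖ < r i + 1 / (m + 1)}
  have hS : ∀ m, S m ∈ (hyperfilter ℕ : Filter ℕ) := by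
    intro m
    have : S m = ⋂ i ∈ Finset.range (m + 1),
        {n | ‖(a i).1 n - (a m).1 n‖ < r i + 1 / (m + 1)} := by
      ext n
      simp [S]
    rw [this, Filter.biInter_finset_mem]
    intro i hi
    have h1 : limNorm (a i - a m) < r i + 1 / (m + 1) :=
      (hnorm i m (Nat.lt_succ_iff.mp (Finset.mem_range.mp hi))).trans_lt
        (lt_add_of_pos_right _ (by positivity))
    exact (tendsto_limNorm (a i - a m)).eventually (gt_mem_nhds h1)
  obtain ⟨d, hd0, hd⟩ := exists_diagonal S hS
  let b : ℕ → W := fun n => (a (d n)).1 n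
  have hb : b ∈ boundedSeq W := by
    obtain ⟨C, hC⟩ := (a 0).2
    refine ⟨C + (|r 0| + 1), fun n => ?_⟩
    have h1 : ‖(a 0).1 n - (a (d n)).1 n‖ ≤ |r 0| + 1 := by
      rcases hd0 n with h | h
      · rw [h, sub_self, norm_zero]; positivity
      · refine (h 0 (Nat.zero_le _)).le.trans (add_le_add (le_abs_self _) ?_)
        rw [div_le_one (by positivity)]
        linarith [(Nat.cast_nonneg (d n) : (0 : ℝ) ≤ d n)]
    calc ‖b n‖ = ‖(a 0).1 n - ((a 0).1 n - (a (d n)).1 n)‖ := by rw [sub_sub_cancel]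
      _ ≤ _ := (norm_sub_le _ _).trans (add_le_add (hC n) h1)
  refine ⟨⟨Ultrapower.mk ⟨b, hb⟩, Ultrapower.mem_subfield.mpr ⟨⟨b, hb⟩, fun n => hak (d n) n, rfl⟩⟩,
    fun i => ?_⟩
  change ‖Ultrapower.mk ⟨b, hb⟩ - (c i : Ultrapower W)‖ ≤ r i
  rw [← ha, ← map_sub, Ultrapower.norm_mk]
  refine le_of_forall_pos_le_add fun δ hδ => ?_
  obtain ⟨N, hN⟩ := exists_nat_one_div_lt hδ
  refine limNorm_le ?_
  filter_upwards [hd (max i N)] with n hn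
  have h1 := hn.2 i ((le_max_left _ _).trans hn.1)
  have h2 : (1 : ℝ) / (d n + 1) ≤ 1 / (N + 1) := by
    have : (N : ℝ) ≤ d n := by exact_mod_cast (le_max_right _ _).trans hn.1
    exact one_div_le_one_div_of_le (by positivity) (by linarith)
  change ‖(a (d n)).1 n - (a i).1 n‖ ≤ _
  rw [norm_sub_rev]
  linarith

/-- Roots of high order of one element of norm greater than one have norms in `(1, 1 + δ)`, so their
powers come within the factor `1 + δ` of every positive real. In the ultrapower this density becomes
surjectivity. -/
theorem exists_norm_near [IsAlgClosed k] (hk : ∃ c ∈ k, c ≠ 0 ∧ ‖c‖ ≠ 1) {r : ℝ} (hr : 0 < r)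
    {δ : ℝ} (hδ : 0 < δ) : ∃ c ∈ k, r ≤ ‖c‖ ∧ ‖c‖ ≤ r * (1 + δ) := by
  obtain ⟨c, hck, hc1⟩ : ∃ c ∈ k, 1 < ‖c‖ := by
    obtain ⟨c, hck, hc0, hc1⟩ := hk
    rcases lt_or_gt_of_ne hc1 with h | h
    · exact ⟨c⁻¹, inv_mem hck, by rw [norm_inv]; exact (one_lt_inv₀ (norm_pos_iff.mpr hc0)).mpr h⟩
    · exact ⟨c, hck, h⟩
  obtain ⟨q, hq⟩ : ∃ q : ℕ, ‖c‖ < (1 + δ) ^ q :=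
    pow_unbounded_of_one_lt _ (by linarith)
  have hq0 : 0 < q := by
    rcases q.eq_zero_or_pos with h | h
    · rw [h, pow_zero] at hq; linarith
    · exact h
  obtain ⟨e, he⟩ := IsAlgClosed.exists_pow_nat_eq (⟨c, hck⟩ : k) hq0
  have he' : ‖(e : W)‖ ^ q = ‖c‖ := by
    rw [← norm_pow, ← SubmonoidClass.coe_pow, he]
  have he1 : 1 < ‖(e : W)‖ := by
    by_contra! h
    have := pow_le_one₀ (n := q) (norm_nonneg _) h
    rw [he'] at this
    linarith
  have heδ : ‖(e : W)‖ < 1 + δ := lt_of_pow_lt_pow_left₀ q (by linarith) (he' ▸ hq)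
  obtain ⟨n, hn, hn'⟩ := exists_mem_Ioc_zpow hr he1
  have hz := zpow_pos (one_pos.trans he1) n
  refine ⟨(e : W) ^ (n + 1), zpow_mem e.2 _, by rwa [norm_zpow], ?_⟩
  rw [norm_zpow, zpow_add₀ (one_pos.trans he1).ne', zpow_one]
  exact mul_le_mul hn.le heδ.le (norm_nonneg _) hr.le

theorem Ultrapower.exists_norm_eq [IsAlgClosed k] (hk : ∃ c ∈ k, c ≠ 0 ∧ ‖c‖ ≠ 1) {r : ℝ}
    (hr : 0 < r) : ∃ c : Ultrapower.subfield k, ‖c‖ = r := by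
  choose c hck hc1 hc2 using fun n : ℕ =>
    exists_norm_near hk hr (δ := 1 / ((n : ℝ) + 1)) (by positivity)
  have hb : c ∈ boundedSeq W := ⟨r * (1 + 1), fun n => (hc2 n).trans
    (mul_le_mul_of_nonneg_left (add_le_add_right (by
      rw [div_le_one (by positivity)]
      linarith [(Nat.cast_nonneg n : (0 : ℝ) ≤ n)]) 1) hr.le)⟩
  refine ⟨⟨Ultrapower.mk ⟨c, hb⟩, Ultrapower.mem_subfield.mpr ⟨_, hck, rfl⟩⟩, ?_⟩
  change ‖Ultrapower.mk ⟨c, hb⟩‖ = r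
  rw [Ultrapower.norm_mk]
  refine limNorm_eq ?_
  have h1 : Tendsto (fun n : ℕ => r * (1 + 1 / ((n : ℝ) + 1))) atTop (𝓝 (r * (1 + 0))) :=
    (tendsto_one_div_add_atTop_nhds_zero_nat.const_add 1).const_mul r
  rw [add_zero, mul_one] at h1
  exact (tendsto_of_tendsto_of_tendsto_of_le_of_le tendsto_const_nhds h1 hc1 hc2).mono_left
    Nat.hyperfilter_le_atTop

end UltrapowerComplete

section Transfer

variable {W : Type*} [NormedField W] {k : Subfield W}

theorem Ultrapower.diag_mem {c : W} (hc : c ∈ k) : Ultrapower.diag c ∈ Ultrapower.subfield k :=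
  Ultrapower.mem_subfield.mpr ⟨constSeq c, fun _ => hc, rfl⟩

theorem Ultrapower.isAlgebraic_diag {x z : W} (h : IsAlgebraic (Algebra.adjoin k {x}) z) :
    IsAlgebraic (Algebra.adjoin (Ultrapower.subfield k) {Ultrapower.diag x})
      (Ultrapower.diag z) := by
  have hmem : ∀ e ∈ Algebra.adjoin k {x}, Ultrapower.diag e ∈
      Algebra.adjoin (Ultrapower.subfield k) {Ultrapower.diag x} := by
    intro e he
    induction he using Algebra.adjoin_induction with
    | mem y hy => rw [Set.mem_singleton_iff.mp hy]; exact Algebra.subset_adjoin rfl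
    | algebraMap c =>
      exact Subalgebra.algebraMap_mem _ (⟨_, Ultrapower.diag_mem c.2⟩ : Ultrapower.subfield k)
    | add a b _ _ ha hb => rw [map_add]; exact add_mem ha hb
    | mul a b _ _ ha hb => rw [map_mul]; exact mul_mem ha hb
  let f : Algebra.adjoin k {x} →+* Algebra.adjoin (Ultrapower.subfield k) {Ultrapower.diag x} :=
    (Ultrapower.diag.comp (algebraMap (Algebra.adjoin k {x}) W)).codRestrict _
      fun e => hmem e e.2
  have hf : Function.Injective f := fun a b hab =>
    Subtype.ext (Ultrapower.diag.injective (congrArg Subtype.val hab))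
  obtain ⟨p, hp, hpz⟩ := h
  refine ⟨p.map f, (Polynomial.map_ne_zero_iff hf).mpr hp, ?_⟩
  rw [aeval_def, eval₂_map, ← map_zero Ultrapower.diag, ← hpz, aeval_def, hom_eval₂]
  rfl

/-- Approximate solutions descend from the ultrapower. -/
theorem Ultrapower.exists_isAlgebraic_near [IsUltrametricDist W] [IsAlgClosed W] {y w : W}
    {α : Ultrapower W} {ε ε' : ℝ} (hε : 0 < ε)
    (hα : IsAlgebraic (Algebra.adjoin (Ultrapower.subfield k) {Ultrapower.diag y}) α)
    (h : ‖α - Ultrapower.diag w‖ ≤ ε) (hεε' : ε < ε') :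
    ∃ a, IsAlgebraic (Subfield.closure (insert y (k : Set W))) a ∧ ‖a - w‖ < ε' := by
  set E := Subfield.closure (insert y (k : Set W)) with hE
  have hlift : ∀ e ∈ Algebra.adjoin (Ultrapower.subfield k) {Ultrapower.diag y},
      ∃ b : boundedSeq W, (∀ n, b.1 n ∈ E) ∧ Ultrapower.mk b = e := by
    intro e he
    induction he using Algebra.adjoin_induction with
    | mem u hu =>
      rw [Set.mem_singleton_iff.mp hu]
      exact ⟨constSeq y, fun _ => Subfield.subset_closure (Set.mem_insert _ _), rfl⟩
    | algebraMap c =>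
      obtain ⟨b, hb, hbc⟩ := Ultrapower.mem_subfield.mp c.2
      exact ⟨b, fun n => Subfield.subset_closure (Set.mem_insert_of_mem _ (hb n)), hbc⟩
    | add u v _ _ hu hv =>
      obtain ⟨a, ha, rfl⟩ := hu
      obtain ⟨b, hb, rfl⟩ := hv
      exact ⟨a + b, fun n => add_mem (ha n) (hb n), map_add _ _ _⟩
    | mul u v _ _ hu hv =>
      obtain ⟨a, ha, rfl⟩ := hu
      obtain ⟨b, hb, rfl⟩ := hv
      exact ⟨a * b, fun n => mul_mem (ha n) (hb n), map_mul _ _ _⟩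
  obtain ⟨p, hp, hpα⟩ := hα
  choose b hbE hb using fun i => hlift (p.coeff i) (p.coeff i).2
  set q := p.map (algebraMap _ (Ultrapower W)) with hq
  have hq0 : q ≠ 0 := (Polynomial.map_ne_zero_iff Subtype.val_injective).mpr hp
  obtain ⟨j, hj, hlt⟩ := exists_coeff_lt_of_isRoot (q := taylor (Ultrapower.diag w) q)
    (v := α - Ultrapower.diag w) (by simpa using hq0)
    (by rw [IsRoot.def, taylor_eval, sub_add_cancel, hq, eval_map_algebraMap, hpα])
    (h.trans_lt hεε')
  set Q : (boundedSeq W)[X] := ∑ i ∈ Finset.range (p.natDegree + 1), C (b i) * X ^ i with hQ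
  have hQq : Q.map Ultrapower.mk = q := by
    ext i
    rw [coeff_map, hQ, finsetSum_coeff, hq, coeff_map]
    simp only [coeff_C_mul, coeff_X_pow, mul_ite, mul_one, mul_zero, Finset.sum_ite_eq,
      Finset.mem_range]
    split_ifs with hi
    · exact hb i
    · rw [coeff_eq_zero_of_natDegree_lt (by omega), map_zero, map_zero]
  let ev : ℕ → boundedSeq W →+* W := fun n => (Pi.evalRingHom _ n).comp (boundedSeq W).subtype
  have hcoeff : ∀ m, ‖(taylor (Ultrapower.diag w) q).coeff m‖ =
      limNorm ((taylor (constSeq w) Q).coeff m) := fun m => by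
    rw [← Ultrapower.norm_mk, ← hQq, ← coeff_map, map_taylor]
    rfl
  have hev : ∀ m n, ((taylor (constSeq w) Q).coeff m).1 n =
      (taylor w (Q.map (ev n))).coeff m := fun m n => by
    have : (taylor (constSeq w) Q).map (ev n) = taylor w (Q.map (ev n)) := map_taylor _ _ _
    rw [← this, coeff_map]
    rfl
  rw [hcoeff, hcoeff] at hlt
  -- The criterion for a near root is a strict inequality of limits, so it already holds at some
  -- index `n`; there the specialized polynomial has coefficients in the field generated by `k` and
  -- `y`.
  obtain ⟨n, hn⟩ := ((tendsto_limNorm ((taylor (constSeq w) Q).coeff 0)).eventually_lt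
    ((tendsto_limNorm ((taylor (constSeq w) Q).coeff j)).mul_const _) hlt).exists
  rw [hev, hev] at hn
  refine exists_isAlgebraic_near_of_coeff (hε.trans hεε') (IsAlgClosed.splits (Q.map (ev n)))
    (fun i => ?_) ⟨j, hj, hn⟩
  rw [coeff_map, hQ, finsetSum_coeff, map_sum]
  refine sum_mem fun l _ => ?_
  rw [coeff_C_mul, map_mul, coeff_X_pow]
  refine mul_mem (hbE l n) ?_
  split_ifs
  · rw [map_one]; exact one_mem _
  · rw [map_zero]; exact zero_mem _

end Transfer

end AnalyticField
end

/-! ### Weak exchange. -/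

noncomputable section

namespace AnalyticField

open Polynomial

section Exchange

variable {W : Type*} [NormedField W]

theorem isAlgebraic_closure_insert_iff {k : Subfield W} {x z : W} :
    IsAlgebraic (Subfield.closure (insert x (k : Set W))) z ↔
      IsAlgebraic (Algebra.adjoin k {x}) z := by
  have h : (IntermediateField.adjoin k {x}).toSubfield =
      Subfield.closure (insert x (k : Set W)) := by
    refine le_antisymm ?_ (Subfield.closure_le.mpr ?_)
    · change Subfield.closure _ ≤ _
      refine Subfield.closure_mono ?_
      rintro y (⟨c, rfl⟩ | hy)
      · exact Set.mem_insert_of_mem _ c.2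
      · exact Set.mem_singleton_iff.mp hy ▸ Set.mem_insert _ _
    · rintro y (rfl | hy)
      · exact IntermediateField.mem_adjoin_simple_self k y
      · exact (IntermediateField.adjoin k {x}).algebraMap_mem ⟨y, hy⟩
  rw [← IntermediateField.isAlgebraic_adjoin_iff, ← h]
  rfl

variable [IsUltrametricDist W]

theorem isAlgClosed_completedAlgClosureIn [IsAlgClosed W] (E : Subfield W) :
    IsAlgClosed (completedAlgClosureIn E) := by
  refine IsAlgClosed.of_exists_root _ fun p hp hirr => ?_
  obtain ⟨x, hx⟩ := IsAlgClosed.exists_aeval_eq_zero W p hirr.degree_pos.ne'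
  have hmem : x ∈ completedAlgClosureIn E :=
    mem_completedAlgClosureIn_of_isAlgebraic ⟨p, hp.ne_zero, hx⟩
  refine ⟨⟨x, hmem⟩, ?_⟩
  refine (algebraMap (completedAlgClosureIn E) W).injective ?_
  rw [map_zero, ← eval_map_apply, eval_map_algebraMap]
  exact hx

theorem taClosure_insert_taClosure [IsAlgClosed W] (A : Set W) (y : W) :
    taClosure (insert y (taClosure A)) = taClosure (insert y A) := by
  refine (taClosure_subset (Set.insert_subset (subset_taClosure _ (Set.mem_insert _ _)) ?_)).antisymm
    (taClosure_mono (Set.insert_subset_insert (subset_taClosure A)))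
  exact taClosure_mono (Set.subset_insert _ _)

/-- Distinct algebraic elements are at distance one, so the algebraic elements form a discrete set,
and a limit of them is one of them. -/
theorem isAlgebraic_of_forall_norm_eq_one {R : Type*} [CommRing R] [IsDomain R] [Algebra R W]
    {y : W} (hx : ∀ u : W, IsAlgebraic R u → u ≠ 0 → ‖u‖ = 1)
    (hy : ∀ ε > 0, ∃ a, IsAlgebraic R a ∧ ‖a - y‖ < ε) : IsAlgebraic R y := by
  obtain ⟨a, ha, hay⟩ := hy 1 one_pos
  by_contra hn
  have hne : a - y ≠ 0 := fun h => hn (by rwa [← sub_eq_zero.mp h])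
  obtain ⟨b, hb, hby⟩ := hy (min 1 ‖a - y‖) (lt_min one_pos (norm_pos_iff.mpr hne))
  have hab : a - b = 0 := by
    by_contra h
    have h1 := hx _ (ha.sub hb) h
    rw [← sub_sub_sub_cancel_right a b y] at h1
    have h2 := IsUltrametricDist.norm_add_le_max (a - y) (-(b - y))
    rw [← sub_eq_add_neg, h1, norm_neg] at h2
    exact not_lt.mpr h2 (max_lt hay (hby.trans_le (min_le_left _ _)))
  rw [sub_eq_zero.mp hab] at hby
  exact lt_irrefl _ (hby.trans_le (min_le_right _ _))

/-- Exchange at a fixed precision. The cases are separated by whether `k`, and then the algebraic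
closure of `k(x)`, is trivially valued. -/
theorem near_or_near [IsAlgClosed W] {k : Subfield W} [IsAlgClosed k] {x y₁ y₂ : W}
    (h₁ : ∀ ε > 0, ∃ a, IsAlgebraic (Algebra.adjoin k {x}) a ∧ ‖a - y₁‖ < ε)
    (h₂ : ∀ ε > 0, ∃ a, IsAlgebraic (Algebra.adjoin k {x}) a ∧ ‖a - y₂‖ < ε)
    {ε : ℝ} (hε : 0 < ε) :
    (∃ a, IsAlgebraic (Subfield.closure (insert y₁ (k : Set W))) a ∧ ‖a - y₂‖ < ε) ∨
      ∃ a, IsAlgebraic (Subfield.closure (insert y₂ (k : Set W))) a ∧ ‖a - y₁‖ < ε := by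
  obtain ⟨z₁, hz₁, hzy₁⟩ := h₁ (ε / 2) (half_pos hε)
  obtain ⟨z₂, hz₂, hzy₂⟩ := h₂ (ε / 2) (half_pos hε)
  rw [norm_sub_rev] at hzy₁ hzy₂
  -- Nontrivially valued `k`: its ultrapower satisfies all hypotheses of the spherically complete
  -- case. The half of `ε` leaves room for the strict inequality in the descent.
  by_cases hk : ∃ c ∈ k, c ≠ 0 ∧ ‖c‖ ≠ 1
  · have h := nearOrNear_of_sphericallyComplete
      (Ultrapower.seqSphericallyComplete_subfield (k := k))
      (fun r hr => Ultrapower.exists_norm_eq hk hr) (Ultrapower.isAlgebraic_diag hz₁)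
      (Ultrapower.isAlgebraic_diag hz₂) (y₁ := Ultrapower.diag y₁) (y₂ := Ultrapower.diag y₂)
      (half_pos hε) (by rw [← map_sub, Ultrapower.norm_diag]; exact hzy₁.le)
      (by rw [← map_sub, Ultrapower.norm_diag]; exact hzy₂.le)
    rcases h with ⟨α, hα, h⟩ | ⟨α, hα, h⟩
    · exact Or.inl (Ultrapower.exists_isAlgebraic_near (half_pos hε) hα h (half_lt_self hε))
    · exact Or.inr (Ultrapower.exists_isAlgebraic_near (half_pos hε) hα h (half_lt_self hε))
  push Not at hk
  by_cases hx : ∃ u : W, IsAlgebraic (Algebra.adjoin k {x}) u ∧ u ≠ 0 ∧ ‖u‖ ≠ 1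
  · rcases nearOrNear_of_trivial hk hx hz₁ hz₂ (half_pos hε) hzy₁.le hzy₂.le with
      ⟨α, hα, h⟩ | ⟨α, hα, h⟩
    · exact Or.inl ⟨α, isAlgebraic_closure_insert_iff.mpr hα, h.trans_lt (half_lt_self hε)⟩
    · exact Or.inr ⟨α, isAlgebraic_closure_insert_iff.mpr hα, h.trans_lt (half_lt_self hε)⟩
  -- Everything algebraic over `k(x)` is trivially valued: `y₁` and `y₂` are algebraic over `k(x)`
  -- themselves, and classical exchange finishes.
  push Not at hx
  have hy₁ := isAlgebraic_of_forall_norm_eq_one hx h₁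
  have hy₂ := isAlgebraic_of_forall_norm_eq_one hx h₂
  by_cases hy₁k : y₁ ∈ k
  · exact Or.inr ⟨y₁, isAlgebraic_closure_insert_iff.mpr (isAlgebraic_algebraMap
      (⟨y₁, Subalgebra.algebraMap_mem _ (⟨y₁, hy₁k⟩ : k)⟩ : Algebra.adjoin k {y₂})), by simpa⟩
  · exact Or.inl ⟨y₂, isAlgebraic_closure_insert_iff.mpr (isAlgebraic_adjoin_exchange hy₁ hy₂
      (transcendental_of_notMem_range fun ⟨c, hc⟩ => hy₁k (hc ▸ c.2))), by simpa⟩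

/-- Weak exchange: inside a closed algebraically closed field of topological generating degree one,
one of two elements is generated by the other. -/
theorem mem_taClosure_or_mem_taClosure [IsAlgClosed W] {A : Set W} {x y₁ y₂ : W}
    (h₁ : y₁ ∈ taClosure (insert x A)) (h₂ : y₂ ∈ taClosure (insert x A)) :
    y₂ ∈ taClosure (insert y₁ A) ∨ y₁ ∈ taClosure (insert y₂ A) := by
  have := isAlgClosed_completedAlgClosureIn (Subfield.closure A)
  have hk : ((completedAlgClosureIn (Subfield.closure A) : Subfield W) : Set W) = taClosure A := rfl
  rw [← taClosure_insert_taClosure, mem_taClosure_iff] at h₁ h₂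
  rw [← hk] at h₁ h₂
  simp only [isAlgebraic_closure_insert_iff] at h₁ h₂
  rw [← taClosure_insert_taClosure A, ← taClosure_insert_taClosure A, mem_taClosure_iff,
    mem_taClosure_iff, ← hk]
  -- The valid alternative may change with the precision. If both memberships fail, at precisions
  -- `ε₁` and `ε₂`, then at the smaller of the two neither alternative is possible.
  by_contra! hno
  obtain ⟨⟨ε₁, hε₁, hn₁⟩, ε₂, hε₂, hn₂⟩ := hno
  rcases near_or_near h₁ h₂ (lt_min hε₁ hε₂) with ⟨a, ha, h⟩ | ⟨a, ha, h⟩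
  · exact not_lt.mpr (hn₁ a ha) (h.trans_le (min_le_left _ _))
  · exact not_lt.mpr (hn₂ a ha) (h.trans_le (min_le_right _ _))

end Exchange

end AnalyticField
end

/-! ### Generating tuples: selection, perturbation and Baire category. -/

noncomputable section

namespace AnalyticField

open Polynomial Topology

section Generation

variable {W : Type*} [NormedField W] [IsUltrametricDist W] [IsAlgClosed W]

theorem taClosure_trans {A : Set W} {a b : W} {S : Set W} (hS : S ⊆ taClosure (insert a A))
    (ha : a ∈ taClosure (insert b A)) : S ⊆ taClosure (insert b A) :=
  hS.trans (taClosure_subset (Set.insert_subset ha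
    ((Set.subset_insert b A).trans (subset_taClosure _))))

/-- In a finite subset of `taClosure (insert x A)` some element generates the others over `A`. -/
theorem exists_mem_generating {A : Set W} {x : W} {S : Set W} (hfin : S.Finite) (hne : S.Nonempty)
    (hS : S ⊆ taClosure (insert x A)) : ∃ s ∈ S, S ⊆ taClosure (insert s A) := by
  induction S, hfin using Set.Finite.induction_on with
  | empty => exact absurd hne Set.not_nonempty_empty
  | @insert a S _ _ ih =>
    have hself : ∀ s : W, s ∈ taClosure (insert s A) := fun s =>
      subset_taClosure _ (Set.mem_insert s A)
    rcases S.eq_empty_or_nonempty with rfl | hne'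
    · exact ⟨a, Set.mem_insert _ _, Set.insert_subset (hself a) (Set.empty_subset _)⟩
    obtain ⟨s, hs, hsS⟩ := ih hne' ((Set.subset_insert _ _).trans hS)
    rcases mem_taClosure_or_mem_taClosure (hS (Set.mem_insert a S))
      (hS (Set.mem_insert_of_mem a hs)) with h | h
    · exact ⟨a, Set.mem_insert _ _, Set.insert_subset (hself a) (taClosure_trans hsS h)⟩
    · exact ⟨s, Set.mem_insert_of_mem _ hs, Set.insert_subset h hsS⟩

/-- A finite set inside the closure of `n` elements is generated by `n` of its elements. -/
theorem exists_generating_subset {n : ℕ} {A X S : Set W} (hX : X.Finite) (hn : X.ncard ≤ n)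
    (hfin : S.Finite) (hS : S ⊆ taClosure (A ∪ X)) :
    ∃ S₀ ⊆ S, S₀.ncard ≤ n ∧ S ⊆ taClosure (A ∪ S₀) := by
  induction X, hX using Set.Finite.induction_on generalizing n A with
  | empty => exact ⟨∅, Set.empty_subset _, by simp, hS⟩
  | @insert x X hx hX ih =>
    rcases S.eq_empty_or_nonempty with rfl | hne
    · exact ⟨∅, le_rfl, by simp, Set.empty_subset _⟩
    rw [Set.ncard_insert_of_notMem hx hX] at hn
    obtain ⟨n, rfl⟩ : ∃ m, n = m + 1 := ⟨n - 1, by omega⟩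
    -- The chosen `s` replaces `x` as a generator over `A ∪ X`. It is then absorbed into the base
    -- `A`, and the remaining generators `X` are treated in the same way.
    obtain ⟨s, hs, hsS⟩ := exists_mem_generating (A := A ∪ X) hfin hne
      (by rwa [← Set.union_insert])
    obtain ⟨S₀, hS₀, hcard, hgen⟩ := ih (n := n) (A := insert s A) (by omega)
      (by rwa [Set.insert_union])
    refine ⟨insert s S₀, Set.insert_subset hs hS₀, (Set.ncard_insert_le _ _).trans (by omega), ?_⟩
    rwa [Set.union_insert, ← Set.insert_union]

/-- Coordinates are replaced one at a time. For small `w ≠ 0` in `L`, the elements `x j`, `x j + w`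
and `x j + w * z j` are all close to `x j`. By weak exchange one of them generates the other two
over the remaining coordinates, hence also the quotient of their differences, which is the old
coordinate `z j`. -/
theorem exists_generating_near {d : ℕ} {B : Set W} {L : Subfield W}
    (hL : ∀ δ > 0, ∃ w ∈ L, w ≠ 0 ∧ ‖w‖ < δ) {x y : Fin d → W} (hx : ∀ j, x j ∈ L)
    (hy : ∀ j, y j ∈ L) (hgen : (L : Set W) ⊆ taClosure (B ∪ Set.range y)) {δ : ℝ} (hδ : 0 < δ) :
    ∃ z : Fin d → W, (∀ j, z j ∈ L) ∧ (∀ j, ‖z j - x j‖ < δ) ∧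
      (L : Set W) ⊆ taClosure (B ∪ Set.range z) := by
  suffices h : ∀ s : Finset (Fin d), ∃ z : Fin d → W, (∀ j, z j ∈ L) ∧ (∀ j ∈ s, ‖z j - x j‖ < δ) ∧
      (L : Set W) ⊆ taClosure (B ∪ Set.range z) by
    obtain ⟨z, h1, h2, h3⟩ := h Finset.univ
    exact ⟨z, h1, fun j => h2 j (Finset.mem_univ j), h3⟩
  intro s
  induction s using Finset.induction_on with
  | empty => exact ⟨y, hy, by simp, hgen⟩
  | insert j s hj ih =>
    obtain ⟨z, hzL, hzs, hz⟩ := ih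
    set A := B ∪ z '' {j}ᶜ with hA
    have hzA : B ∪ Set.range z ⊆ insert (z j) A := by
      rintro v (hv | ⟨i, rfl⟩)
      · exact Set.mem_insert_of_mem _ (Or.inl hv)
      · by_cases hij : i = j
        · rw [hij]; exact Set.mem_insert _ _
        · exact Set.mem_insert_of_mem _ (Or.inr ⟨i, hij, rfl⟩)
    -- A bound on `‖w‖` that makes both `‖w‖` and `‖w * z j‖` less than `δ`.
    have hpos : 0 < δ / (1 + ‖z j‖) := by positivity
    obtain ⟨w, hwL, hw0, hwδ⟩ := hL _ hpos
    have hw : ‖w‖ * (1 + ‖z j‖) < δ := (lt_div_iff₀ (by positivity)).mp hwδ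
    have hw1 : ‖w‖ < δ := by nlinarith [norm_nonneg w, norm_nonneg (z j)]
    have hw2 : ‖w * z j‖ < δ := by rw [norm_mul]; nlinarith [norm_nonneg w, norm_nonneg (z j)]
    have hSL : ({x j, x j + w, x j + w * z j} : Set W) ⊆ L := by
      rintro v (rfl | rfl | rfl)
      exacts [hx j, add_mem (hx j) hwL, add_mem (hx j) (mul_mem hwL (hzL j))]
    obtain ⟨m, hm, hmS⟩ := exists_mem_generating (A := A) (x := z j)
      (S := {x j, x j + w, x j + w * z j}) (by simp) ⟨x j, by simp⟩
      (hSL.trans (hz.trans (taClosure_mono hzA)))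
    have hmL : m ∈ L := hSL hm
    have hmδ : ‖m - x j‖ < δ := by
      rcases hm with rfl | rfl | rfl
      · rw [sub_self, norm_zero]; exact hδ
      · rwa [add_sub_cancel_left]
      · rwa [add_sub_cancel_left]
    have hzm : z j ∈ taClosure (insert m A) := by
      have h1 : x j ∈ completedAlgClosureIn (Subfield.closure (insert m A)) := hmS (by simp)
      have h2 : x j + w ∈ completedAlgClosureIn (Subfield.closure (insert m A)) := hmS (by simp)
      have h3 : x j + w * z j ∈ completedAlgClosureIn (Subfield.closure (insert m A)) :=
        hmS (by simp)
      have h4 := div_mem (sub_mem h3 h1) (sub_mem h2 h1)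
      rwa [add_sub_cancel_left, add_sub_cancel_left, mul_div_cancel_left₀ _ hw0] at h4
    refine ⟨Function.update z j m, fun i => ?_, fun i hi => ?_, ?_⟩
    · by_cases hij : i = j
      · rw [hij, Function.update_self]; exact hmL
      · rw [Function.update_of_ne hij]; exact hzL i
    · by_cases hij : i = j
      · rw [hij, Function.update_self]; exact hmδ
      · rw [Function.update_of_ne hij]
        exact hzs i (Finset.mem_of_mem_insert_of_ne hi hij)
    · refine (taClosure_trans (hz.trans (taClosure_mono hzA)) hzm).trans (taClosure_mono ?_)
      refine Set.insert_subset (Or.inr ⟨j, Function.update_self _ _ _⟩) ?_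
      rintro v (hv | ⟨i, hi, rfl⟩)
      · exact Or.inl hv
      · exact Or.inr ⟨i, Function.update_of_ne hi _ _⟩

omit [IsUltrametricDist W] [IsAlgClosed W] in
-- Each element of the ring is a polynomial expression in the tuple, so it extends to a continuous
-- function of the tuple with values in the corresponding rings.
theorem exists_continuous_of_mem_closure {d : ℕ} {B : Set W} {x : Fin d → W} {c : W}
    (hc : c ∈ Subring.closure (B ∪ Set.range x)) : ∃ f : (Fin d → W) → W, Continuous f ∧ f x = c ∧
      ∀ x', f x' ∈ Subring.closure (B ∪ Set.range x') := by
  induction hc using Subring.closure_induction with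
  | mem u hu =>
    rcases hu with hu | ⟨j, rfl⟩
    · exact ⟨fun _ => u, continuous_const, rfl, fun _ => Subring.subset_closure (Or.inl hu)⟩
    · exact ⟨fun x' => x' j, continuous_apply j, rfl,
        fun x' => Subring.subset_closure (Or.inr ⟨j, rfl⟩)⟩
  | zero => exact ⟨fun _ => 0, continuous_const, rfl, fun _ => zero_mem _⟩
  | one => exact ⟨fun _ => 1, continuous_const, rfl, fun _ => one_mem _⟩
  | add u v _ _ hu hv =>
    obtain ⟨f, hf, rfl, hf'⟩ := hu
    obtain ⟨g, hg, rfl, hg'⟩ := hv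
    exact ⟨fun x' => f x' + g x', hf.add hg, rfl, fun x' => add_mem (hf' x') (hg' x')⟩
  | neg u _ hu =>
    obtain ⟨f, hf, rfl, hf'⟩ := hu
    exact ⟨fun x' => -f x', hf.neg, rfl, fun x' => neg_mem (hf' x')⟩
  | mul u v _ _ hu hv =>
    obtain ⟨f, hf, rfl, hf'⟩ := hu
    obtain ⟨g, hg, rfl, hg'⟩ := hv
    exact ⟨fun x' => f x' * g x', hf.mul hg, rfl, fun x' => mul_mem (hf' x') (hg' x')⟩

/-- Being close to the algebraic closure of the field generated by a tuple is an open condition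
on the tuple. -/
theorem isOpen_near (d : ℕ) (B : Set W) (b : W) {ε : ℝ} (hε : 0 < ε) :
    IsOpen {x : Fin d → W | ∃ a, IsAlgebraic (Subfield.closure (B ∪ Set.range x)) a ∧
      ‖a - b‖ < ε} := by
  rw [isOpen_iff_mem_nhds]
  rintro x ⟨a, ha, hab⟩
  obtain ⟨q, hq, j, hj, hlt⟩ := exists_coeff_of_isAlgebraic_near ha hab
  choose f hf hfx hfc using fun i => exists_continuous_of_mem_closure (hq i)
  set N := q.natDegree + 1 with hN
  let P : (Fin d → W) → W[X] := fun x' => ∑ i ∈ Finset.range N, C (f i x') * X ^ i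
  have hP : P x = q := by
    conv_rhs => rw [q.as_sum_range_C_mul_X_pow]
    exact Finset.sum_congr rfl fun i _ => by rw [hfx]
  have hcont : ∀ m, Continuous fun x' => (taylor b (P x')).coeff m := by
    intro m
    have : (fun x' => (taylor b (P x')).coeff m) =
        fun x' => ∑ i ∈ Finset.range N, f i x' * (taylor b (X ^ i)).coeff m := by
      funext x'
      simp only [P, map_sum, finsetSum_coeff, taylor_mul, taylor_C, coeff_C_mul]
    rw [this]
    exact continuous_finsetSum _ fun i _ => (hf i).mul continuous_const
  have hopen : IsOpen {x' | ‖(taylor b (P x')).coeff 0‖ < ‖(taylor b (P x')).coeff j‖ * ε ^ j} :=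
    isOpen_lt (hcont 0).norm ((hcont j).norm.mul continuous_const)
  refine Filter.mem_of_superset (hopen.mem_nhds (by rw [Set.mem_ofPred_eq, hP]; exact hlt))
    fun x' hx' => ?_
  refine exists_isAlgebraic_near_of_coeff hε (IsAlgClosed.splits (P x')) (fun n => ?_) ⟨j, hj, hx'⟩
  simp only [P, finsetSum_coeff, coeff_C_mul, coeff_X_pow]
  refine sum_mem fun i _ => mul_mem ?_ ?_
  · exact (Subring.closure_le (t := (Subfield.closure _).toSubring)).mpr Subfield.subset_closure
      (hfc i x')
  · split_ifs
    exacts [one_mem _, zero_mem _]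

/-- The closure of the union of a countable directed family of subfields generated by `d` elements
is generated by `d` elements, if some element is neither zero nor of norm one. -/
theorem exists_generating_of_directed [CompleteSpace W] {I : Type*} [Countable I] [Nonempty I]
    {L : I → Subfield W} (hL : Directed (· ≤ ·) L) {d : ℕ} {B : Set W}
    (hgen : ∀ i, ∃ y : Fin d → W, (∀ j, y j ∈ L i) ∧ (L i : Set W) ⊆ taClosure (B ∪ Set.range y))
    (hnt : ∃ i, ∃ w ∈ L i, w ≠ 0 ∧ ‖w‖ ≠ 1) :
    ∃ x : Fin d → W, (∀ j, x j ∈ closure (⋃ i, (L i : Set W))) ∧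
      ∀ i, (L i : Set W) ⊆ taClosure (B ∪ Set.range x) := by
  classical
  set V := closure (⋃ i, (L i : Set W)) with hV
  have : Nonempty V :=
    ⟨⟨0, subset_closure (Set.mem_iUnion.mpr ⟨Classical.arbitrary I, zero_mem _⟩)⟩⟩
  have : CompleteSpace V := isClosed_closure.completeSpace_coe
  obtain ⟨i₀, w, hwL, hw0, hw1⟩ := hnt
  have hsmall : ∀ i, L i₀ ≤ L i → ∀ δ > 0, ∃ w ∈ L i, w ≠ 0 ∧ ‖w‖ < δ := by
    intro i hi δ hδ
    obtain ⟨u, hu, hu0, hu1⟩ : ∃ u ∈ L i, u ≠ 0 ∧ ‖u‖ < 1 := by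
      rcases lt_or_gt_of_ne hw1 with h | h
      · exact ⟨w, hi hwL, hw0, h⟩
      · exact ⟨w⁻¹, inv_mem (hi hwL), inv_ne_zero hw0, by
          rw [norm_inv]; exact inv_lt_one_of_one_lt₀ h⟩
    obtain ⟨n, hn⟩ := exists_pow_lt_of_lt_one hδ hu1
    exact ⟨u ^ n, pow_mem hu n, pow_ne_zero n hu0, by rwa [norm_pow]⟩
  choose y hyL hy using hgen
  let c : (Fin d → V) → Fin d → W := fun x j => x j
  have hc : Continuous c := by fun_prop
  -- Tuples that capture one generator of one member with precision `1 / (n + 1)`. Countably many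
  -- such open sets occur, and a tuple in all of them generates every member.
  let U : I × Fin d × ℕ → Set (Fin d → V) := fun p => c ⁻¹' {x : Fin d → W |
    ∃ a, IsAlgebraic (Subfield.closure (B ∪ Set.range x)) a ∧
      ‖a - y p.1 p.2.1‖ < 1 / ((p.2.2 : ℝ) + 1)}
  have hUo : ∀ p, IsOpen (U p) := fun p => (isOpen_near d B _ (by positivity)).preimage hc
  have hUd : ∀ p, Dense (U p) := by
    rintro ⟨i, l, n⟩
    rw [Metric.dense_iff]
    intro x δ hδ
    have happ : ∀ j, ∃ v ∈ ⋃ i, (L i : Set W), dist (x j : W) v < δ := fun j =>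
      Metric.mem_closure_iff.mp (x j).2 δ hδ
    choose v hv hvδ using happ
    choose m hm using fun j => Set.mem_iUnion.mp (hv j)
    -- One member containing the generators of index `i`, the approximations of all coordinates, and
    -- arbitrarily small nonzero elements. A generating tuple of this larger member near `x` also
    -- captures the generators of index `i`.
    obtain ⟨t, ht⟩ := hL.finset_le (insert i (insert i₀ (Finset.univ.image m)))
    have hti : L i ≤ L t := ht i (by simp)
    have hti₀ : L i₀ ≤ L t := ht i₀ (by simp)
    have htm : ∀ j, L (m j) ≤ L t := fun j => ht (m j) (by simp)
    obtain ⟨z, hzL, hzv, hz⟩ := exists_generating_near (hsmall t hti₀)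
      (fun j => htm j (hm j)) (hyL t) (hy t) hδ
    have hzV : ∀ j, z j ∈ V := fun j => subset_closure (Set.mem_iUnion.mpr ⟨t, hzL j⟩)
    refine ⟨fun j => ⟨z j, hzV j⟩, ?_, ?_⟩
    · rw [Metric.mem_ball, dist_pi_lt_iff hδ]
      intro j
      refine lt_of_le_of_lt (dist_triangle_max (z j) (v j) (x j : W)) (max_lt ?_ ?_)
      · rw [dist_eq_norm]; exact hzv j
      · rw [dist_comm]; exact hvδ j
    · exact mem_taClosure_iff.mp (hz (hti (hyL i l))) _ (by positivity)
  obtain ⟨x, hx⟩ := (dense_iInter_of_isOpen hUo hUd).nonempty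
  refine ⟨c x, fun j => (x j).2, fun i => ?_⟩
  refine (hy i).trans (taClosure_subset ?_)
  rintro v (hv | ⟨j, rfl⟩)
  · exact subset_taClosure _ (Or.inl hv)
  · rw [mem_taClosure_iff]
    intro ε hε
    obtain ⟨n, hn⟩ := exists_nat_one_div_lt hε
    obtain ⟨a, ha, hab⟩ := Set.mem_iInter.mp hx (i, j, n)
    exact ⟨a, ha, hab.trans hn⟩

end Generation

end AnalyticField
end

/-! ### Families of trivially valued fields. -/

noncomputable section

namespace AnalyticField

open Polynomial Topology

section Trivial

/-- Enumerate `T` and pad with the arbitrary `v`, so that sets of at most `d` elements become tuples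
of fixed length. -/
theorem exists_fin_tuple {α : Type*} {d : ℕ} {T V : Set α} (hT : #T ≤ d) (hTV : T ⊆ V) {v : α}
    (hv : v ∈ V) : ∃ x : Fin d → α, (∀ j, x j ∈ V) ∧ T ⊆ Set.range x := by
  have h : Cardinal.lift.{0} #T ≤ Cardinal.lift #(Fin d) := by simpa using hT
  obtain ⟨e⟩ := Cardinal.lift_mk_le'.mp h
  refine ⟨Function.extend e Subtype.val fun _ => v, fun j => ?_, fun t ht => ?_⟩
  · by_cases hj : ∃ t, e t = j
    · obtain ⟨t, rfl⟩ := hj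
      rw [e.injective.extend_apply]
      exact hTV t.2
    · rw [Function.extend_apply' _ _ _ hj]
      exact hv
  · exact ⟨e ⟨t, ht⟩, e.injective.extend_apply _ _ _⟩

theorem ncard_range_fin_le {α : Type*} {d : ℕ} (y : Fin d → α) : (Set.range y).ncard ≤ d := by
  rw [← Set.image_univ]
  exact (Set.ncard_image_le Set.finite_univ).trans (by simp [Set.ncard_univ])

variable {W : Type*} [NormedField W] [IsUltrametricDist W] [IsAlgClosed W]

omit [IsAlgClosed W] in
-- The algebraic closure of a trivially valued field is trivially valued, hence discrete, and taking
-- limits adds nothing.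
theorem isAlgebraic_of_mem_taClosure {L : Subfield W} (hL : ∀ c ∈ L, c ≠ 0 → ‖c‖ = 1) {S : Set W}
    (hS : S ⊆ L) {b : W} (hb : b ∈ taClosure S) : IsAlgebraic (Subfield.closure S) b :=
  isAlgebraic_of_forall_norm_eq_one
    (fun _ hu => norm_eq_one_of_isAlgebraic
      (fun c hc => hL c ((Subfield.closure_le.mpr hS) hc)) hu) (mem_taClosure_iff.mp hb)

omit [IsAlgClosed W] in
/-- Exchange inside a trivially valued field. -/
theorem mem_taClosure_exchange {L : Subfield W} (hL : ∀ c ∈ L, c ≠ 0 → ‖c‖ = 1) {A : Set W}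
    (hA : A ⊆ L) {a b : W} (hb : b ∈ L) (hab : a ∈ taClosure (insert b A))
    (ha : a ∉ taClosure A) : b ∈ taClosure (insert a A) := by
  have hcl : ∀ y : W, Subfield.closure (insert y (Subfield.closure A : Set W)) =
      Subfield.closure (insert y A) := fun y => by
    refine le_antisymm (Subfield.closure_le.mpr (Set.insert_subset
      (Subfield.subset_closure (Set.mem_insert _ _))
      (Subfield.closure_mono (Set.subset_insert _ _)))) ?_
    exact Subfield.closure_mono (Set.insert_subset_insert Subfield.subset_closure)
  have h1 := isAlgebraic_of_mem_taClosure hL (Set.insert_subset hb hA) hab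
  rw [← hcl, isAlgebraic_closure_insert_iff] at h1
  refine mem_taClosure_of_isAlgebraic ?_
  rw [← hcl, isAlgebraic_closure_insert_iff]
  exact isAlgebraic_adjoin_exchange h1 (isAlgebraic_algebraMap
    (⟨b, Algebra.subset_adjoin rfl⟩ : Algebra.adjoin (Subfield.closure A) {b}))
    fun h => ha (mem_taClosure_of_isAlgebraic h)

/-- The union of a directed family of trivially valued subfields generated by `d` elements is
generated by `d` elements. -/
theorem exists_generating_of_trivial {I : Type*} [Nonempty I] {L : I → Subfield W}
    (hL : Directed (· ≤ ·) L) {d : ℕ} {B : Set W} (hB : ∀ i, B ⊆ L i)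
    (hgen : ∀ i, ∃ y : Fin d → W, (∀ j, y j ∈ L i) ∧ (L i : Set W) ⊆ taClosure (B ∪ Set.range y))
    (htriv : ∀ i, ∀ w ∈ L i, w ≠ 0 → ‖w‖ = 1) :
    ∃ x : Fin d → W, (∀ j, x j ∈ ⋃ i, (L i : Set W)) ∧
      ∀ i, (L i : Set W) ⊆ taClosure (B ∪ Set.range x) := by
  classical
  have hcommon : ∀ T : Finset W, (T : Set W) ⊆ ⋃ i, (L i : Set W) → ∃ i, (T : Set W) ⊆ L i := by
    intro T hT
    choose! m hm using fun t (ht : t ∈ T) => Set.mem_iUnion.mp (hT ht)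
    obtain ⟨i, hi⟩ := hL.finset_le (T.image m)
    exact ⟨i, fun t ht => hi (m t) (Finset.mem_image_of_mem m ht) (hm t ht)⟩
  -- A finite independent set lies in one member, where `d` elements generate. By
  -- `exists_generating_subset` at most `d` of its own elements generate it, and independence leaves
  -- no others.
  have hbound : ∀ T : Finset W, (T : Set W) ⊆ ⋃ i, (L i : Set W) →
      (∀ t ∈ T, t ∉ taClosure (B ∪ (T \ {t} : Set W))) → T.card ≤ d := by
    intro T hT hind
    obtain ⟨i, hi⟩ := hcommon T hT
    obtain ⟨y, -, hy⟩ := hgen i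
    obtain ⟨T₀, hT₀, hcard, hgenT⟩ := exists_generating_subset (n := d) (Set.finite_range y)
      (ncard_range_fin_le y) T.finite_toSet (hi.trans hy)
    have : (T : Set W) ⊆ T₀ := by
      intro t ht
      by_contra hn
      refine hind t ht (taClosure_mono (Set.union_subset_union_right B ?_) (hgenT ht))
      exact fun s hs => ⟨hT₀ hs, fun h => hn (Set.mem_singleton_iff.mp h ▸ hs)⟩
    rw [← Set.ncard_coe_finset]
    exact (Set.ncard_le_ncard this (T.finite_toSet.subset hT₀)).trans hcard
  by_contra hno
  -- If no `d`-tuple generates, every independent set misses some `b` and can be enlarged by it: a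
  -- dependence of an old `t` on the others and `b` would, by exchange, put `b` into the closure of
  -- the old set. Size `d + 1` contradicts the bound.
  have hstep : ∀ n : ℕ, ∃ T : Finset W, (T : Set W) ⊆ ⋃ i, (L i : Set W) ∧
      (∀ t ∈ T, t ∉ taClosure (B ∪ (T \ {t} : Set W))) ∧ T.card = n := by
    intro n
    induction n with
    | zero => exact ⟨∅, by simp, by simp, rfl⟩
    | succ n ih =>
      obtain ⟨T, hT, hind, hcard⟩ := ih
      obtain ⟨x, hxL, hTx⟩ := exists_fin_tuple (d := d) (T := (T : Set W)) (V := ⋃ i, (L i : Set W))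
        (by simpa using hbound T hT hind) hT
        (Set.mem_iUnion.mpr ⟨Classical.arbitrary I, zero_mem _⟩)
      obtain ⟨i, b, hb, hbT⟩ : ∃ i, ∃ b ∈ L i, b ∉ taClosure (B ∪ T) := by
        by_contra! h
        exact hno ⟨x, hxL, fun i b hb =>
          taClosure_mono (Set.union_subset_union_right B hTx) (h i b hb)⟩
      have hbT' : b ∉ T := fun h => hbT (subset_taClosure _ (Or.inr h))
      have hT' : ((insert b T : Finset W) : Set W) ⊆ ⋃ i, (L i : Set W) := by
        rw [Finset.coe_insert]
        exact Set.insert_subset (Set.mem_iUnion.mpr ⟨i, hb⟩) hT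
      obtain ⟨j, hj⟩ := hcommon _ hT'
      refine ⟨insert b T, hT', fun t ht htc => ?_, by
        rw [Finset.card_insert_of_notMem hbT', hcard]⟩
      rcases Finset.mem_insert.mp ht with rfl | htT
      · refine hbT (taClosure_mono (Set.union_subset_union_right B ?_) htc)
        rintro s ⟨hs, hne⟩
        exact Finset.mem_of_mem_insert_of_ne hs hne
      · have hsub : B ∪ (T \ {t} : Set W) ⊆ L j := Set.union_subset (hB j)
          fun s hs => hj (Finset.mem_insert_of_mem hs.1)
        refine hbT (taClosure_mono ?_ (mem_taClosure_exchange (htriv j) hsub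
          (hj (Finset.mem_insert_self b T)) (taClosure_mono ?_ htc) (hind t htT)))
        · rintro s (rfl | hs | hs)
          · exact Or.inr htT
          · exact Or.inl hs
          · exact Or.inr hs.1
        · rintro s (hs | ⟨hs, hne⟩)
          · exact Or.inr (Or.inl hs)
          · rcases Finset.mem_insert.mp hs with rfl | hs
            · exact Or.inl rfl
            · exact Or.inr (Or.inr ⟨hs, hne⟩)
  obtain ⟨T, hT, hind, hcard⟩ := hstep (d + 1)
  have := hbound T hT hind
  omega

end Trivial

end AnalyticField
end

/-! ### Generation read in an arbitrary algebraically closed extension. -/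

noncomputable section

namespace AnalyticField

open Polynomial

section CompletedAlgClosure

variable (L : Type*) [NormedField L] [IsUltrametricDist L] [CompleteSpace L]

instance : IsUltrametricDist (AlgClosure L) :=
  IsUltrametricDist.isUltrametricDist_of_forall_norm_add_le_max_norm fun x y =>
    isNonarchimedean_spectralNorm x y

instance : IsAlgClosed (AlgClosure L) := IsAlgClosure.isAlgClosed L

instance : IsUltrametricDist (CompletedAlgClosure L) := by
  refine IsUltrametricDist.isUltrametricDist_of_forall_norm_add_le_max_norm fun x y => ?_
  induction x, y using UniformSpace.Completion.induction_on₂ with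
  | hp => exact isClosed_le (by fun_prop) (by fun_prop)
  | ih a b =>
    rw [← UniformSpace.Completion.coe_add, UniformSpace.Completion.norm_coe,
      UniformSpace.Completion.norm_coe, UniformSpace.Completion.norm_coe]
    exact IsUltrametricDist.norm_add_le_max a b

/-- The embedding of the algebraic closure in its completion. -/
def algClosureEmb : AlgClosure L →+* CompletedAlgClosure L := UniformSpace.Completion.coeRingHom

instance : IsAlgClosed (CompletedAlgClosure L) :=
  isAlgClosed_of_denseRange (algClosureEmb L) UniformSpace.Completion.denseRange_coe

theorem norm_algebraMap_completedAlgClosure (x : L) :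
    ‖algebraMap L (CompletedAlgClosure L) x‖ = ‖x‖ := norm_algebraMap' _ x

variable {L}

/-- A closed subfield that is algebraically closed and contains `L` contains the algebraic closure
of `L`, which is dense. -/
theorem completedAlgClosureIn_eq_top {T : Subfield (CompletedAlgClosure L)}
    (h : ∀ b : L, algebraMap L (CompletedAlgClosure L) b ∈ completedAlgClosureIn T) :
    completedAlgClosureIn T = ⊤ := by
  refine eq_top_iff.mpr fun w _ => ?_
  have hclosed : IsClosed (completedAlgClosureIn T : Set (CompletedAlgClosure L)) :=
    isClosed_closure
  refine hclosed.closure_subset_iff.mpr ?_ (UniformSpace.Completion.denseRange_coe w)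
  rintro _ ⟨a, rfl⟩
  refine mem_completedAlgClosureIn_of_isAlgebraic ?_
  obtain ⟨p, hp, hpa⟩ := Algebra.IsAlgebraic.isAlgebraic (R := L) a
  let f : L →+* completedAlgClosureIn T :=
    (algebraMap L (CompletedAlgClosure L)).codRestrict _ h
  refine ⟨p.map f, (Polynomial.map_ne_zero_iff f.injective).mpr hp, ?_⟩
  rw [aeval_def, eval₂_map, ← map_zero (algClosureEmb L), ← hpa, aeval_def, hom_eval₂]
  rfl

variable {k : Type*} [Field k] [Algebra k L]

theorem isTAGenerating_iff {S : Set L} : IsTAGenerating k S ↔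
    ∀ b : L, algebraMap L (CompletedAlgClosure L) b ∈
      taClosure (algebraMap L (CompletedAlgClosure L) '' (Set.range (algebraMap k L) ∪ S)) := by
  have h : (IntermediateField.adjoin k S).toSubfield.map (algebraMap L (CompletedAlgClosure L)) =
      Subfield.closure
        (algebraMap L (CompletedAlgClosure L) '' (Set.range (algebraMap k L) ∪ S)) :=
    RingHom.map_field_closure _ _
  rw [IsTAGenerating, h]
  refine ⟨fun h b => ?_, completedAlgClosureIn_eq_top⟩
  change _ ∈ completedAlgClosureIn _
  rw [h]
  trivial

end CompletedAlgClosure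

section Transfer

variable {L W : Type*} [NormedField L] [NormedField W] [IsUltrametricDist W] [IsAlgClosed W]

/-- The criterion for approximability only involves polynomials over `L` and norms of their Taylor
coefficients, so it does not see the field `W` into which `L` is embedded. -/
theorem mem_taClosure_image_iff {φ : L →+* W} (hφ : ∀ x, ‖φ x‖ = ‖x‖) {S : Set L} {b : L} :
    φ b ∈ taClosure (φ '' S) ↔ ∀ ε > 0, ∃ q : L[X], (∀ n, q.coeff n ∈ Subring.closure S) ∧
      ∃ j, 1 ≤ j ∧ ‖(taylor b q).coeff 0‖ < ‖(taylor b q).coeff j‖ * ε ^ j := by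
  have hcoeff : ∀ (q : L[X]) (n : ℕ), ‖(taylor (φ b) (q.map φ)).coeff n‖ = ‖(taylor b q).coeff n‖ :=
    fun q n => by rw [← map_taylor, coeff_map, hφ]
  rw [mem_taClosure_iff]
  refine forall₂_congr fun ε hε => ⟨?_, ?_⟩
  · rintro ⟨a, ha, hab⟩
    obtain ⟨q, hq, j, hj, h⟩ := exists_coeff_of_isAlgebraic_near ha hab
    rw [← RingHom.map_closure] at hq
    choose c hc hcq using hq
    have hq' : (∑ i ∈ Finset.range (q.natDegree + 1), C (c i) * X ^ i).map φ = q := by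
      conv_rhs => rw [q.as_sum_range_C_mul_X_pow]
      rw [Polynomial.map_sum]
      refine Finset.sum_congr rfl fun i _ => ?_
      rw [Polynomial.map_mul, map_C, Polynomial.map_pow, map_X, hcq]
    refine ⟨∑ i ∈ Finset.range (q.natDegree + 1), C (c i) * X ^ i, fun n => ?_, j, hj, ?_⟩
    · simp only [finsetSum_coeff, coeff_C_mul, coeff_X_pow]
      refine sum_mem fun i _ => mul_mem (hc i) ?_
      split_ifs
      exacts [one_mem _, zero_mem _]
    · rw [← hcoeff, ← hcoeff, hq']
      exact h
  · rintro ⟨q, hq, j, hj, h⟩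
    rw [← hcoeff, ← hcoeff] at h
    refine exists_isAlgebraic_near_of_coeff hε (IsAlgClosed.splits (q.map φ)) (fun n => ?_)
      ⟨j, hj, h⟩
    rw [coeff_map]
    refine (Subring.closure_le (t := (Subfield.closure (φ '' S)).toSubring)).mpr
      Subfield.subset_closure ?_
    rw [← RingHom.map_closure]
    exact ⟨_, hq n, rfl⟩

variable [IsUltrametricDist L] [CompleteSpace L] {k : Type*} [Field k] [Algebra k L]

/-- Generation can be tested in every algebraically closed ultrametric extension. -/
theorem isTAGenerating_iff_of_isometry {φ : L →+* W} (hφ : ∀ x, ‖φ x‖ = ‖x‖) {S : Set L} :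
    IsTAGenerating k S ↔
      Set.range φ ⊆ taClosure (φ '' Set.range (algebraMap k L) ∪ φ '' S) := by
  rw [isTAGenerating_iff, Set.range_subset_iff, ← Set.image_union]
  refine forall_congr' fun b => ?_
  rw [mem_taClosure_image_iff (norm_algebraMap_completedAlgClosure L), mem_taClosure_image_iff hφ]

theorem topdeg_le {S : Set L} (h : IsTAGenerating k S) : Topdeg k L ≤ #S :=
  csInf_le' ⟨S, h, rfl⟩

variable (L k) in
theorem exists_isTAGenerating : ∃ S : Set L, IsTAGenerating k S ∧ #S = Topdeg k L := by
  refine csInf_mem (s := {c : Cardinal | ∃ S : Set L, IsTAGenerating k S ∧ #S = c})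
    ⟨_, Set.univ, isTAGenerating_iff.mpr fun b => ?_, rfl⟩
  exact subset_taClosure _ ⟨b, Or.inr trivial, rfl⟩

end Transfer

end AnalyticField
end

/-! ### The degree of subfields and of completed unions. -/

noncomputable section

namespace AnalyticField

section Union

variable {k K : Type*} [NormedField k] [NormedField K] [IsUltrametricDist K] [NormedAlgebra k K]
  {W : Type*} [NormedField W] [IsUltrametricDist W] [IsAlgClosed W]
  {ψ : K →+* W}

theorem isTAGenerating_intermediateField_iff (hψ : ∀ x, ‖ψ x‖ = ‖x‖) (E : IntermediateField k K)
    [CompleteSpace E] {S : Set E} : IsTAGenerating k S ↔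
      ψ '' E ⊆ taClosure (ψ '' Set.range (algebraMap k K) ∪ ψ '' (Subtype.val '' S)) := by
  rw [isTAGenerating_iff_of_isometry (φ := ψ.comp (algebraMap E K)) (fun x => hψ x)]
  have h1 : Set.range (ψ.comp (algebraMap E K)) = ψ '' E := by
    rw [RingHom.coe_comp, Set.range_comp]
    exact congrArg _ Subtype.range_coe
  have h2 : ψ.comp (algebraMap E K) '' Set.range (algebraMap k E) =
      ψ '' Set.range (algebraMap k K) := by
    rw [RingHom.coe_comp, Set.image_comp, ← Set.range_comp]
    rfl
  have h3 : ψ.comp (algebraMap E K) '' S = ψ '' (Subtype.val '' S) := by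
    rw [RingHom.coe_comp, Set.image_comp]
    rfl
  rw [h1, h2, h3]

theorem exists_fin_tuple_of_topdeg_le (hψ : ∀ x, ‖ψ x‖ = ‖x‖) (E : IntermediateField k K)
    [CompleteSpace E] {d : ℕ} (hd : Topdeg k E ≤ d) :
    ∃ y : Fin d → W, (∀ j, y j ∈ ψ '' E) ∧
      ψ '' E ⊆ taClosure (ψ '' Set.range (algebraMap k K) ∪ Set.range y) := by
  obtain ⟨S, hS, hcard⟩ := exists_isTAGenerating E k
  rw [isTAGenerating_intermediateField_iff hψ] at hS
  obtain ⟨y, hy, hSy⟩ := exists_fin_tuple (d := d) (T := Subtype.val '' S) (V := (E : Set K))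
    (Cardinal.mk_image_le.trans (hcard.le.trans hd)) (by rintro _ ⟨e, -, rfl⟩; exact e.2)
    (zero_mem E)
  refine ⟨ψ ∘ y, fun j => ⟨_, hy j, rfl⟩, hS.trans (taClosure_mono ?_)⟩
  rw [Set.range_comp]
  exact Set.union_subset_union_right _ (Set.image_mono hSy)

theorem topdeg_le_of_fin_tuple (hψ : ∀ x, ‖ψ x‖ = ‖x‖) (E : IntermediateField k K)
    [CompleteSpace E] {d : ℕ} {y : Fin d → W} (hy : ∀ j, y j ∈ ψ '' E)
    (hgen : ψ '' E ⊆ taClosure (ψ '' Set.range (algebraMap k K) ∪ Set.range y)) :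
    Topdeg k E ≤ d := by
  choose z hz hzy using hy
  have h : IsTAGenerating k (Set.range fun j => (⟨z j, hz j⟩ : E)) := by
    rw [isTAGenerating_intermediateField_iff hψ]
    refine hgen.trans (taClosure_mono (Set.union_subset_union_right _ ?_))
    rintro _ ⟨j, rfl⟩
    exact ⟨z j, ⟨_, ⟨j, rfl⟩, rfl⟩, hzy j⟩
  refine (topdeg_le h).trans ?_
  have := Cardinal.mk_range_le_lift (f := fun j => (⟨z j, hz j⟩ : E))
  simpa using this

/-- The topological generating degree is monotone among extensions of finite degree. -/
theorem topdeg_mono (hψ : ∀ x, ‖ψ x‖ = ‖x‖) {E E' : IntermediateField k K} [CompleteSpace E]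
    [CompleteSpace E'] (hE : E ≤ E') {d e : ℕ} (hd : Topdeg k E = d) (he : Topdeg k E' ≤ e) :
    d ≤ e := by
  obtain ⟨y, -, hy⟩ := exists_fin_tuple_of_topdeg_le hψ E' he
  obtain ⟨z, hzE, hz⟩ := exists_fin_tuple_of_topdeg_le hψ E hd.le
  have hzy : Set.range z ⊆ ψ '' E' := by
    rintro _ ⟨j, rfl⟩
    exact Set.image_mono hE (hzE j)
  -- The generators of the smaller field lie in the closure of at most `e` elements, so at most `e`
  -- of them already generate it; unlike the elements of `y`, these belong to the smaller field.
  obtain ⟨T, hT, hcard, hgen⟩ := exists_generating_subset (Set.finite_range y)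
    (ncard_range_fin_le y) (Set.finite_range z) (hzy.trans hy)
  have hfin : T.Finite := (Set.finite_range z).subset hT
  have hTe : #T ≤ (e : ℕ) := by
    have : Fintype T := hfin.fintype
    rw [Cardinal.mk_fintype, ← Nat.card_eq_fintype_card]
    exact_mod_cast hcard
  obtain ⟨x, hx, hTx⟩ := exists_fin_tuple (V := ψ '' E) hTe
    (hT.trans (by rintro _ ⟨j, rfl⟩; exact hzE j)) ⟨0, zero_mem E, map_zero ψ⟩
  have h := topdeg_le_of_fin_tuple hψ E hx (hz.trans (taClosure_subset (Set.union_subset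
    (Set.subset_union_left.trans (subset_taClosure _))
    (hgen.trans (taClosure_mono (Set.union_subset_union_right _ hTx))))))
  rw [hd] at h
  exact_mod_cast h

/-- Baire category needs a countable family, so the family is replaced by a countable cofinal part.
A tuple in the closure of the union that generates each of its members generates the completed
union, because `taClosure` is topologically closed. -/
theorem topdeg_completedUnion_le [CompleteSpace K] [CompleteSpace W] (hψ : ∀ x, ‖ψ x‖ = ‖x‖)
    {ι : Type*} [Nonempty ι] (F : ι → IntermediateField k K) [∀ i, CompleteSpace (F i)]
    (hF : Directed (· ≤ ·) F) (hcof : Order.cof (Set.range F) ≤ ℵ₀) {d : ℕ}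
    (hd : ∀ i, Topdeg k (F i) ≤ d) : Topdeg k (completedUnion F) ≤ d := by
  obtain ⟨c, hc, hcard⟩ := Order.exists_cof_eq (Set.range F)
  have hcount : Countable c := Cardinal.mk_le_aleph0_iff.mp (hcard.le.trans hcof)
  have hne : Nonempty c := by
    obtain ⟨b, hb, -⟩ := hc ⟨F (Classical.arbitrary ι), _, rfl⟩
    exact ⟨⟨b, hb⟩⟩
  have hiso : Isometry ψ := AddMonoidHomClass.isometry_of_norm ψ hψ
  choose i hi using fun b : c => b.1.2
  have hex : ∀ j, ∃ b : c, F j ≤ F (i b) := fun j => by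
    obtain ⟨b, hb, hle⟩ := hc ⟨F j, j, rfl⟩
    exact ⟨⟨b, hb⟩, (hi ⟨b, hb⟩).symm ▸ hle⟩
  let L : c → Subfield W := fun b => (F (i b)).toSubfield.map ψ
  have hLc : ∀ b, (L b : Set W) = ψ '' (F (i b) : Set K) := fun b => rfl
  have hLdir : Directed (· ≤ ·) L := by
    intro a b
    obtain ⟨j, haj, hbj⟩ := hF (i a) (i b)
    obtain ⟨e, he⟩ := hex j
    exact ⟨e, Set.image_mono (haj.trans he), Set.image_mono (hbj.trans he)⟩
  have hLgen := fun b => exists_fin_tuple_of_topdeg_le hψ (F (i b)) (hd (i b))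
  have hcl : IsClosed (ψ '' (completedUnion F : Set K)) :=
    hiso.isClosedEmbedding.isClosedMap _ isClosed_closure
  have hLU : closure (⋃ b, (L b : Set W)) ⊆ ψ '' (completedUnion F : Set K) := by
    refine closure_minimal (Set.iUnion_subset fun b => Set.image_mono ?_) hcl
    exact (le_iSup F (i b)).trans subset_closure
  obtain ⟨x, hx, hgen⟩ : ∃ x : Fin d → W, (∀ j, x j ∈ closure (⋃ b, (L b : Set W))) ∧
      ∀ b, (L b : Set W) ⊆ taClosure (ψ '' Set.range (algebraMap k K) ∪ Set.range x) := by
    by_cases hnt : ∃ b, ∃ w ∈ L b, w ≠ 0 ∧ ‖w‖ ≠ 1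
    · exact exists_generating_of_directed hLdir hLgen hnt
    · push Not at hnt
      obtain ⟨x, hx, h⟩ := exists_generating_of_trivial hLdir
        (B := ψ '' Set.range (algebraMap k K)) (fun b => Set.image_mono (by
          rintro _ ⟨a, rfl⟩
          exact (F (i b)).algebraMap_mem a)) hLgen hnt
      exact ⟨x, fun j => subset_closure (hx j), h⟩
  refine topdeg_le_of_fin_tuple hψ _ (fun j => hLU (hx j)) ?_
  rw [coe_completedUnion F hF]
  refine (image_closure_subset_closure_image hiso.continuous).trans ?_
  refine closure_minimal ?_ isClosed_closure
  rw [Set.image_iUnion]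
  refine Set.iUnion_subset fun j => ?_
  obtain ⟨b, hb⟩ := hex j
  exact (Set.image_mono hb).trans (hgen b)

end Union

end AnalyticField
end

theorem mainTheorem6 {k K : Type*}
    [NormedField k] [IsUltrametricDist k] [CompleteSpace k]
    [NormedField K] [IsUltrametricDist K] [CompleteSpace K] [NormedAlgebra k K]
    {ι : Type*} (F : ι → IntermediateField k K) [∀ i, CompleteSpace (F i)]
    (hF : Directed (· ≤ ·) F) (hcof : Order.cof (Set.range F) ≤ ℵ₀)
    (d : ℕ)
    (hd : IsGreatest (Set.range fun i => AnalyticField.Topdeg k (F i)) (d : Cardinal)) :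
    AnalyticField.Topdeg k (AnalyticField.completedUnion F) = (d : Cardinal) := by
  obtain ⟨⟨i₀, hi₀⟩, hmax⟩ := hd
  have hne : Nonempty ι := ⟨i₀⟩
  have hψ := AnalyticField.norm_algebraMap_completedAlgClosure K
  have hle := AnalyticField.topdeg_completedUnion_le hψ F hF hcof fun i => hmax ⟨i, rfl⟩
  -- The upper bound makes the degree of the union finite, which monotonicity requires; the member
  -- that attains `d` then gives the lower bound.
  obtain ⟨e, he⟩ := Cardinal.lt_aleph0.mp (hle.trans_lt Cardinal.natCast_lt_aleph0)
  refine le_antisymm hle ?_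
  rw [he]
  exact_mod_cast AnalyticField.topdeg_mono hψ (E := F i₀) (E' := AnalyticField.completedUnion F)
    ((le_iSup F i₀).trans subset_closure) hi₀ he.le
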